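/- Let $n\ge 1$, $a_j\in\mathbb R\setminus\{0\}$ and $k_j\in\{2,3,4,\dots\}$ for $j=1,\dots,n$. Put $$a(\xi)=\sum_{j=1}^n a_j\xi_j^{k_j},\qquad p=2-\frac{2}{2+\sum_{j=1}^n \frac1{k_j}},\qquad p'=\frac{p}{p-1}.$$ There is a constant $C$, depending only on $n$, $(a_j)$ and $(k_j)$, such that the following holds for all $\phi\in L^2(\mathbb R^n)$ and $f\in L^p(\mathbb R^{1+n})$ (complex-valued). Let $u$ be a solution of the initial value problem $$D_t u-a(D)u=f \ \text{ in }\mathbb R^{1+n},\qquad u(0,\cdot)=\phi \ \text{ in }\mathbb R^n,$$ where $D_t=-i\,\partial/\partial t$, $D_j=-i\,\partial/\partial x_j$ and $a(D)=\sum_j a_jD_j^{k_j}$; that is, $u\in C(\mathbb R;\mathscr S'(\mathbb R^n))$ (for the weak topology of the space of tempered distributions), the equation holds in the sense of distributions on $\mathbb R^{1+n}$, and $u(0)=\phi$. Then $u$ is a function in $L^{p'}(\mathbb R^{1+n})$ (meaning that there is $U\in L^{p'}(\mathbb R^{1+n})$ such that $u(t)=U(t,\cdot)$ for almost every $t$),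 and $$\|u\|_{L^{p'}(\mathbb R^{1+n})}\le C\bigl(\|\phi\|_{L^2(\mathbb R^n)}+\|f\|_{L^p(\mathbb R^{1+n})}\bigr).$$ -/

import Mathlib

open MeasureTheory Complex
open scoped SchwartzMap LineDeriv NNReal ENNReal ContDiff

noncomputable section

namespace Dispersive

/-- The Euclidean space `ℝⁿ` with its Euclidean norm and Lebesgue measure. -/
abbrev Space (n : ℕ) : Type := EuclideanSpace ℝ (Fin n)

/-- `D_j = -i ∂/∂x_j`, acting on tempered distributions on `ℝⁿ`. -/
def partialD {n : ℕ} (j : Fin n) (T : 𝓢'(Space n, ℂ)) : 𝓢'(Space n, ℂ) :=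
  (-I) • ∂_{(EuclideanSpace.single j (1 : ℝ) : Space n)} T

/-- `a(D) = ∑_j a_j D_j^{k_j}`, for the symbol `a(ξ) = ∑_j a_j ξ_j^{k_j}`,
acting on tempered distributions on `ℝⁿ`. -/
def symbolD {n : ℕ} (a : Fin n → ℝ) (k : Fin n → ℕ) (T : 𝓢'(Space n, ℂ)) : 𝓢'(Space n, ℂ) :=
  ∑ j, (a j : ℂ) • (partialD j)^[k j] T

/-- The tempered distribution `T` on `ℝⁿ` is the function `g`. -/
def IsFunction {n : ℕ} (T : 𝓢'(Space n, ℂ)) (g : Space n → ℂ) : Prop :=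
  ∀ ψ : 𝓢(Space n, ℂ), Integrable (fun x ↦ g x * ψ x) ∧ T ψ = ∫ x, g x * ψ x

/-- `u ∈ C(ℝ; 𝓢'(ℝⁿ))` (Mathlib's topology on `𝓢'` is the weak one: pointwise convergence on
Schwartz functions) solves `D_t u - a(D) u = f` on `ℝ × ℝⁿ`, `D_t = -i ∂/∂t`, in the sense of
distributions, with `u(0) = φ`. -/
structure IsSolution {n : ℕ} (a : Fin n → ℝ) (k : Fin n → ℕ) (φ : Space n → ℂ)
    (f : ℝ × Space n → ℂ) (u : ℝ → 𝓢'(Space n, ℂ)) : Prop where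
  continuous : Continuous u
  /-- The equation, tested against `η(t) ψ(x)`; in the first term `D_t` has been moved to `η`,
  using `⟨D_t v, η⟩ = -⟨v, D_t η⟩`. -/
  equation : ∀ (η : ℝ → ℂ) (ψ : 𝓢(Space n, ℂ)), ContDiff ℝ ∞ η → HasCompactSupport η →
    (-∫ t, u t ψ * ((-I) * deriv η t)) - ∫ t, symbolD a k (u t) ψ * η t =
      ∫ z : ℝ × Space n, f z * (η z.1 * ψ z.2)
  initial : IsFunction (u 0) φ

end Dispersive

end

/-! Write `σ = ∑ 1 / k_j` and let `S_r` be the unitary group `exp (i r a(D))`, transposed so that it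
acts on test functions. A solution should satisfy Duhamel's formula `u_T(ψ) = ∫ φ S_T ψ + i ∫_0^T
⟨f_r, S_{T-r} ψ⟩ dr`, and the estimate is then of Strichartz type.

Decay: the symbol is a sum of functions of single variables, so the kernel of `S_r`, cut off to a
frequency cube, is a product of one-dimensional oscillatory integrals. Van der Corput bounds the
factors by multiples of `|r| ^ (-1/k_j)`, uniformly in the cutoff and in the linear phase. This
gives an `L¹ → L^∞` bound of size `|r| ^ (-σ)`. Interpolation with the `L²` isometry
(`norm_bilin_le_interpolation`) gives an `L^p → L^{p'}` bound of size `|r| ^ (-α)` with `α = (2/p -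
1) σ = σ / (1 + σ)`. The stated `p` is exactly `2 / (2 - α)`, for which convolution with `|t| ^
(-α)` maps `L^p(ℝ)` to `L^{p'}(ℝ)` by Hardy–Littlewood–Sobolev (`rieszForm_le`).

Duality: pair `u` with a sum `g` of tensors `η(t) ψ(x)`. The inhomogeneous part is bounded by the
Riesz form of the slice norms of `f` and `g`. For the homogeneous part, the `TT*` argument writes
`‖∫ S_t g_t dt‖²` as a double integral of `⟨g_t, S_{r-t} g_r⟩`, which is again bounded by a Riesz
form. Hence the pairing is bounded by the `L^p` norm of `g`; Hahn–Banach and the Riesz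
representation of functionals on `L^p` produce `U ∈ L^{p'}`.

Since `u` is only weakly continuous with values in tempered distributions, Duhamel's formula needs
an argument. Banach–Steinhaus on the Fréchet space of Schwartz functions gives local equicontinuity
of `t ↦ u_t`; combined with a Taylor expansion of `S_r ψ` in every continuous seminorm, this allows
differentiating `s ↦ u_s(S_{T-s} ψ)`. Finally, identifying `u_t` with `U(t, ·)` for almost every `t`
requires a null set independent of the test function. It comes from a countable set of Schwartz
functions dense for the `L² ∩ L^p` norm, together with a fixed-time bound valid at almost every `t`.
-/

/-! ### Oscillatory integrals in one variable -/

namespace Dispersive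

open intervalIntegral Set

/-- First derivative test. -/
theorem norm_integral_exp_le_of_one_le_deriv {a b : ℝ} (hab : a ≤ b) {P P' P'' : ℝ → ℝ}
    (hP : ∀ x, HasDerivAt P (P' x) x) (hP' : ∀ x, HasDerivAt P' (P'' x) x)
    (hc : Continuous P'') (h2 : ∀ x ∈ Icc a b, 0 ≤ P'' x) (h1 : ∀ x ∈ Icc a b, 1 ≤ P' x) :
    ‖∫ x in a..b, cexp (I * P x)‖ ≤ 3 := by
  have huIcc : uIcc a b = Icc a b := uIcc_of_le hab
  have hcP : Continuous P := continuous_iff_continuousAt.2 fun x ↦ (hP x).continuousAt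
  have hcP' : Continuous P' := continuous_iff_continuousAt.2 fun x ↦ (hP' x).continuousAt
  set u : ℝ → ℝ := fun x ↦ (P' x)⁻¹ with hu
  set u' : ℝ → ℝ := fun x ↦ -P'' x / (P' x) ^ 2 with hu'
  set v : ℝ → ℂ := fun x ↦ -I * cexp (I * P x) with hv
  have hpos : ∀ x ∈ Icc a b, 0 < P' x := fun x hx ↦ lt_of_lt_of_le one_pos (h1 x hx)
  have hdu : ∀ x ∈ uIcc a b, HasDerivAt u (u' x) x := fun x hx ↦
    (hP' x).inv (hpos x (huIcc ▸ hx)).ne'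
  have hdv : ∀ x, HasDerivAt v (P' x * cexp (I * P x)) x := by
    intro x
    have := (((hP x).ofReal_comp.const_mul I).cexp).const_mul (-I)
    refine this.congr_deriv ?_
    ring_nf
    simp
  have hcu' : ContinuousOn u' (uIcc a b) := by
    rw [huIcc]
    refine ContinuousOn.div hc.neg.continuousOn (hcP'.pow 2).continuousOn fun x hx ↦ ?_
    have := hpos x hx
    positivity
  have hiu' : IntervalIntegrable u' volume a b := hcu'.intervalIntegrable
  have hiuC : IntervalIntegrable (fun x ↦ (u' x : ℂ)) volume a b :=
    (continuous_ofReal.comp_continuousOn hcu').intervalIntegrable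
  have hv' : IntervalIntegrable (fun x ↦ P' x * cexp (I * P x)) volume a b := by
    apply Continuous.intervalIntegrable
    fun_prop
  -- Integrate by parts in `(1 / P') * (P' exp (iP))`. Each boundary term is at most 1, and since `1
  -- / P'` is decreasing its total variation is at most 1: this is the constant 3.
  have hparts := integral_mul_deriv_eq_deriv_mul (u := fun x ↦ (u x : ℂ)) (v := v)
    (u' := fun x ↦ (u' x : ℂ)) (v' := fun x ↦ P' x * cexp (I * P x))
    (fun x hx ↦ (hdu x hx).ofReal_comp) (fun x _ ↦ hdv x) hiuC hv'
  have hlhs : ∫ x in a..b, (u x : ℂ) * (P' x * cexp (I * P x)) = ∫ x in a..b, cexp (I * P x) := by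
    refine integral_congr fun x hx ↦ ?_
    have : (P' x : ℂ) ≠ 0 := by exact_mod_cast (hpos x (huIcc ▸ hx)).ne'
    simp only [hu, ofReal_inv]
    field_simp
  have hnv : ∀ x, ‖v x‖ = 1 := by
    intro x
    simp only [hv, norm_mul, norm_neg, norm_I, one_mul]
    rw [mul_comm]; exact norm_exp_ofReal_mul_I _
  have hub : ∀ x ∈ Icc a b, ‖(u x : ℂ)‖ ≤ 1 := by
    intro x hx
    have h := h1 x hx
    rw [norm_real, Real.norm_of_nonneg (inv_nonneg.2 (hpos x hx).le)]
    exact inv_le_one_of_one_le₀ h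
  have hint : ‖∫ x in a..b, (u' x : ℂ) * v x‖ ≤ 1 := by
    have hle : ‖∫ x in a..b, (u' x : ℂ) * v x‖ ≤ ∫ x in a..b, -u' x := by
      refine norm_integral_le_of_norm_le hab ?_ hiu'.neg
      refine Filter.Eventually.of_forall fun x hx ↦ ?_
      have hx' : x ∈ Icc a b := Ioc_subset_Icc_self hx
      rw [norm_mul, hnv, mul_one, norm_real, Real.norm_eq_abs, abs_of_nonpos]
      have := h2 x hx'
      simp only [hu']
      exact div_nonpos_of_nonpos_of_nonneg (by linarith) (by positivity)
    rw [intervalIntegral.integral_neg, integral_eq_sub_of_hasDerivAt hdu hiu'] at hle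
    have ha := h1 a (left_mem_Icc.2 hab)
    have hb := hpos b (right_mem_Icc.2 hab)
    have h1' : u a ≤ 1 := inv_le_one_of_one_le₀ ha
    have h2' : 0 ≤ u b := inv_nonneg.2 hb.le
    linarith
  rw [hlhs] at hparts
  rw [hparts]
  have e1 : ‖(u b : ℂ) * v b‖ ≤ 1 := by
    rw [norm_mul, hnv, mul_one]; exact hub b (right_mem_Icc.2 hab)
  have e2 : ‖(u a : ℂ) * v a‖ ≤ 1 := by
    rw [norm_mul, hnv, mul_one]; exact hub a (left_mem_Icc.2 hab)
  calc _ ≤ ‖(u b : ℂ) * v b‖ + ‖(u a : ℂ) * v a‖ + ‖∫ x in a..b, (u' x : ℂ) * v x‖ :=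
        (norm_sub_le _ _).trans (add_le_add_left (norm_sub_le _ _) _)
    _ ≤ 3 := by linarith

theorem norm_integral_exp_le_sub {a b : ℝ} (hab : a ≤ b) (P : ℝ → ℝ) :
    ‖∫ x in a..b, cexp (I * P x)‖ ≤ b - a := by
  have := norm_integral_le_of_norm_le_const (a := a) (b := b) (C := 1)
    (f := fun x ↦ cexp (I * P x)) fun x _ ↦ by
      rw [mul_comm, norm_exp_ofReal_mul_I]
  rwa [one_mul, abs_of_nonneg (by linarith)] at this

/-- Since `P'` grows at rate at least 1 from a nonnegative value, it exceeds 1 after one unit of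
length. The trivial bound on that unit and the first derivative test beyond it give 1 + 3. -/
theorem norm_integral_exp_le_of_deriv_nonneg {a b : ℝ} (hab : a ≤ b) {P P' P'' : ℝ → ℝ}
    (hP : ∀ x, HasDerivAt P (P' x) x) (hP' : ∀ x, HasDerivAt P' (P'' x) x)
    (hc : Continuous P'') (h2 : ∀ x ∈ Icc a b, 1 ≤ P'' x) (h1 : 0 ≤ P' a) :
    ‖∫ x in a..b, cexp (I * P x)‖ ≤ 4 := by
  rcases le_total b (a + 1) with h | h
  · exact (norm_integral_exp_le_sub hab P).trans (by linarith)
  have hcP : Continuous P := continuous_iff_continuousAt.2 fun x ↦ (hP x).continuousAt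
  have hcP' : Continuous P' := continuous_iff_continuousAt.2 fun x ↦ (hP' x).continuousAt
  have hci : ∀ c d : ℝ, IntervalIntegrable (fun x ↦ cexp (I * P x)) volume c d := fun c d ↦ by
    apply Continuous.intervalIntegrable; fun_prop
  have hmono : MonotoneOn (fun x ↦ P' x - x) (Icc a b) := by
    refine monotoneOn_of_deriv_nonneg (convex_Icc a b) (by fun_prop) ?_ ?_
    · intro x _
      exact ((hP' x).sub (hasDerivAt_id x)).differentiableAt.differentiableWithinAt
    · intro x hx
      have hd : HasDerivAt (fun x ↦ P' x - x) (P'' x - 1) x := (hP' x).sub (hasDerivAt_id x)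
      rw [hd.deriv]
      have := h2 x (interior_subset hx)
      linarith
  rw [← integral_add_adjacent_intervals (hci a (a + 1)) (hci (a + 1) b)]
  have e1 := norm_integral_exp_le_sub (show a ≤ a + 1 by linarith) P
  have e2 : ‖∫ x in (a + 1)..b, cexp (I * P x)‖ ≤ 3 := by
    refine norm_integral_exp_le_of_one_le_deriv h hP hP' hc ?_ ?_
    · intro x hx
      have := h2 x ⟨by linarith [hx.1], hx.2⟩
      linarith
    · intro x hx
      have := hmono (left_mem_Icc.2 hab) ⟨by linarith [hx.1], hx.2⟩ (by linarith [hx.1] : a ≤ x)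
      simp only at this
      linarith [hx.1]
  exact (norm_add_le _ _).trans (by linarith)

/-- Second derivative test. -/
theorem norm_integral_exp_le_of_one_le_deriv2 {a b : ℝ} (hab : a ≤ b) {P P' P'' : ℝ → ℝ}
    (hP : ∀ x, HasDerivAt P (P' x) x) (hP' : ∀ x, HasDerivAt P' (P'' x) x)
    (hc : Continuous P'') (h2 : ∀ x ∈ Icc a b, 1 ≤ P'' x) :
    ‖∫ x in a..b, cexp (I * P x)‖ ≤ 8 := by
  have hcP : Continuous P := continuous_iff_continuousAt.2 fun x ↦ (hP x).continuousAt
  have hcP' : Continuous P' := continuous_iff_continuousAt.2 fun x ↦ (hP' x).continuousAt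
  have hci : ∀ c d : ℝ, IntervalIntegrable (fun x ↦ cexp (I * P x)) volume c d := fun c d ↦ by
    apply Continuous.intervalIntegrable; fun_prop
  -- To the left of a zero of `P'` the reflection `x ↦ -x` restores the previous situation; the two
  -- sides contribute 4 each.
  have hrefl : ∀ c ∈ Icc a b, P' c ≤ 0 → ‖∫ x in a..c, cexp (I * P x)‖ ≤ 4 := by
    intro c hcI hc0
    have h := norm_integral_exp_le_of_deriv_nonneg (a := -c) (b := -a) (by linarith [hcI.1])
      (P := fun x ↦ P (-x)) (P' := fun x ↦ -P' (-x)) (P'' := fun x ↦ P'' (-x))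
      (fun x ↦ by
        have := (hP (-x)).comp x (hasDerivAt_neg x)
        exact this.congr_deriv (by ring))
      (fun x ↦ by
        have := ((hP' (-x)).comp x (hasDerivAt_neg x)).neg
        exact this.congr_deriv (by ring))
      (by fun_prop)
      (fun x hx ↦ h2 _ ⟨by linarith [hx.2], by linarith [hx.1, hcI.2]⟩)
      (by simpa using hc0)
    rwa [intervalIntegral.integral_comp_neg (fun x ↦ cexp (I * P x)), neg_neg, neg_neg] at h
  rcases le_total 0 (P' a) with ha | ha
  · exact (norm_integral_exp_le_of_deriv_nonneg hab hP hP' hc h2 ha).trans (by norm_num)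
  rcases le_total (P' b) 0 with hb | hb
  · exact (hrefl b (right_mem_Icc.2 hab) hb).trans (by norm_num)
  obtain ⟨c, hcI, hc0⟩ := intermediate_value_Icc hab hcP'.continuousOn ⟨ha, hb⟩
  rw [← integral_add_adjacent_intervals (hci a c) (hci c b)]
  have e1 := hrefl c hcI hc0.le
  have e2 := norm_integral_exp_le_of_deriv_nonneg hcI.2 hP hP' hc
    (fun x hx ↦ h2 x ⟨hcI.1.trans hx.1, hx.2⟩) hc0.ge
  exact (norm_add_le _ _).trans (by linarith)

/-- The linear term does not affect the second derivative `k (k - 1) x ^ (k - 2)`, which is at least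
1 for `x ≥ 1`. Hence a bound uniform in `y` and `R`: 1 from `[0, 1]` and 8 from the rest. -/
theorem norm_integral_exp_pow_le_nine {k : ℕ} (hk : 2 ≤ k) (y R : ℝ) (hR : 0 ≤ R) :
    ‖∫ x in (0 : ℝ)..R, cexp (I * ((x ^ k + y * x : ℝ) : ℂ))‖ ≤ 9 := by
  have hci : ∀ c d : ℝ, IntervalIntegrable
      (fun x : ℝ ↦ cexp (I * ((x ^ k + y * x : ℝ) : ℂ))) volume c d := fun c d ↦ by
    apply Continuous.intervalIntegrable; fun_prop
  rcases le_total R 1 with h | h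
  · exact (norm_integral_exp_le_sub hR fun x ↦ x ^ k + y * x).trans (by linarith)
  rw [← integral_add_adjacent_intervals (hci 0 1) (hci 1 R)]
  have e1 := norm_integral_exp_le_sub (zero_le_one (α := ℝ)) fun x ↦ x ^ k + y * x
  have e2 := norm_integral_exp_le_of_one_le_deriv2 h (P := fun x ↦ x ^ k + y * x)
    (P' := fun x ↦ k * x ^ (k - 1) + y) (P'' := fun x ↦ k * ((k - 1 : ℕ) * x ^ (k - 1 - 1)))
    (fun x ↦ by
      simpa [Function.comp_def] using (hasDerivAt_pow k x).fun_add ((hasDerivAt_id' x).const_mul y))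
    (fun x ↦ by simpa using ((hasDerivAt_pow (k - 1) x).const_mul (k : ℝ)).add_const y)
    (by fun_prop) (by
      intro x hx
      have h1 : (1 : ℝ) ≤ x ^ (k - 1 - 1) := one_le_pow₀ hx.1
      have h2 : (1 : ℝ) ≤ (k - 1 : ℕ) := by exact_mod_cast (by omega : 1 ≤ k - 1)
      have h3 : (1 : ℝ) ≤ k := by exact_mod_cast (by omega : 1 ≤ k)
      nlinarith [one_le_mul_of_one_le_of_one_le h2 h1])
  refine (norm_add_le _ _).trans ?_
  linarith

theorem norm_integral_exp_mul_pow_le_of_sign {k : ℕ} (hk : 2 ≤ k) {s : ℝ} (hs : s = 1 ∨ s = -1)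
    (y R : ℝ) (hR : 0 ≤ R) :
    ‖∫ x in (0 : ℝ)..R, cexp (I * ((s * x ^ k + y * x : ℝ) : ℂ))‖ ≤ 9 := by
  rcases hs with rfl | rfl
  · simpa using norm_integral_exp_pow_le_nine hk y R hR
  · have h := norm_integral_exp_pow_le_nine hk (-y) R hR
    -- Changing the sign of the leading coefficient amounts to complex conjugation, with `y`
    -- replaced by `-y`.
    have hconj : (fun x : ℝ ↦ cexp (I * ((-1 * x ^ k + y * x : ℝ) : ℂ))) =
        fun x : ℝ ↦ (starRingEnd ℂ) (cexp (I * ((x ^ k + -y * x : ℝ) : ℂ))) := by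
      funext x
      rw [← Complex.exp_conj, map_mul, conj_I, conj_ofReal]
      push_cast
      ring_nf
    rw [hconj, intervalIntegral.intervalIntegral_conj, RCLike.norm_conj]
    exact h

/-- Van der Corput's estimate for the phases `c x ^ k + y x`. -/
theorem norm_integral_exp_mul_pow_add_le {k : ℕ} (hk : 2 ≤ k) {c : ℝ} (hc : c ≠ 0) (y R : ℝ)
    (hR : 0 ≤ R) :
    ‖∫ x in (-R)..R, cexp (I * ((c * x ^ k + y * x : ℝ) : ℂ))‖ ≤ 18 * |c| ^ (-(1 / k : ℝ)) := by
  have hk0 : (k : ℝ) ≠ 0 := by positivity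
  have hcpos : 0 < |c| := abs_pos.2 hc
  -- Rescaling by `l = |c| ^ (1/k)` normalises the leading coefficient to `±1`; the Jacobian `l⁻¹`
  -- is the decay factor.
  set l : ℝ := |c| ^ (1 / k : ℝ) with hl
  have hlpos : 0 < l := Real.rpow_pos_of_pos hcpos _
  have hlk : l ^ k = |c| := by
    rw [hl, ← Real.rpow_natCast, ← Real.rpow_mul hcpos.le, one_div_mul_cancel hk0, Real.rpow_one]
  have half : ∀ (s : ℝ) (y : ℝ), |s| = 1 →
      ‖∫ x in (0 : ℝ)..R, cexp (I * ((s * |c| * x ^ k + y * x : ℝ) : ℂ))‖ ≤ 9 * l⁻¹ := by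
    intro s y hs
    have hs' : s = 1 ∨ s = -1 := by
      rcases abs_choice s with h | h
      · left; rw [← h, hs]
      · right; rw [hs] at h; linarith
    have h := norm_integral_exp_mul_pow_le_of_sign hk hs' (y / l) (l * R) (by positivity)
    have hsub := intervalIntegral.integral_comp_mul_left (a := 0) (b := R) (c := l)
      (fun x : ℝ ↦ cexp (I * ((s * x ^ k + y / l * x : ℝ) : ℂ))) hlpos.ne'
    rw [mul_zero] at hsub
    have hcongr : (fun x : ℝ ↦ cexp (I * ((s * (l * x) ^ k + y / l * (l * x) : ℝ) : ℂ)))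
        = fun x : ℝ ↦ cexp (I * ((s * |c| * x ^ k + y * x : ℝ) : ℂ)) := by
      funext x
      rw [mul_pow, hlk]
      congr 3
      field_simp
    rw [hcongr] at hsub
    rw [hsub, norm_smul, Real.norm_of_nonneg (inv_nonneg.2 hlpos.le), mul_comm]
    exact mul_le_mul_of_nonneg_right h (inv_nonneg.2 hlpos.le)
  have hci : ∀ d e : ℝ, IntervalIntegrable
      (fun x : ℝ ↦ cexp (I * ((c * x ^ k + y * x : ℝ) : ℂ))) volume d e := fun d e ↦ by
    apply Continuous.intervalIntegrable; fun_prop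
  have hsgn : |(SignType.sign c : ℝ)| = 1 := by
    rcases hc.lt_or_gt with h | h
    · simp [sign_neg h]
    · simp [sign_pos h]
  have hsc : (SignType.sign c : ℝ) * |c| = c := sign_mul_abs c
  have e1 : ‖∫ x in (0 : ℝ)..R, cexp (I * ((c * x ^ k + y * x : ℝ) : ℂ))‖ ≤ 9 * l⁻¹ := by
    have := half (SignType.sign c) y (by simpa using hsgn)
    rwa [hsc] at this
  have e2 : ‖∫ x in (-R)..0, cexp (I * ((c * x ^ k + y * x : ℝ) : ℂ))‖ ≤ 9 * l⁻¹ := by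
    -- Reflecting the negative half-line multiplies the leading coefficient by `(-1) ^ k` and
    -- changes the sign of `y`.
    have := half ((-1) ^ k * (SignType.sign c : ℝ)) (-y) (by rw [abs_mul, hsgn]; simp)
    rw [mul_assoc, hsc] at this
    have h := intervalIntegral.integral_comp_neg (a := 0) (b := R)
      (fun x : ℝ ↦ cexp (I * ((c * x ^ k + y * x : ℝ) : ℂ)))
    rw [neg_zero] at h
    rw [← h]
    convert this using 6 with x
    rw [neg_pow]
    push_cast
    ring
  rw [← integral_add_adjacent_intervals (hci (-R) 0) (hci 0 R), Real.rpow_neg hcpos.le]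
  refine (norm_add_le _ _).trans ?_
  linarith

end Dispersive

/-! ### Real interpolation of a bilinear form between `L¹ × L¹` and `L² × L²` -/

noncomputable section

namespace Dispersive

open Set Filter Topology

variable {X : Type*} [MeasurableSpace X]

/-- The functions which are both integrable and square integrable. -/
def intersectionL1L2 (μ : Measure X) : Submodule ℂ (X → ℂ) where
  carrier := {f | MemLp f 1 μ ∧ MemLp f 2 μ}
  add_mem' hf hg := ⟨hf.1.add hg.1, hf.2.add hg.2⟩
  zero_mem' := ⟨MemLp.zero, MemLp.zero⟩
  smul_mem' c _ hf := ⟨hf.1.const_smul c, hf.2.const_smul c⟩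

/-- Each positive size lies in exactly one dyadic level, whose index is an integer logarithm. This
turns sums over levels into a membership test. -/
theorem mem_Ico_mul_zpow_iff_log {l r : ℝ} (hl : 0 < l) (hr : 0 < r) (a : ℤ) :
    r ∈ Ico (l * 2 ^ a) (l * 2 ^ (a + 1)) ↔ Int.log 2 (r / l) = a := by
  have hrl : 0 < r / l := div_pos hr hl
  constructor
  · rintro ⟨h1, h2⟩
    apply le_antisymm
    · have : r / l < (2 : ℕ) ^ (a + 1) := by
        rw [div_lt_iff₀ hl, mul_comm]; exact_mod_cast h2
      have := (Int.lt_zpow_iff_log_lt one_lt_two hrl).1 this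
      omega
    · have : ((2 : ℕ) : ℝ) ^ a ≤ r / l := by
        rw [le_div_iff₀ hl, mul_comm]; exact_mod_cast h1
      exact (Int.zpow_le_iff_le_log one_lt_two hrl).1 this
  · rintro rfl
    constructor
    · have := Int.zpow_log_le_self (b := 2) one_lt_two hrl
      rw [le_div_iff₀ hl, mul_comm] at this
      exact_mod_cast this
    · have := Int.lt_zpow_succ_log_self (b := 2) one_lt_two (r / l)
      rw [div_lt_iff₀ hl, mul_comm] at this
      exact_mod_cast this

/-- The set where `‖f‖` has size about `l * 2 ^ a`. -/
def levelSet (l : ℝ) (a : ℤ) (f : X → ℂ) : Set X :=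
  {x | ‖f x‖ ∈ Ico (l * 2 ^ a) (l * 2 ^ (a + 1))}

theorem nullMeasurableSet_levelSet {μ : Measure X} (l : ℝ) (a : ℤ) {f : X → ℂ}
    (hf : AEStronglyMeasurable f μ) : NullMeasurableSet (levelSet l a f) μ :=
  hf.norm.aemeasurable.nullMeasurableSet_preimage measurableSet_Ico

theorem memLp_indicator_of_nullMeasurableSet {μ : Measure X} {p : ℝ≥0∞} {f : X → ℂ} {s : Set X}
    (hs : NullMeasurableSet s μ) (hf : MemLp f p μ) : MemLp (s.indicator f) p μ :=
  hf.mono (hf.aestronglyMeasurable.indicator₀ hs)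
    (Eventually.of_forall fun x ↦ norm_indicator_le_norm_self f x)

/-- The part of `f` where `‖f‖` has size about `l * 2 ^ a`. -/
def dyadicPiece {μ : Measure X} (l : ℝ) (a : ℤ) (f : intersectionL1L2 μ) : intersectionL1L2 μ :=
  ⟨(levelSet l a f.1).indicator f.1,
    memLp_indicator_of_nullMeasurableSet
      (nullMeasurableSet_levelSet l a f.2.1.aestronglyMeasurable) f.2.1,
    memLp_indicator_of_nullMeasurableSet
      (nullMeasurableSet_levelSet l a f.2.1.aestronglyMeasurable) f.2.2⟩

/-- At most one level contains `x`. A zero of `f` lies in no level, although `Int.log` still assigns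
it an index; the hypothesis on `g` makes that index harmless. -/
theorem sum_indicator_levelSet {X : Type*} {l : ℝ} (hl : 0 < l) (s : Finset ℤ) (f : X → ℂ) {E : Type*}
    [AddCommMonoid E] (g : X → E) (hg : ∀ x, f x = 0 → g x = 0) (x : X) :
    ∑ a ∈ s, (levelSet l a f).indicator g x =
      if Int.log 2 (‖f x‖ / l) ∈ s then g x else 0 := by
  classical
  by_cases h0 : f x = 0
  · simp [indicator_apply, hg x h0]
  · have : ∀ a, (levelSet l a f).indicator g x =
        if Int.log 2 (‖f x‖ / l) = a then g x else 0 := fun a ↦ by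
      simp only [indicator_apply, levelSet, mem_ofPred_eq,
        mem_Ico_mul_zpow_iff_log hl (norm_pos_iff.2 h0)]
    simp only [this, Finset.sum_ite_eq]

/-- For exponents between 1 and 2, `t ^ p ≤ t + t ^ 2`. -/
theorem rpow_integrable_of_mem {μ : Measure X} {p : ℝ} (hp1 : 1 ≤ p) (hp2 : p ≤ 2)
    {f : X → ℂ} (hf : f ∈ intersectionL1L2 μ) : Integrable (fun x ↦ ‖f x‖ ^ p) μ := by
  have h1 : Integrable (fun x ↦ ‖f x‖ + ‖f x‖ ^ 2) μ :=
    (memLp_one_iff_integrable.1 hf.1).norm.add (hf.2.integrable_norm_pow two_ne_zero)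
  refine h1.mono' ((hf.1.aestronglyMeasurable.norm.aemeasurable.pow_const p).aestronglyMeasurable)
    (Eventually.of_forall fun x ↦ ?_)
  have hn := norm_nonneg (f x)
  rw [Real.norm_of_nonneg (by positivity)]
  rcases le_total ‖f x‖ 1 with h | h
  · have := Real.rpow_le_rpow_of_exponent_ge' hn h zero_le_one hp1
    rw [Real.rpow_one] at this
    nlinarith
  · have := Real.rpow_le_rpow_of_exponent_le h hp2
    rw [Real.rpow_two] at this
    linarith

section pieces

variable {μ : Measure X} {p l : ℝ}

/-- The contribution to `∫ ‖f‖ ^ p` of the set where `‖f‖` has size about `l * 2 ^ a`. -/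
def levelMass (μ : Measure X) (p l : ℝ) (a : ℤ) (f : X → ℂ) : ℝ :=
  ∫ x, (levelSet l a f).indicator (fun x ↦ ‖f x‖ ^ p) x ∂μ

theorem levelMass_nonneg (a : ℤ) (f : X → ℂ) : 0 ≤ levelMass μ p l a f :=
  integral_nonneg fun x ↦ indicator_nonneg (fun x _ ↦ by positivity) x

theorem integrable_indicator_levelSet (hp1 : 1 ≤ p) (hp2 : p ≤ 2) (a : ℤ)
    (f : intersectionL1L2 μ) :
    Integrable ((levelSet l a f.1).indicator fun x ↦ ‖f.1 x‖ ^ p) μ :=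
  (rpow_integrable_of_mem hp1 hp2 f.2).indicator₀
    (nullMeasurableSet_levelSet l a f.2.1.aestronglyMeasurable)

theorem sum_levelMass_le (hp1 : 1 ≤ p) (hp2 : p ≤ 2) (hl : 0 < l) (s : Finset ℤ)
    (f : intersectionL1L2 μ) :
    ∑ a ∈ s, levelMass μ p l a f.1 ≤ ∫ x, ‖f.1 x‖ ^ p ∂μ := by
  simp only [levelMass]
  rw [← integral_finsetSum s fun a _ ↦ integrable_indicator_levelSet hp1 hp2 a f]
  refine integral_mono (integrable_finsetSum s fun a _ ↦
    integrable_indicator_levelSet hp1 hp2 a f) (rpow_integrable_of_mem hp1 hp2 f.2) fun x ↦ ?_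
  simp only
  rw [sum_indicator_levelSet hl s f.1 _ fun x hx ↦ by
    simp [hx, Real.zero_rpow (by linarith : p ≠ 0)]]
  split_ifs
  · exact le_rfl
  · positivity

/-- On one level `‖f‖` is known up to a factor 2, so the `L¹` and `L²` norms of a piece are both
controlled by its mass. Here `‖f‖ ^ (1 - p)` has a nonpositive exponent and is bounded through the
lower end of the level; the `L²` version uses the upper end. -/
theorem integral_norm_dyadicPiece_le (hp1 : 1 ≤ p) (hp2 : p ≤ 2) (hl : 0 < l) (a : ℤ)
    (f : intersectionL1L2 μ) :
    ∫ x, ‖(dyadicPiece l a f).1 x‖ ∂μ ≤ (l * 2 ^ a) ^ (1 - p) * levelMass μ p l a f.1 := by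
  rw [levelMass, ← integral_const_mul]
  refine integral_mono (memLp_one_iff_integrable.1 (dyadicPiece l a f).2.1).norm
    ((integrable_indicator_levelSet hp1 hp2 a f).const_mul _) fun x ↦ ?_
  by_cases h : x ∈ levelSet l a f.1
  · simp only [dyadicPiece, indicator_of_mem h]
    have hpos : 0 < l * 2 ^ a := by positivity
    have hr : 0 < ‖f.1 x‖ := hpos.trans_le h.1
    calc ‖f.1 x‖ = ‖f.1 x‖ ^ (1 - p) * ‖f.1 x‖ ^ p := by
          rw [← Real.rpow_add hr]; simp
      _ ≤ _ := mul_le_mul_of_nonneg_right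
          (Real.rpow_le_rpow_of_nonpos hpos h.1 (by linarith)) (by positivity)
  · simp [dyadicPiece, indicator_of_notMem h]

theorem integral_norm_sq_dyadicPiece_le (hp1 : 1 ≤ p) (hp2 : p ≤ 2) (hl : 0 < l) (a : ℤ)
    (f : intersectionL1L2 μ) :
    ∫ x, ‖(dyadicPiece l a f).1 x‖ ^ 2 ∂μ ≤
      (l * 2 ^ (a + 1)) ^ (2 - p) * levelMass μ p l a f.1 := by
  rw [levelMass, ← integral_const_mul]
  refine integral_mono ((dyadicPiece l a f).2.2.integrable_norm_pow two_ne_zero)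
    ((integrable_indicator_levelSet hp1 hp2 a f).const_mul _) fun x ↦ ?_
  by_cases h : x ∈ levelSet l a f.1
  · simp only [dyadicPiece, indicator_of_mem h]
    have hpos : 0 < l * 2 ^ a := by positivity
    have hr : 0 < ‖f.1 x‖ := hpos.trans_le h.1
    calc ‖f.1 x‖ ^ 2 = ‖f.1 x‖ ^ (2 - p) * ‖f.1 x‖ ^ p := by
          rw [← Real.rpow_add hr]; simp
      _ ≤ _ := mul_le_mul_of_nonneg_right
          (Real.rpow_le_rpow hr.le h.2.le (by linarith)) (by positivity)
  · simp [dyadicPiece, indicator_of_notMem h]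

theorem tendsto_sum_dyadicPiece (hl : 0 < l) (f : intersectionL1L2 μ) :
    Tendsto (fun M : ℕ ↦ ∫ x, ‖(f - ∑ a ∈ Finset.Ico (-M : ℤ) M, dyadicPiece l a f).1 x‖ ^ 2 ∂μ)
      atTop (𝓝 0) := by
  have hval : ∀ (M : ℕ) (x : X), (f - ∑ a ∈ Finset.Ico (-M : ℤ) M, dyadicPiece l a f).1 x =
      f.1 x - if Int.log 2 (‖f.1 x‖ / l) ∈ Finset.Ico (-M : ℤ) M then f.1 x else 0 := by
    intro M x
    rw [← sum_indicator_levelSet hl _ f.1 f.1 (fun x h ↦ h)]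
    simp [dyadicPiece]
  have := tendsto_integral_of_dominated_convergence (μ := μ)
    (F := fun (M : ℕ) x ↦ ‖(f - ∑ a ∈ Finset.Ico (-M : ℤ) M, dyadicPiece l a f).1 x‖ ^ 2)
    (f := fun _ ↦ (0 : ℝ)) (fun x ↦ ‖f.1 x‖ ^ 2)
    (fun M ↦ ((f - ∑ a ∈ Finset.Ico (-M : ℤ) M, dyadicPiece l a f).2.2.integrable_norm_pow
      two_ne_zero).aestronglyMeasurable)
    (f.2.2.integrable_norm_pow two_ne_zero)
    (fun M ↦ Eventually.of_forall fun x ↦ by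
      rw [hval]
      split_ifs <;> simp)
    (Eventually.of_forall fun x ↦ by
      refine tendsto_const_nhds.congr' ?_
      filter_upwards [eventually_gt_atTop (Int.log 2 (‖f.1 x‖ / l)).natAbs] with M hM
      rw [hval, if_pos (Finset.mem_Ico.2 (by omega))]
      simp)
  simpa using this

end pieces

/-- A geometric weight on the negative integers. -/
def negGeometric (r : ℝ) (N : ℤ) : ℝ := if N < 0 then r ^ N else 0

theorem summable_negGeometric {r : ℝ} (hr : 1 < r) : Summable (negGeometric r) := by
  apply Summable.of_nat_of_neg
  · refine summable_zero.congr fun n ↦ ?_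
    rw [negGeometric, if_neg (by omega)]
  · refine Summable.of_nonneg_of_le (f := fun n : ℕ ↦ r⁻¹ ^ n) (fun n ↦ ?_) (fun n ↦ ?_)
      (summable_geometric_of_lt_one (by positivity) (inv_lt_one_of_one_lt₀ hr))
    · unfold negGeometric; split_ifs <;> positivity
    · unfold negGeometric; split_ifs
      · simp
      · positivity

theorem negGeometric_nonneg {r : ℝ} (hr : 0 ≤ r) (N : ℤ) : 0 ≤ negGeometric r N := by
  unfold negGeometric; split_ifs <;> positivity

theorem sum_negGeometric_le {r : ℝ} (hr : 1 < r) (s : Finset ℤ) (a : ℤ) :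
    ∑ b ∈ s, negGeometric r (a + b) ≤ ∑' N, negGeometric r N := by
  rw [← (Equiv.addLeft a).tsum_eq (negGeometric r)]
  exact ((Equiv.addLeft a).summable_iff.2 (summable_negGeometric hr)).sum_le_tsum s
    fun b _ ↦ negGeometric_nonneg (by linarith) _


section main

variable {μ : Measure X} {p : ℝ}

/-- The constant in the interpolation theorem. -/
def interpolationConst (p : ℝ) : ℝ :=
  1 + 2 ^ (2 - p) * ∑' N, negGeometric (2 ^ ((2 - p) / 2)) N

theorem interpolationConst_nonneg (p : ℝ) : 0 ≤ interpolationConst p := by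
  have : 0 ≤ ∑' N, negGeometric ((2 : ℝ) ^ ((2 - p) / 2)) N :=
    tsum_nonneg fun N ↦ negGeometric_nonneg (by positivity) N
  unfold interpolationConst
  positivity

variable {A : ℝ} (B : intersectionL1L2 μ →ₗ[ℂ] intersectionL1L2 μ →ₗ[ℂ] ℂ)

/-- The unit `l = A ^ (1/p)` makes both endpoint bounds carry the same factor `l ^ (2 - p)`. What
remains is `2 ^ ((a + b)(1 - p))` from `L¹`, which is at most 1 for `a + b ≥ 0`, and `2 ^ ((a + b)(2
- p)/2)` from `L²`, up to a constant, which decays geometrically as `a + b → -∞`. Each bound is used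
on its good side. -/
theorem norm_bilin_dyadicPiece_le (hp1 : 1 < p) (hp2 : p < 2) (hA : 0 < A)
    (h1 : ∀ f g, ‖B f g‖ ≤ A * ((∫ x, ‖f.1 x‖ ∂μ) * ∫ x, ‖g.1 x‖ ∂μ))
    (h2 : ∀ f g, ‖B f g‖ ≤ √(∫ x, ‖f.1 x‖ ^ 2 ∂μ) * √(∫ x, ‖g.1 x‖ ^ 2 ∂μ))
    {l : ℝ} (hl : l = A ^ (1 / p)) (f g : intersectionL1L2 μ) (a b : ℤ) :
    ‖B (dyadicPiece l a f) (dyadicPiece l b g)‖ ≤ l ^ (2 - p) *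
      (levelMass μ p l a f.1 * levelMass μ p l b g.1 +
        2 ^ (2 - p) * (negGeometric (2 ^ ((2 - p) / 2)) (a + b) *
          ((levelMass μ p l a f.1 + levelMass μ p l b g.1) / 2))) := by
  have hlpos : 0 < l := hl ▸ Real.rpow_pos_of_pos hA _
  have hAl : A = l ^ p := by
    rw [hl, ← Real.rpow_mul hA.le, one_div_mul_cancel (by linarith), Real.rpow_one]
  set x := levelMass μ p l a f.1 with hx
  set y := levelMass μ p l b g.1 with hy
  have hx0 : 0 ≤ x := levelMass_nonneg a f.1
  have hy0 : 0 ≤ y := levelMass_nonneg b g.1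
  have two_pos' : (0 : ℝ) < 2 := two_pos
  rcases le_or_gt 0 (a + b) with hN | hN
  · have e : negGeometric (2 ^ ((2 - p) / 2)) (a + b) = 0 := by
      rw [negGeometric, if_neg (by omega)]
    rw [e, zero_mul, mul_zero, add_zero]
    calc _ ≤ A * (((l * 2 ^ a) ^ (1 - p) * x) * ((l * 2 ^ b) ^ (1 - p) * y)) := by
          refine (h1 _ _).trans ?_
          gcongr
          · exact integral_norm_dyadicPiece_le hp1.le hp2.le hlpos a f
          · exact integral_norm_dyadicPiece_le hp1.le hp2.le hlpos b g
      _ = l ^ (2 - p) * ((2 : ℝ) ^ ((a + b : ℤ) * (1 - p)) * (x * y)) := by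
          rw [hAl, Real.mul_rpow hlpos.le (by positivity), Real.mul_rpow hlpos.le (by positivity),
            ← Real.rpow_intCast 2 a, ← Real.rpow_intCast 2 b, ← Real.rpow_mul two_pos'.le,
            ← Real.rpow_mul two_pos'.le]
          have e1 : l ^ (2 - p) = l ^ p * l ^ (1 - p) * l ^ (1 - p) := by
            rw [← Real.rpow_add hlpos, ← Real.rpow_add hlpos]; ring_nf
          have e2 : (2 : ℝ) ^ ((a + b : ℤ) * (1 - p)) =
              2 ^ (a * (1 - p)) * 2 ^ (b * (1 - p)) := by
            rw [← Real.rpow_add two_pos']; push_cast; ring_nf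
          rw [e1, e2]; ring
      _ ≤ l ^ (2 - p) * (1 * (x * y)) := by
          gcongr
          refine Real.rpow_le_one_of_one_le_of_nonpos one_le_two ?_
          have : (0 : ℝ) ≤ (a + b : ℤ) := by exact_mod_cast hN
          nlinarith
      _ = _ := by ring
  · have e : negGeometric (2 ^ ((2 - p) / 2)) (a + b) =
        (2 : ℝ) ^ ((a : ℝ) * ((2 - p) / 2)) * 2 ^ ((b : ℝ) * ((2 - p) / 2)) := by
      rw [negGeometric, if_pos hN, ← Real.rpow_intCast, ← Real.rpow_mul two_pos'.le,
        ← Real.rpow_add two_pos']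
      push_cast; ring_nf
    have hsq : ∀ (c : ℤ) (z : ℝ), √((l * 2 ^ (c + 1)) ^ (2 - p) * z) =
        l ^ ((2 - p) / 2) * 2 ^ ((2 - p) / 2) * 2 ^ ((c : ℝ) * ((2 - p) / 2)) * √z := by
      intro c z
      rw [Real.sqrt_mul (by positivity), Real.sqrt_eq_rpow, ← Real.rpow_mul (by positivity),
        Real.mul_rpow hlpos.le (by positivity), ← Real.rpow_intCast 2 (c + 1),
        ← Real.rpow_mul two_pos'.le, mul_assoc (l ^ ((2 - p) / 2)), ← Real.rpow_add two_pos']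
      push_cast; ring_nf
    -- Replacing the geometric mean of the masses by their arithmetic mean leaves a single mass
    -- against each geometric weight, which can be summed in the other index.
    have hamgm : √x * √y ≤ (x + y) / 2 := by
      nlinarith [Real.sq_sqrt hx0, Real.sq_sqrt hy0, sq_nonneg (√x - √y)]
    calc _ ≤ √((l * 2 ^ (a + 1)) ^ (2 - p) * x) * √((l * 2 ^ (b + 1)) ^ (2 - p) * y) := by
          refine (h2 _ _).trans ?_
          gcongr
          · exact integral_norm_sq_dyadicPiece_le hp1.le hp2.le hlpos a f
          · exact integral_norm_sq_dyadicPiece_le hp1.le hp2.le hlpos b g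
      _ = l ^ (2 - p) * (2 ^ (2 - p) * (negGeometric (2 ^ ((2 - p) / 2)) (a + b) *
            (√x * √y))) := by
          rw [hsq, hsq, e]
          have e1 : l ^ (2 - p) = l ^ ((2 - p) / 2) * l ^ ((2 - p) / 2) := by
            rw [← Real.rpow_add hlpos]; ring_nf
          have e2 : (2 : ℝ) ^ (2 - p) = 2 ^ ((2 - p) / 2) * 2 ^ ((2 - p) / 2) := by
            rw [← Real.rpow_add two_pos']; ring_nf
          rw [e1, e2]; ring
      _ ≤ l ^ (2 - p) * (2 ^ (2 - p) * (negGeometric (2 ^ ((2 - p) / 2)) (a + b) *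
            ((x + y) / 2))) := by
          have := negGeometric_nonneg (r := (2 : ℝ) ^ ((2 - p) / 2)) (by positivity) (a + b)
          gcongr
      _ ≤ _ := by
          gcongr
          exact le_add_of_nonneg_left (by positivity)

/-- The part without weight sums to a product of two total masses, each at most 1. In the weighted
part, summing the weight in one index is bounded uniformly in the other, as in Schur's test. -/
theorem norm_bilin_sum_dyadicPiece_le (hp1 : 1 < p) (hp2 : p < 2) (hA : 0 < A)
    (h1 : ∀ f g, ‖B f g‖ ≤ A * ((∫ x, ‖f.1 x‖ ∂μ) * ∫ x, ‖g.1 x‖ ∂μ))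
    (h2 : ∀ f g, ‖B f g‖ ≤ √(∫ x, ‖f.1 x‖ ^ 2 ∂μ) * √(∫ x, ‖g.1 x‖ ^ 2 ∂μ))
    {l : ℝ} (hl : l = A ^ (1 / p)) (f g : intersectionL1L2 μ)
    (hf : ∫ x, ‖f.1 x‖ ^ p ∂μ ≤ 1) (hg : ∫ x, ‖g.1 x‖ ^ p ∂μ ≤ 1) (s : Finset ℤ) :
    ‖B (∑ a ∈ s, dyadicPiece l a f) (∑ b ∈ s, dyadicPiece l b g)‖ ≤
      interpolationConst p * A ^ (2 / p - 1) := by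
  have hlpos : 0 < l := hl ▸ Real.rpow_pos_of_pos hA _
  set x := fun a ↦ levelMass μ p l a f.1
  set y := fun a ↦ levelMass μ p l a g.1
  have hx0 : ∀ a, 0 ≤ x a := fun a ↦ levelMass_nonneg a f.1
  have hy0 : ∀ a, 0 ≤ y a := fun a ↦ levelMass_nonneg a g.1
  have hx : ∑ a ∈ s, x a ≤ 1 := (sum_levelMass_le hp1.le hp2.le hlpos s f).trans hf
  have hy : ∑ a ∈ s, y a ≤ 1 := (sum_levelMass_le hp1.le hp2.le hlpos s g).trans hg
  set r : ℝ := 2 ^ ((2 - p) / 2) with hr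
  have hr1 : 1 < r := Real.one_lt_rpow one_lt_two (by linarith)
  set K := ∑' N, negGeometric r N with hK
  have hK0 : 0 ≤ K := tsum_nonneg fun N ↦ negGeometric_nonneg (by linarith) N
  have hlA : l ^ (2 - p) = A ^ (2 / p - 1) := by
    rw [hl, ← Real.rpow_mul hA.le]
    congr 1
    field_simp
  have hsx : ∑ a ∈ s, ∑ b ∈ s, negGeometric r (a + b) * x a ≤ K := by
    calc _ = ∑ a ∈ s, (∑ b ∈ s, negGeometric r (a + b)) * x a := by
          simp_rw [Finset.sum_mul]
      _ ≤ ∑ a ∈ s, K * x a := Finset.sum_le_sum fun a _ ↦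
          mul_le_mul_of_nonneg_right (sum_negGeometric_le hr1 s a) (hx0 a)
      _ ≤ K := by rw [← Finset.mul_sum]; exact mul_le_of_le_one_right hK0 hx
  have hsy : ∑ a ∈ s, ∑ b ∈ s, negGeometric r (a + b) * y b ≤ K := by
    rw [Finset.sum_comm]
    calc _ = ∑ b ∈ s, (∑ a ∈ s, negGeometric r (b + a)) * y b := by
          simp_rw [Finset.sum_mul, add_comm]
      _ ≤ ∑ b ∈ s, K * y b := Finset.sum_le_sum fun b _ ↦
          mul_le_mul_of_nonneg_right (sum_negGeometric_le hr1 s b) (hy0 b)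
      _ ≤ K := by rw [← Finset.mul_sum]; exact mul_le_of_le_one_right hK0 hy
  have hsxy : ∑ a ∈ s, ∑ b ∈ s, x a * y b ≤ 1 := by
    rw [← Finset.sum_mul_sum]
    exact mul_le_one₀ hx (Finset.sum_nonneg fun b _ ↦ hy0 b) hy
  calc _ = ‖∑ a ∈ s, ∑ b ∈ s, B (dyadicPiece l a f) (dyadicPiece l b g)‖ := by
        simp only [map_sum, LinearMap.sum_apply]
        rw [Finset.sum_comm]
    _ ≤ ∑ a ∈ s, ∑ b ∈ s, ‖B (dyadicPiece l a f) (dyadicPiece l b g)‖ :=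
        (norm_sum_le _ _).trans (Finset.sum_le_sum fun a _ ↦ norm_sum_le _ _)
    _ ≤ ∑ a ∈ s, ∑ b ∈ s, l ^ (2 - p) * (x a * y b +
          2 ^ (2 - p) * (negGeometric r (a + b) * ((x a + y b) / 2))) :=
        Finset.sum_le_sum fun a _ ↦ Finset.sum_le_sum fun b _ ↦
          norm_bilin_dyadicPiece_le B hp1 hp2 hA h1 h2 hl f g a b
    _ = l ^ (2 - p) * (∑ a ∈ s, ∑ b ∈ s, x a * y b + 2 ^ (2 - p) / 2 *
          (∑ a ∈ s, ∑ b ∈ s, negGeometric r (a + b) * x a +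
            ∑ a ∈ s, ∑ b ∈ s, negGeometric r (a + b) * y b)) := by
        simp_rw [mul_add, Finset.mul_sum, ← Finset.sum_add_distrib]
        refine Finset.sum_congr rfl fun a _ ↦ Finset.sum_congr rfl fun b _ ↦ ?_
        ring
    _ ≤ l ^ (2 - p) * (1 + 2 ^ (2 - p) / 2 * (K + K)) := by gcongr
    _ = _ := by rw [hlA, interpolationConst]; ring

/-- The bound for finite sums of pieces does not depend on their number, and the `L² × L²` bound
makes `B` continuous along the `L²`-convergent truncations. -/
theorem norm_bilin_le_of_normalized (hp1 : 1 < p) (hp2 : p < 2) (hA : 0 < A)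
    (h1 : ∀ f g, ‖B f g‖ ≤ A * ((∫ x, ‖f.1 x‖ ∂μ) * ∫ x, ‖g.1 x‖ ∂μ))
    (h2 : ∀ f g, ‖B f g‖ ≤ √(∫ x, ‖f.1 x‖ ^ 2 ∂μ) * √(∫ x, ‖g.1 x‖ ^ 2 ∂μ))
    (f g : intersectionL1L2 μ)
    (hf : ∫ x, ‖f.1 x‖ ^ p ∂μ ≤ 1) (hg : ∫ x, ‖g.1 x‖ ^ p ∂μ ≤ 1) :
    ‖B f g‖ ≤ interpolationConst p * A ^ (2 / p - 1) := by
  set l := A ^ (1 / p) with hl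
  have hlpos : 0 < l := Real.rpow_pos_of_pos hA _
  set F : ℕ → intersectionL1L2 μ := fun M ↦ ∑ a ∈ Finset.Ico (-M : ℤ) M, dyadicPiece l a f
  set G : ℕ → intersectionL1L2 μ := fun M ↦ ∑ a ∈ Finset.Ico (-M : ℤ) M, dyadicPiece l a g
  have hFn : ∀ M, ∫ x, ‖(F M).1 x‖ ^ 2 ∂μ ≤ ∫ x, ‖f.1 x‖ ^ 2 ∂μ := by
    intro M
    refine integral_mono ((F M).2.2.integrable_norm_pow two_ne_zero)
      (f.2.2.integrable_norm_pow two_ne_zero) fun x ↦ ?_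
    have : (F M).1 x = if Int.log 2 (‖f.1 x‖ / l) ∈ Finset.Ico (-M : ℤ) M then f.1 x else 0 := by
      rw [← sum_indicator_levelSet hlpos _ f.1 f.1 (fun x h ↦ h)]
      simp [F, dyadicPiece]
    simp only [this]
    split_ifs
    · exact le_rfl
    · simp
  have hdiff : ∀ M, ‖B f g - B (F M) (G M)‖ ≤
      √(∫ x, ‖(f - F M).1 x‖ ^ 2 ∂μ) * √(∫ x, ‖g.1 x‖ ^ 2 ∂μ) +
      √(∫ x, ‖f.1 x‖ ^ 2 ∂μ) * √(∫ x, ‖(g - G M).1 x‖ ^ 2 ∂μ) := by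
    intro M
    have : B f g - B (F M) (G M) = B (f - F M) g + B (F M) (g - G M) := by
      simp only [map_sub, LinearMap.sub_apply]; ring
    rw [this]
    refine (norm_add_le _ _).trans (add_le_add (h2 _ _) ((h2 _ _).trans ?_))
    exact mul_le_mul_of_nonneg_right (Real.sqrt_le_sqrt (hFn M)) (Real.sqrt_nonneg _)
  have hlim : Tendsto (fun M ↦ √(∫ x, ‖(f - F M).1 x‖ ^ 2 ∂μ) * √(∫ x, ‖g.1 x‖ ^ 2 ∂μ) +
      √(∫ x, ‖f.1 x‖ ^ 2 ∂μ) * √(∫ x, ‖(g - G M).1 x‖ ^ 2 ∂μ)) atTop (𝓝 0) := by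
    have e1 := (tendsto_sum_dyadicPiece hlpos f).sqrt.mul_const √(∫ x, ‖g.1 x‖ ^ 2 ∂μ)
    have e2 := (tendsto_sum_dyadicPiece hlpos g).sqrt.const_mul √(∫ x, ‖f.1 x‖ ^ 2 ∂μ)
    have := e1.add e2
    rwa [Real.sqrt_zero, zero_mul, mul_zero, add_zero] at this
  have hconst := hlim.add_const (interpolationConst p * A ^ (2 / p - 1))
  rw [zero_add] at hconst
  refine ge_of_tendsto' hconst fun M ↦ ?_
  calc ‖B f g‖ = ‖(B f g - B (F M) (G M)) + B (F M) (G M)‖ := by rw [sub_add_cancel]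
    _ ≤ _ := (norm_add_le _ _).trans (add_le_add (hdiff M)
        (norm_bilin_sum_dyadicPiece_le B hp1 hp2 hA h1 h2 hl f g hf hg _))

/-- A bilinear form bounded on `L¹ × L¹` and `L² × L²` is bounded on `Lᵖ × Lᵖ`. -/
theorem norm_bilin_le_interpolation (hp1 : 1 < p) (hp2 : p < 2) (hA : 0 < A)
    (h1 : ∀ f g, ‖B f g‖ ≤ A * ((∫ x, ‖f.1 x‖ ∂μ) * ∫ x, ‖g.1 x‖ ∂μ))
    (h2 : ∀ f g, ‖B f g‖ ≤ √(∫ x, ‖f.1 x‖ ^ 2 ∂μ) * √(∫ x, ‖g.1 x‖ ^ 2 ∂μ))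
    (f g : intersectionL1L2 μ) :
    ‖B f g‖ ≤ interpolationConst p * A ^ (2 / p - 1) *
      ((∫ x, ‖f.1 x‖ ^ p ∂μ) ^ (1 / p) * (∫ x, ‖g.1 x‖ ^ p ∂μ) ^ (1 / p)) := by
  have hp0 : p ≠ 0 := by linarith
  have hnn : ∀ f : intersectionL1L2 μ, 0 ≤ ∫ x, ‖f.1 x‖ ^ p ∂μ := fun f ↦
    integral_nonneg fun x ↦ by positivity
  -- When the `L^p` norm vanishes no normalisation is possible, but then the function is zero almost
  -- everywhere and the `L²` bound gives `B f g = 0`.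
  have hzero : ∀ f : intersectionL1L2 μ, ∫ x, ‖f.1 x‖ ^ p ∂μ = 0 →
      ∫ x, ‖f.1 x‖ ^ 2 ∂μ = 0 := by
    intro f hf
    rw [integral_eq_zero_iff_of_nonneg (fun x ↦ by positivity)
      (rpow_integrable_of_mem hp1.le hp2.le f.2)] at hf
    rw [integral_eq_zero_iff_of_nonneg (fun x ↦ by positivity)
      (f.2.2.integrable_norm_pow two_ne_zero)]
    filter_upwards [hf] with x hx
    have : ‖f.1 x‖ = 0 := by
      by_contra hne
      exact hne ((Real.rpow_eq_zero (norm_nonneg _) hp0).1 hx)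
    simp [this]
  have hscale : ∀ f : intersectionL1L2 μ, 0 < ∫ x, ‖f.1 x‖ ^ p ∂μ →
      ∫ x, ‖((((∫ x, ‖f.1 x‖ ^ p ∂μ) ^ (1 / p) : ℝ) : ℂ)⁻¹ • f).1 x‖ ^ p ∂μ ≤ 1 := by
    intro f hf
    set c := ∫ x, ‖f.1 x‖ ^ p ∂μ
    have hcp : 0 < c ^ (1 / p) := Real.rpow_pos_of_pos hf _
    have : ∀ x, ‖((((c ^ (1 / p) : ℝ)) : ℂ)⁻¹ • f).1 x‖ ^ p = c⁻¹ * ‖f.1 x‖ ^ p := by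
      intro x
      simp only [SetLike.val_smul, Pi.smul_apply, smul_eq_mul, norm_mul, norm_inv, norm_real,
        Real.norm_of_nonneg hcp.le]
      rw [Real.mul_rpow (by positivity) (by positivity), Real.inv_rpow hcp.le,
        ← Real.rpow_mul hf.le, one_div_mul_cancel hp0, Real.rpow_one]
    simp only [this]
    rw [integral_const_mul]
    exact (inv_mul_cancel₀ hf.ne').le
  rcases (hnn f).eq_or_lt with hf | hf
  · have := h2 f g
    rw [hzero f hf.symm, Real.sqrt_zero, zero_mul] at this
    rw [← hf, Real.zero_rpow (by positivity)]
    simpa using this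
  rcases (hnn g).eq_or_lt with hg | hg
  · have := h2 f g
    rw [hzero g hg.symm, Real.sqrt_zero, mul_zero] at this
    rw [← hg, Real.zero_rpow (by positivity)]
    simpa using this
  have key := norm_bilin_le_of_normalized B hp1 hp2 hA h1 h2 _ _ (hscale f hf) (hscale g hg)
  have hcf := Real.rpow_pos_of_pos hf (1 / p)
  have hcg := Real.rpow_pos_of_pos hg (1 / p)
  simp only [map_smul, LinearMap.smul_apply, smul_eq_mul, norm_mul, norm_inv, norm_real,
    Real.norm_of_nonneg hcf.le, Real.norm_of_nonneg hcg.le] at key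
  rw [inv_mul_le_iff₀ hcg, inv_mul_le_iff₀ hcf] at key
  linarith

end main

end Dispersive

end

/-! ### The Hardy–Littlewood–Sobolev inequality on the line -/

noncomputable section

namespace Dispersive

open Set Filter Topology

/-- The layer-cake formula for `F` with respect to the measure of density `h`. -/
theorem lintegral_mul_ofReal_eq_lintegral_superlevel {X : Type*} [MeasurableSpace X]
    {μ : Measure X} {F : X → ℝ} (hF : Measurable F) (hF0 : ∀ x, 0 ≤ F x) {h : X → ℝ≥0∞}
    (hh : Measurable h) :
    ∫⁻ x, h x * ENNReal.ofReal (F x) ∂μ = ∫⁻ a in Ioi (0 : ℝ), ∫⁻ x in {x | a < F x}, h x ∂μ := by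
  have h1 := lintegral_eq_lintegral_meas_lt (μ.withDensity h) (Eventually.of_forall hF0)
    hF.aemeasurable
  rw [lintegral_withDensity_eq_lintegral_mul _ hh hF.ennreal_ofReal] at h1
  simp only [Pi.mul_apply] at h1
  rw [h1]
  refine lintegral_congr fun a ↦ ?_
  rw [withDensity_apply _ (measurableSet_lt measurable_const hF)]

/-- The Riesz kernel on the line. -/
def rieszKernel (α : ℝ) (t : ℝ) : ℝ≥0∞ := ENNReal.ofReal (|t| ^ (-α))

theorem measurable_rieszKernel (α : ℝ) : Measurable (rieszKernel α) := by
  unfold rieszKernel; fun_prop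

theorem rieszKernel_sub_comm (α s t : ℝ) : rieszKernel α (s - t) = rieszKernel α (t - s) := by
  rw [rieszKernel, abs_sub_comm]; rfl

theorem setLIntegral_rpow_Ioo {θ r : ℝ} (hθ1 : θ < 1) (hr : 0 ≤ r) :
    ∫⁻ s in Ioo 0 r, ENNReal.ofReal (s ^ (-θ)) = ENNReal.ofReal (r ^ (1 - θ) / (1 - θ)) := by
  have hint : IntervalIntegrable (fun s : ℝ ↦ s ^ (-θ)) volume 0 r :=
    intervalIntegral.intervalIntegrable_rpow' (by linarith)
  have h : ∫ s in (0 : ℝ)..r, s ^ (-θ) = r ^ (1 - θ) / (1 - θ) := by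
    rw [integral_rpow (Or.inl (by linarith)), Real.zero_rpow (by linarith)]
    ring_nf
  rw [setLIntegral_congr Ioo_ae_eq_Ioc, ← h, intervalIntegral.integral_of_le hr,
    ofReal_integral_eq_lintegral_ofReal ((intervalIntegrable_iff_integrableOn_Ioc_of_le hr).1 hint)]
  filter_upwards [ae_restrict_mem measurableSet_Ioc] with s hs
  exact Real.rpow_nonneg hs.1.le _

theorem setLIntegral_rieszKernel_ball {α r : ℝ} (hα1 : α < 1) (hr : 0 ≤ r) (t : ℝ) :
    ∫⁻ s in {s | |t - s| < r}, rieszKernel α (t - s) ≤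
      ENNReal.ofReal (2 / (1 - α) * r ^ (1 - α)) := by
  have hsub : ∫⁻ s in {s | |t - s| < r}, rieszKernel α (t - s) =
      ∫⁻ s in Ioo (-r) r, rieszKernel α s := by
    rw [← lintegral_indicator (measurableSet_lt (by fun_prop) measurable_const),
      ← lintegral_indicator measurableSet_Ioo,
      ← lintegral_sub_left_eq_self ((Ioo (-r) r).indicator (rieszKernel α)) t]
    refine lintegral_congr fun s ↦ ?_
    simp only [indicator_apply, mem_ofPred_eq, mem_Ioo, ← abs_lt]
  have hpos : ∫⁻ s in Ioo 0 r, rieszKernel α s = ENNReal.ofReal (r ^ (1 - α) / (1 - α)) := by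
    rw [← setLIntegral_rpow_Ioo hα1 hr]
    refine setLIntegral_congr_fun measurableSet_Ioo fun s hs ↦ ?_
    simp only [rieszKernel]
    rw [abs_of_pos hs.1]
  have hneg : ∫⁻ s in Ioo (-r) 0, rieszKernel α s = ∫⁻ s in Ioo 0 r, rieszKernel α s := by
    rw [← lintegral_indicator measurableSet_Ioo, ← lintegral_indicator measurableSet_Ioo,
      ← lintegral_sub_left_eq_self ((Ioo (-r) 0).indicator (rieszKernel α)) 0]
    refine lintegral_congr fun s ↦ ?_
    have : rieszKernel α (0 - s) = rieszKernel α s := by simp [rieszKernel]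
    simp only [indicator_apply, mem_Ioo, this]
    refine if_congr ?_ rfl rfl
    constructor <;> intro h <;> constructor <;> linarith [h.1, h.2]
  -- The origin is separated off: it is a null set, and the two half-intervals are exchanged by
  -- reflection.
  have hcover : Ioo (-r) r ⊆ Ioo (-r) 0 ∪ ({0} ∪ Ioo 0 r) := by
    intro s hs
    rcases lt_trichotomy s 0 with h | h | h
    · exact Or.inl ⟨hs.1, h⟩
    · exact Or.inr (Or.inl h)
    · exact Or.inr (Or.inr ⟨h, hs.2⟩)
  rw [hsub]
  refine (lintegral_mono_set hcover).trans ((lintegral_union_le _ _ _).trans ?_)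
  refine (add_le_add_right (lintegral_union_le _ _ _) _).trans ?_
  rw [hneg, hpos, Measure.restrict_singleton, Real.volume_singleton, zero_smul,
    lintegral_zero_measure, zero_add, ← ENNReal.ofReal_add (by have := sub_pos.2 hα1; positivity)
    (by have := sub_pos.2 hα1; positivity)]
  apply ENNReal.ofReal_le_ofReal
  apply le_of_eq
  ring

/-- Among the sets of given measure, the Riesz kernel has the largest integral over a ball. -/
theorem setLIntegral_rieszKernel_le {α : ℝ} (hα0 : 0 < α) (hα1 : α < 1) (t : ℝ) {E : Set ℝ}
    (hEm : MeasurableSet E) (hE : volume E ≠ ⊤) :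
    ∫⁻ s in E, rieszKernel α (t - s) ≤
      ENNReal.ofReal (1 + 2 / (1 - α)) * volume E ^ (1 - α) := by
  rcases eq_or_ne (volume E) 0 with h0 | h0
  · rw [setLIntegral_measure_zero _ _ h0]; exact zero_le
  -- A ball of radius `r = |E|` suffices: outside it the kernel is at most `r ^ (-α)`, contributing
  -- `r ^ (-α) |E| = r ^ (1 - α)`, the same power as the ball itself.
  set r := (volume E).toReal with hr
  have hrpos : 0 < r := ENNReal.toReal_pos h0 hE
  have hEr : volume E = ENNReal.ofReal r := (ENNReal.ofReal_toReal hE).symm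
  have h1α := sub_pos.2 hα1
  have hcover : E ⊆ {s | |t - s| < r} ∪ E ∩ {s | r ≤ |t - s|} := by
    intro s hs
    rcases lt_or_ge |t - s| r with h | h
    · exact Or.inl h
    · exact Or.inr ⟨hs, h⟩
  have hfar : ∫⁻ s in E ∩ {s | r ≤ |t - s|}, rieszKernel α (t - s) ≤
      ENNReal.ofReal (r ^ (1 - α)) := by
    calc _ ≤ ∫⁻ s in E ∩ {s | r ≤ |t - s|}, ENNReal.ofReal (r ^ (-α)) := by
          refine setLIntegral_mono' (hEm.inter (measurableSet_le measurable_const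
            (by fun_prop))) fun s hs ↦ ENNReal.ofReal_le_ofReal ?_
          exact Real.rpow_le_rpow_of_nonpos hrpos hs.2 (by linarith)
      _ ≤ ENNReal.ofReal (r ^ (-α)) * volume E := by
          rw [setLIntegral_const]
          gcongr
          exact inter_subset_left
      _ = ENNReal.ofReal (r ^ (1 - α)) := by
          rw [hEr, ← ENNReal.ofReal_mul (by positivity), ← Real.rpow_add_one hrpos.ne']
          ring_nf
  refine (lintegral_mono_set hcover).trans ((lintegral_union_le _ _ _).trans ?_)
  refine (add_le_add (setLIntegral_rieszKernel_ball hα1 hrpos.le t) hfar).trans ?_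
  rw [hEr, ENNReal.ofReal_rpow_of_pos hrpos, ← ENNReal.ofReal_add (by positivity) (by positivity),
    ← ENNReal.ofReal_mul (by positivity)]
  apply ENNReal.ofReal_le_ofReal
  apply le_of_eq
  ring


/-- The threshold is `x = w ^ (-1/α)`: below it the second term dominates, above it `x ^ (-α) ≤ w`.
The inequality trades a sublinear power of a distribution function for a linear term, which layer
cake can integrate, plus an explicit function. -/
theorem rpow_one_sub_le {α x w : ℝ} (hα0 : 0 < α) (hα1 : α < 1) (hx : 0 ≤ x) (hw : 0 < w) :
    x ^ (1 - α) ≤ x * w + w ^ (-((1 - α) / α)) := by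
  have hpos : 0 < w ^ (-(1 / α)) := Real.rpow_pos_of_pos hw _
  rcases le_total x (w ^ (-(1 / α))) with h | h
  · have := Real.rpow_le_rpow hx h (sub_pos.2 hα1).le
    rw [← Real.rpow_mul hw.le] at this
    have e : -(1 / α) * (1 - α) = -((1 - α) / α) := by ring
    rw [e] at this
    nlinarith [mul_nonneg hx hw.le]
  · have hx' : 0 < x := hpos.trans_le h
    have h2 := Real.rpow_le_rpow_of_nonpos hpos h (by linarith : -α ≤ 0)
    rw [← Real.rpow_mul hw.le] at h2
    have e : -(1 / α) * -α = 1 := by field_simp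
    rw [e, Real.rpow_one] at h2
    have e2 : x ^ (1 - α) = x * x ^ (-α) := by
      rw [sub_eq_add_neg, Real.rpow_add hx', Real.rpow_one]
    rw [e2]
    have : 0 ≤ w ^ (-((1 - α) / α)) := by positivity
    nlinarith

section HLS

variable {α p : ℝ}

/-- The distribution function of `F`. -/
def distribution (F : ℝ → ℝ) (a : ℝ) : ℝ≥0∞ := volume {x | a < F x}

theorem measurable_distribution (F : ℝ → ℝ) : Measurable (distribution F) :=
  Antitone.measurable fun _ _ h ↦ measure_mono fun _ hx ↦ lt_of_le_of_lt h hx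

/-- Layer cake for `F ^ p`, with the factor `p ≥ 1` discarded. -/
theorem lintegral_distribution_mul_rpow {F : ℝ → ℝ} (hF : Measurable F) (hF0 : ∀ x, 0 ≤ F x)
    (hp : 1 < p) (h : ∫⁻ x, ENNReal.ofReal (F x ^ p) ≤ 1) :
    ∫⁻ a in Ioi (0 : ℝ), distribution F a * ENNReal.ofReal (a ^ (p - 1)) ≤ 1 := by
  rw [lintegral_rpow_eq_lintegral_meas_lt_mul volume (Eventually.of_forall hF0) hF.aemeasurable
    (by linarith : 0 < p)] at h
  refine le_trans ?_ h
  exact le_mul_of_one_le_left zero_le (by simpa using hp.le)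

theorem distribution_ne_top {F : ℝ → ℝ} (hF : Measurable F) (hp : 1 < p) (h : ∫⁻ x, ENNReal.ofReal (F x ^ p) ≤ 1) {a : ℝ} (ha : 0 < a) :
    distribution F a ≠ ⊤ := by
  have hap : 0 < a ^ p := Real.rpow_pos_of_pos ha _
  refine ne_top_of_le_ne_top ?_ (measure_mono (t := {x | ENNReal.ofReal (a ^ p) ≤
    ENNReal.ofReal (F x ^ p)}) fun x hx ↦ ?_)
  · refine ne_top_of_le_ne_top ?_ (meas_ge_le_lintegral_div (by fun_prop)
      (by simpa using hap) ENNReal.ofReal_ne_top)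
    exact ENNReal.div_ne_top (ne_top_of_le_ne_top ENNReal.one_ne_top h) (by simpa using hap)
  · exact ENNReal.ofReal_le_ofReal (Real.rpow_le_rpow ha.le (le_of_lt hx) (by linarith))

/-- Apply the previous splitting with `w = (a b) ^ (p - 1)`. The linear term integrates to at most
`a ^ (p - 1)`. The other term is `a ^ (-θ) b ^ (-θ)` with `θ < 1`, and integrates over `0 < b < a`
to `(2 - α) a ^ (1 - 2θ)`. The value of `p` is what makes `1 - 2θ = p - 1`. -/
theorem setLIntegral_distribution_rpow_le (hα0 : 0 < α) (hα1 : α < 1) (hp : p = 2 / (2 - α))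
    {F : ℝ → ℝ} (hF : Measurable F) (hF0 : ∀ x, 0 ≤ F x)
    (h : ∫⁻ x, ENNReal.ofReal (F x ^ p) ≤ 1) {a : ℝ} (ha : 0 < a) :
    ∫⁻ b in Ioo 0 a, distribution F b ^ (1 - α) ≤
      ENNReal.ofReal (3 - α) * ENNReal.ofReal (a ^ (p - 1)) := by
  have h2α : 0 < 2 - α := by linarith
  have hp1 : 1 < p := by rw [hp, lt_div_iff₀ h2α]; linarith
  have hpα : p - 1 = α / (2 - α) := by rw [hp]; field_simp; ring
  set θ := (1 - α) / (2 - α) with hθ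
  have hθ1 : θ < 1 := by rw [hθ, div_lt_one h2α]; linarith
  have h1θ : 1 - θ = 1 / (2 - α) := by rw [hθ]; field_simp; ring
  have hptw : ∀ b ∈ Ioo 0 a, distribution F b ^ (1 - α) ≤
      ENNReal.ofReal (a ^ (p - 1)) * (distribution F b * ENNReal.ofReal (b ^ (p - 1))) +
        ENNReal.ofReal (a ^ (-θ)) * ENNReal.ofReal (b ^ (-θ)) := by
    intro b hb
    have hb0 := hb.1
    have hfin := distribution_ne_top hF hp1 h hb0
    set x := (distribution F b).toReal
    have hx : distribution F b = ENNReal.ofReal x := (ENNReal.ofReal_toReal hfin).symm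
    have hx0 : 0 ≤ x := ENNReal.toReal_nonneg
    rw [hx, ENNReal.ofReal_rpow_of_nonneg hx0 (by linarith), ← ENNReal.ofReal_mul hx0,
      ← ENNReal.ofReal_mul (by positivity), ← ENNReal.ofReal_mul (by positivity),
      ← ENNReal.ofReal_add (by positivity) (by positivity)]
    apply ENNReal.ofReal_le_ofReal
    have := rpow_one_sub_le hα0 hα1 hx0 (w := a ^ (p - 1) * b ^ (p - 1)) (by positivity)
    have e : (a ^ (p - 1) * b ^ (p - 1)) ^ (-((1 - α) / α)) = a ^ (-θ) * b ^ (-θ) := by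
      rw [Real.mul_rpow (by positivity) (by positivity), ← Real.rpow_mul ha.le,
        ← Real.rpow_mul hb0.le]
      have : (p - 1) * -((1 - α) / α) = -θ := by rw [hpα, hθ]; field_simp
      rw [this]
    rw [e] at this
    linarith
  calc _ ≤ ∫⁻ b in Ioo 0 a,
        (ENNReal.ofReal (a ^ (p - 1)) * (distribution F b * ENNReal.ofReal (b ^ (p - 1))) +
          ENNReal.ofReal (a ^ (-θ)) * ENNReal.ofReal (b ^ (-θ))) :=
        setLIntegral_mono' measurableSet_Ioo hptw
    _ = ENNReal.ofReal (a ^ (p - 1)) *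
          (∫⁻ b in Ioo 0 a, distribution F b * ENNReal.ofReal (b ^ (p - 1))) +
        ENNReal.ofReal (a ^ (-θ)) * ∫⁻ b in Ioo 0 a, ENNReal.ofReal (b ^ (-θ)) := by
        have hm := measurable_distribution F
        rw [lintegral_add_left (by fun_prop), lintegral_const_mul _ (by fun_prop),
          lintegral_const_mul _ (by fun_prop)]
    _ ≤ ENNReal.ofReal (a ^ (p - 1)) * 1 +
        ENNReal.ofReal (a ^ (-θ)) * ENNReal.ofReal (a ^ (1 - θ) / (1 - θ)) := by
        gcongr
        · exact (lintegral_mono_set Ioo_subset_Ioi_self).trans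
            (lintegral_distribution_mul_rpow hF hF0 hp1 h)
        · exact (setLIntegral_rpow_Ioo hθ1 ha.le).le
    _ = ENNReal.ofReal (3 - α) * ENNReal.ofReal (a ^ (p - 1)) := by
        have e : a ^ (p - 1) = a ^ (-θ) * a ^ (1 - θ) := by
          rw [← Real.rpow_add ha, hpα, hθ]
          congr 1
          field_simp
          ring
        rw [mul_one, ← ENNReal.ofReal_mul (by positivity), ← ENNReal.ofReal_add (by positivity)
          (by rw [h1θ]; positivity), ← ENNReal.ofReal_mul (by linarith), e]
        congr 1
        have e3 : a ^ (1 - θ) / (1 - θ) = (2 - α) * a ^ (1 - θ) := by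
          rw [div_eq_iff (by linarith), mul_right_comm, h1θ, mul_one_div_cancel h2α.ne', one_mul]
        rw [e3]
        ring

/-- The Riesz potential form of two functions. -/
def rieszForm (α : ℝ) (F G : ℝ → ℝ≥0∞) : ℝ≥0∞ := ∫⁻ t, ∫⁻ s, rieszKernel α (t - s) * F s * G t

theorem measurable_rieszKernel_sub (α : ℝ) :
    Measurable fun z : ℝ × ℝ ↦ rieszKernel α (z.1 - z.2) :=
  (measurable_rieszKernel α).comp (by fun_prop)

/-- Layer cake in both functions reduces the form to interactions of superlevel sets. The remaining
work is joint measurability, needed to exchange the level and time integrals. -/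
theorem rieszForm_eq_lintegral_superlevel {F G : ℝ → ℝ} (hF : Measurable F) (hF0 : ∀ x, 0 ≤ F x)
    (hG : Measurable G) (hG0 : ∀ x, 0 ≤ G x) :
    rieszForm α (fun s ↦ ENNReal.ofReal (F s)) (fun t ↦ ENNReal.ofReal (G t)) =
      ∫⁻ b in Ioi (0 : ℝ), ∫⁻ a in Ioi (0 : ℝ), ∫⁻ t in {t | b < G t}, ∫⁻ s in {s | a < F s},
        rieszKernel α (t - s) := by
  have hk := measurable_rieszKernel_sub α
  have hmeas : Measurable fun z : ℝ × ℝ ↦ ∫⁻ s in {s | z.2 < F s}, rieszKernel α (z.1 - s) := by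
    have : (fun z : ℝ × ℝ ↦ ∫⁻ s in {s | z.2 < F s}, rieszKernel α (z.1 - s)) =
        fun z : ℝ × ℝ ↦ ∫⁻ s, {y : (ℝ × ℝ) × ℝ | y.1.2 < F y.2}.indicator
          (fun y ↦ rieszKernel α (y.1.1 - y.2)) (z, s) := by
      funext z
      rw [← lintegral_indicator (measurableSet_lt measurable_const hF)]
      rfl
    rw [this]
    refine Measurable.lintegral_prod_right' ?_
    refine Measurable.indicator ?_ (measurableSet_lt (by fun_prop) (hF.comp measurable_snd))
    exact hk.comp (by fun_prop : Measurable fun y : (ℝ × ℝ) × ℝ ↦ (y.1.1, y.2))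
  have h1 : ∀ t, ∫⁻ s, rieszKernel α (t - s) * ENNReal.ofReal (F s) * ENNReal.ofReal (G t) =
      (∫⁻ a in Ioi (0 : ℝ), ∫⁻ s in {s | a < F s}, rieszKernel α (t - s)) *
        ENNReal.ofReal (G t) := by
    intro t
    have hkt : Measurable fun s ↦ rieszKernel α (t - s) :=
      (measurable_rieszKernel α).comp (by fun_prop)
    rw [lintegral_mul_const _ (by fun_prop),
      lintegral_mul_ofReal_eq_lintegral_superlevel hF hF0 hkt]
  have h2 : Measurable fun t ↦ ∫⁻ a in Ioi (0 : ℝ), ∫⁻ s in {s | a < F s}, rieszKernel α (t - s) :=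
    Measurable.lintegral_prod_right' (f := fun z : ℝ × ℝ ↦
      ∫⁻ s in {s | z.2 < F s}, rieszKernel α (z.1 - s)) hmeas
  simp only [rieszForm, h1]
  rw [lintegral_mul_ofReal_eq_lintegral_superlevel hG hG0 h2]
  refine lintegral_congr fun b ↦ ?_
  exact lintegral_lintegral_swap hmeas.aemeasurable

theorem setLIntegral_setLIntegral_rieszKernel_le (hα0 : 0 < α) (hα1 : α < 1) {E H : Set ℝ}
    (hEm : MeasurableSet E) (hE : volume E ≠ ⊤) :
    ∫⁻ t in H, ∫⁻ s in E, rieszKernel α (t - s) ≤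
      ENNReal.ofReal (1 + 2 / (1 - α)) * (volume E ^ (1 - α) * volume H) := by
  calc _ ≤ ∫⁻ t in H, ENNReal.ofReal (1 + 2 / (1 - α)) * volume E ^ (1 - α) :=
        lintegral_mono fun t ↦ setLIntegral_rieszKernel_le hα0 hα1 t hEm hE
    _ = _ := by rw [setLIntegral_const]; ring

/-- For two superlevel sets the interaction is at most a constant times `|E| ^ (1 - α) |H|`, with
either set allowed the smaller exponent. The exponent `1 - α` is given to the set of the lower
level: integrating over levels below `b` then yields `(3 - α) b ^ (p - 1)`, and the integral over
`b` is again layer cake. The two orderings of the levels account for the factor 2. -/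
theorem rieszForm_ofReal_le_of_normalized (hα0 : 0 < α) (hα1 : α < 1) (hp : p = 2 / (2 - α))
    {F G : ℝ → ℝ} (hF : Measurable F) (hF0 : ∀ x, 0 ≤ F x)
    (hG : Measurable G) (hG0 : ∀ x, 0 ≤ G x)
    (hFp : ∫⁻ x, ENNReal.ofReal (F x ^ p) ≤ 1) (hGp : ∫⁻ x, ENNReal.ofReal (G x ^ p) ≤ 1) :
    rieszForm α (fun s ↦ ENNReal.ofReal (F s)) (fun t ↦ ENNReal.ofReal (G t)) ≤
      ENNReal.ofReal (2 * (1 + 2 / (1 - α)) * (3 - α)) := by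
  have h2α : 0 < 2 - α := by linarith
  have hp1 : 1 < p := by rw [hp, lt_div_iff₀ h2α]; linarith
  have h1α := sub_pos.2 hα1
  set C := ENNReal.ofReal (1 + 2 / (1 - α)) with hC
  have hu := measurable_distribution F
  have hv := measurable_distribution G
  set J : ℝ → ℝ → ℝ≥0∞ := fun b a ↦ ∫⁻ t in {t | b < G t}, ∫⁻ s in {s | a < F s},
    rieszKernel α (t - s) with hJ
  have hJ1 : ∀ b, ∀ a > 0, J b a ≤ C * (distribution F a ^ (1 - α) * distribution G b) :=
    fun b a ha ↦ setLIntegral_setLIntegral_rieszKernel_le hα0 hα1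
      (measurableSet_lt measurable_const hF) (distribution_ne_top hF hp1 hFp ha)
  have hJ2 : ∀ b > 0, ∀ a, J b a ≤ C * (distribution G b ^ (1 - α) * distribution F a) := by
    intro b hb a
    have := setLIntegral_setLIntegral_rieszKernel_le (H := {s | a < F s}) hα0 hα1
      (measurableSet_lt measurable_const hG) (distribution_ne_top hG hp1 hGp hb)
    refine le_trans (le_of_eq ?_) this
    rw [hJ]
    simp only
    rw [lintegral_lintegral_swap (measurable_rieszKernel_sub α).aemeasurable]
    simp only [rieszKernel_sub_comm α]
  have hhalf : ∀ {F G : ℝ → ℝ}, Measurable F → (∀ x, 0 ≤ F x) → Measurable G → (∀ x, 0 ≤ G x) →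
      (∫⁻ x, ENNReal.ofReal (F x ^ p) ≤ 1) → (∫⁻ x, ENNReal.ofReal (G x ^ p) ≤ 1) →
      ∫⁻ b in Ioi (0 : ℝ), ∫⁻ a in Ioo 0 b, C * (distribution F a ^ (1 - α) * distribution G b) ≤
        C * ENNReal.ofReal (3 - α) := by
    intro F G hF hF0 hG hG0 hFp hGp
    have hu := measurable_distribution F
    have hv := measurable_distribution G
    calc _ ≤ ∫⁻ b in Ioi (0 : ℝ), C * ENNReal.ofReal (3 - α) *
          (distribution G b * ENNReal.ofReal (b ^ (p - 1))) := by
          refine setLIntegral_mono' measurableSet_Ioi fun b hb ↦ ?_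
          rw [lintegral_const_mul _ (by fun_prop), lintegral_mul_const _ (by fun_prop)]
          rw [show C * ENNReal.ofReal (3 - α) *
              (distribution G b * ENNReal.ofReal (b ^ (p - 1))) = C * (ENNReal.ofReal (3 - α) *
              ENNReal.ofReal (b ^ (p - 1)) * distribution G b) by ring]
          gcongr
          exact setLIntegral_distribution_rpow_le hα0 hα1 hp hF hF0 hFp hb
      _ ≤ _ := by
          rw [lintegral_const_mul _ (by fun_prop)]
          exact mul_le_of_le_one_right' (lintegral_distribution_mul_rpow hG hG0 hp1 hGp)
  rw [rieszForm_eq_lintegral_superlevel hF hF0 hG hG0]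
  have hsplit : ∀ b ∈ Ioi (0 : ℝ), ∫⁻ a in Ioi (0 : ℝ), J b a ≤
      (∫⁻ a in Ioo 0 b, C * (distribution F a ^ (1 - α) * distribution G b)) +
        ∫⁻ a in Ici b, C * (distribution G b ^ (1 - α) * distribution F a) := by
    intro b hb
    rw [← Ioo_union_Ici_eq_Ioi (show (0 : ℝ) < b from hb)]
    refine (lintegral_union_le _ _ _).trans (add_le_add ?_ ?_)
    · exact setLIntegral_mono' measurableSet_Ioo fun a ha ↦ hJ1 b a ha.1
    · exact setLIntegral_mono' measurableSet_Ici fun a _ ↦ hJ2 b hb a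
  -- Tonelli on the region `0 < b ≤ a` puts the second half in the form of the first, with `F` and
  -- `G` exchanged.
  have hsecond : ∫⁻ b in Ioi (0 : ℝ), ∫⁻ a in Ici b,
        C * (distribution G b ^ (1 - α) * distribution F a) =
      ∫⁻ a in Ioi (0 : ℝ), ∫⁻ b in Ioo 0 a,
        C * (distribution G b ^ (1 - α) * distribution F a) := by
    have hm : Measurable fun z : ℝ × ℝ ↦ {z : ℝ × ℝ | 0 < z.1 ∧ z.1 ≤ z.2}.indicator
        (fun z ↦ C * (distribution G z.1 ^ (1 - α) * distribution F z.2)) z := by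
      refine Measurable.indicator ?_ ?_
      · exact measurable_const.mul (((hv.comp measurable_fst).pow_const _).mul
          (hu.comp measurable_snd))
      · exact (measurableSet_lt measurable_const measurable_fst).inter
          (measurableSet_le measurable_fst measurable_snd)
    calc _ = ∫⁻ b, ∫⁻ a, {z : ℝ × ℝ | 0 < z.1 ∧ z.1 ≤ z.2}.indicator
          (fun z ↦ C * (distribution G z.1 ^ (1 - α) * distribution F z.2)) (b, a) := by
          rw [← lintegral_indicator measurableSet_Ioi]
          refine lintegral_congr fun b ↦ ?_
          by_cases hb : 0 < b
          · rw [indicator_of_mem (show b ∈ Ioi 0 from hb), ← lintegral_indicator measurableSet_Ici]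
            refine lintegral_congr fun a ↦ ?_
            simp [indicator_apply, hb]
          · rw [indicator_of_notMem (show b ∉ Ioi 0 from hb)]
            simp [hb]
      _ = ∫⁻ a, ∫⁻ b, {z : ℝ × ℝ | 0 < z.1 ∧ z.1 ≤ z.2}.indicator
          (fun z ↦ C * (distribution G z.1 ^ (1 - α) * distribution F z.2)) (b, a) :=
          lintegral_lintegral_swap hm.aemeasurable
      _ = _ := by
          rw [← lintegral_indicator measurableSet_Ioi]
          refine lintegral_congr fun a ↦ ?_
          by_cases ha : 0 < a
          · rw [indicator_of_mem (show a ∈ Ioi 0 from ha), setLIntegral_congr Ioo_ae_eq_Ioc,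
              ← lintegral_indicator measurableSet_Ioc]
            refine lintegral_congr fun b ↦ ?_
            simp [indicator_apply]
          · rw [indicator_of_notMem (show a ∉ Ioi 0 from ha)]
            refine (lintegral_congr fun b ↦ ?_).trans lintegral_zero
            rw [indicator_of_notMem]
            rintro ⟨h1, h2⟩
            exact ha (lt_of_lt_of_le h1 h2)
  calc _ ≤ ∫⁻ b in Ioi (0 : ℝ),
        ((∫⁻ a in Ioo 0 b, C * (distribution F a ^ (1 - α) * distribution G b)) +
          ∫⁻ a in Ici b, C * (distribution G b ^ (1 - α) * distribution F a)) :=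
        setLIntegral_mono' measurableSet_Ioi hsplit
    _ ≤ (∫⁻ b in Ioi (0 : ℝ),
          ∫⁻ a in Ioo 0 b, C * (distribution F a ^ (1 - α) * distribution G b)) +
        ∫⁻ b in Ioi (0 : ℝ),
          ∫⁻ a in Ici b, C * (distribution G b ^ (1 - α) * distribution F a) := by
        apply le_of_eq
        refine lintegral_add_left' ?_ _
        have hI : ∀ b, ∫⁻ a in Ioo 0 b, C * (distribution F a ^ (1 - α) * distribution G b) =
            C * ((∫⁻ a in Ioo 0 b, distribution F a ^ (1 - α)) * distribution G b) := fun b ↦ by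
          rw [lintegral_const_mul _ (by fun_prop), lintegral_mul_const _ (by fun_prop)]
        simp only [hI]
        have hmono : Monotone fun b ↦ ∫⁻ a in Ioo 0 b, distribution F a ^ (1 - α) :=
          fun b b' hbb ↦ lintegral_mono_set (Ioo_subset_Ioo_right hbb)
        exact (measurable_const.mul (hmono.measurable.mul hv)).aemeasurable
    _ ≤ C * ENNReal.ofReal (3 - α) + C * ENNReal.ofReal (3 - α) := by
        rw [hsecond]
        exact add_le_add (hhalf hF hF0 hG hG0 hFp hGp) (hhalf hG hG0 hF hF0 hGp hFp)
    _ = _ := by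
        rw [hC, ← ENNReal.ofReal_mul (by positivity), ← ENNReal.ofReal_add
          (mul_nonneg (by positivity) (by linarith)) (mul_nonneg (by positivity) (by linarith))]
        congr 1
        ring

/-- The constant in the Hardy–Littlewood–Sobolev inequality. -/
def hlsConst (α : ℝ) : ℝ≥0∞ := ENNReal.ofReal (2 * (1 + 2 / (1 - α)) * (3 - α))

/-- The Hardy–Littlewood–Sobolev inequality on the line, for equal exponents. -/
theorem rieszForm_le (hα0 : 0 < α) (hα1 : α < 1) (hp : p = 2 / (2 - α)) {F G : ℝ → ℝ≥0∞}
    (hF : AEMeasurable F) (hG : AEMeasurable G) :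
    rieszForm α F G ≤
      hlsConst α * ((∫⁻ s, F s ^ p) ^ (1 / p) * (∫⁻ t, G t ^ p) ^ (1 / p)) := by
  have h2α : 0 < 2 - α := by linarith
  have hp1 : 1 < p := by rw [hp, lt_div_iff₀ h2α]; linarith
  have hp0 : 0 < p := by linarith
  have hC : hlsConst α ≠ 0 := by
    have : 0 < 1 - α := by linarith
    have h3 : 0 < 3 - α := by linarith
    have : 0 < 2 * (1 + 2 / (1 - α)) * (3 - α) := by positivity
    simpa [hlsConst] using this
  -- reduction to measurable functions
  have hcongr : ∀ {F F' G G' : ℝ → ℝ≥0∞}, F =ᵐ[volume] F' → G =ᵐ[volume] G' →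
      rieszForm α F G = rieszForm α F' G' := by
    intro F F' G G' h h'
    refine lintegral_congr_ae ?_
    filter_upwards [h'] with t ht
    refine lintegral_congr_ae ?_
    filter_upwards [h] with s hs
    rw [ht, hs]
  have hzero : ∀ {F : ℝ → ℝ≥0∞}, AEMeasurable F → ∫⁻ s, F s ^ p = 0 → F =ᵐ[volume] 0 := by
    intro F hF h0
    rw [lintegral_eq_zero_iff' (by fun_prop)] at h0
    filter_upwards [h0] with s hs
    exact (ENNReal.rpow_eq_zero_iff_of_pos hp0).1 hs
  set A := ∫⁻ s, F s ^ p with hA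
  set B := ∫⁻ s, G s ^ p with hB
  by_cases hA0 : A = 0
  · rw [hcongr (hzero hF hA0) (ae_eq_refl G)]
    simp [rieszForm]
  by_cases hB0 : B = 0
  · rw [hcongr (ae_eq_refl F) (hzero hG hB0)]
    simp [rieszForm]
  have hp' : 0 < 1 / p := by positivity
  by_cases hAt : A = ⊤
  · rw [hAt, ENNReal.top_rpow_of_pos hp', ENNReal.top_mul, ENNReal.mul_top hC]
    · exact le_top
    · simp [ENNReal.rpow_eq_zero_iff, hB0, hp0.le]
  by_cases hBt : B = ⊤
  · rw [hBt, ENNReal.top_rpow_of_pos hp', ENNReal.mul_top, ENNReal.mul_top hC]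
    · exact le_top
    · simp [ENNReal.rpow_eq_zero_iff, hA0, hp0.le]
  -- normalization
  have hnorm : ∀ {F : ℝ → ℝ≥0∞}, AEMeasurable F → ∫⁻ s, F s ^ p ≠ 0 → ∫⁻ s, F s ^ p ≠ ⊤ →
      ∃ F' : ℝ → ℝ, Measurable F' ∧ (∀ s, 0 ≤ F' s) ∧ ∫⁻ s, ENNReal.ofReal (F' s ^ p) ≤ 1 ∧
        F =ᵐ[volume] fun s ↦ (∫⁻ s, F s ^ p) ^ (1 / p) * ENNReal.ofReal (F' s) := by
    intro F hF h0 ht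
    set A := ∫⁻ s, F s ^ p with hA
    have hA0 : A ^ (1 / p) ≠ 0 := by simp [ENNReal.rpow_eq_zero_iff, h0, hp0.le]
    have hAt : A ^ (1 / p) ≠ ⊤ := by simp [ENNReal.rpow_eq_top_iff, h0, ht]
    have hfin : ∀ᵐ s, F s < ⊤ := by
      filter_upwards [ae_lt_top' (by fun_prop) ht] with s hs
      exact (ENNReal.rpow_lt_top_iff_of_pos hp0).1 hs
    set F' : ℝ → ℝ := fun s ↦ ((A ^ (1 / p))⁻¹ * hF.mk F s).toReal with hF'
    have hFF' : F =ᵐ[volume] fun s ↦ A ^ (1 / p) * ENNReal.ofReal (F' s) := by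
      filter_upwards [hfin, hF.ae_eq_mk] with s hs hs'
      simp only [hF']
      rw [← hs', ENNReal.ofReal_toReal (ENNReal.mul_ne_top (ENNReal.inv_ne_top.2 hA0) hs.ne),
        ← mul_assoc, ENNReal.mul_inv_cancel hA0 hAt, one_mul]
    have hmeas : Measurable F' :=
      (measurable_const.mul hF.measurable_mk).ennreal_toReal
    refine ⟨F', hmeas, fun s ↦ ENNReal.toReal_nonneg, ?_, hFF'⟩
    -- The normalisation of `F'` is obtained by cancelling `A`, which is neither zero nor infinite.
    have hA' : A = A * ∫⁻ s, ENNReal.ofReal (F' s ^ p) := by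
      conv_lhs => rw [hA]
      rw [← lintegral_const_mul _ (by fun_prop)]
      refine lintegral_congr_ae ?_
      filter_upwards [hFF'] with s hs
      rw [hs, ENNReal.mul_rpow_of_nonneg _ _ hp0.le, ← ENNReal.rpow_mul,
        one_div_mul_cancel hp0.ne', ENNReal.rpow_one,
        ENNReal.ofReal_rpow_of_nonneg ENNReal.toReal_nonneg hp0.le]
    have : A * 1 = A * ∫⁻ s, ENNReal.ofReal (F' s ^ p) := by rw [mul_one]; exact hA'
    exact ((ENNReal.mul_right_inj h0 ht).1 this).ge
  obtain ⟨F', hF'm, hF'0, hF'1, hFF'⟩ := hnorm hF hA0 hAt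
  obtain ⟨G', hG'm, hG'0, hG'1, hGG'⟩ := hnorm hG hB0 hBt
  rw [hcongr hFF' hGG']
  have hmul : rieszForm α (fun s ↦ A ^ (1 / p) * ENNReal.ofReal (F' s))
      (fun s ↦ B ^ (1 / p) * ENNReal.ofReal (G' s)) = A ^ (1 / p) * B ^ (1 / p) *
      rieszForm α (fun s ↦ ENNReal.ofReal (F' s)) (fun s ↦ ENNReal.ofReal (G' s)) := by
    have hcf : A ^ (1 / p) ≠ ⊤ := by simp [ENNReal.rpow_eq_top_iff, hA0, hAt]
    have hcg : B ^ (1 / p) ≠ ⊤ := by simp [ENNReal.rpow_eq_top_iff, hB0, hBt]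
    rw [rieszForm, rieszForm, ← lintegral_const_mul' _ _ (ENNReal.mul_ne_top hcf hcg)]
    refine lintegral_congr fun t ↦ ?_
    rw [← lintegral_const_mul' _ _ (ENNReal.mul_ne_top hcf hcg)]
    refine lintegral_congr fun s ↦ ?_
    ring
  rw [hmul, mul_comm]
  gcongr
  exact rieszForm_ofReal_le_of_normalized hα0 hα1 hp hF'm hF'0 hG'm hG'0 hF'1 hG'1

end HLS

end Dispersive

end

/-! ### Riesz representation of functionals on `Lᵖ`, `1 < p < 2` -/

noncomputable section

namespace Dispersive

open Set Filter Topology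

variable {X : Type*} [MeasurableSpace X] {μ : Measure X}

theorem tendsto_toLp_indicator {P : ℝ≥0∞} (hP0 : P ≠ 0) (hPt : P ≠ ⊤) [Fact (1 ≤ P)]
    {G : X → ℂ} (hG : MemLp G P μ) {S : ℕ → Set X} (hS : ∀ N, MeasurableSet (S N))
    (hev : ∀ x, ∀ᶠ N in atTop, x ∈ S N) :
    Tendsto (fun N ↦ (hG.indicator (hS N)).toLp ((S N).indicator G)) atTop (𝓝 (hG.toLp G)) := by
  rw [Lp.tendsto_Lp_iff_tendsto_eLpNorm'']
  have hpos : 0 < P.toReal := ENNReal.toReal_pos hP0 hPt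
  have hval : ∀ N, eLpNorm ((S N).indicator G - G) P μ =
      (∫⁻ x, (S N)ᶜ.indicator (fun x ↦ ‖G x‖ₑ ^ P.toReal) x ∂μ) ^ (1 / P.toReal) := by
    intro N
    rw [eLpNorm_eq_lintegral_rpow_enorm_toReal hP0 hPt]
    congr 1
    refine lintegral_congr fun x ↦ ?_
    by_cases hx : x ∈ S N
    · simp [hx, hpos]
    · simp [hx]
  have hlim : Tendsto (fun N ↦ ∫⁻ x, (S N)ᶜ.indicator (fun x ↦ ‖G x‖ₑ ^ P.toReal) x ∂μ) atTop
      (𝓝 (∫⁻ _, 0 ∂μ)) := by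
    refine tendsto_lintegral_of_dominated_convergence' (fun x ↦ ‖G x‖ₑ ^ P.toReal) ?_ ?_ ?_ ?_
    · exact fun N ↦ (hG.aestronglyMeasurable.enorm.pow_const _).indicator (hS N).compl
    · exact fun N ↦ Eventually.of_forall fun x ↦ indicator_le_self _ _ x
    · exact ((eLpNorm_lt_top_iff_lintegral_rpow_enorm_lt_top hP0 hPt).1 hG.2).ne
    · refine Eventually.of_forall fun x ↦ tendsto_const_nhds.congr' ?_
      filter_upwards [hev x] with N hN
      simp [hN]
  simp only [hval]
  rw [lintegral_zero] at hlim
  have := (ENNReal.continuous_rpow_const (y := 1 / P.toReal)).tendsto 0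
  rw [ENNReal.zero_rpow_of_pos (by positivity)] at this
  exact this.comp hlim

/-- A positive weight `W` such that multiplication by `W` maps `L²` to `Lᵖ`, with the sets where it
is bounded below. -/
theorem exists_weight (μ : Measure X) [SigmaFinite μ] {s : ℝ} (hs : 0 < s) :
    ∃ W : X → ℝ, (∀ x, 0 < W x) ∧ Measurable W ∧
      MemLp (fun x ↦ (W x : ℂ)) (ENNReal.ofReal s⁻¹) μ ∧
      ∀ c > 0, μ {x | c ≤ W x} < ⊤ := by
  obtain ⟨g, hg0, hgm, hg⟩ := exists_pos_lintegral_lt_of_sigmaFinite μ one_ne_zero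
  have hs' : 0 < s⁻¹ := inv_pos.2 hs
  have hWm : Measurable fun x ↦ (g x : ℝ) ^ s := by fun_prop
  -- With `g` positive and integrable, `W = g ^ s` has `W ^ (1/s) = g` integrable, and Markov's
  -- inequality for `g` bounds its superlevel sets.
  refine ⟨fun x ↦ (g x : ℝ) ^ s, fun x ↦ Real.rpow_pos_of_pos (hg0 x) _, hWm, ?_, ?_⟩
  · refine ⟨(measurable_ofReal.comp hWm).aestronglyMeasurable, ?_⟩
    rw [eLpNorm_lt_top_iff_lintegral_rpow_enorm_lt_top (by simpa using hs) ENNReal.ofReal_ne_top]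
    refine lt_of_le_of_lt (lintegral_mono fun x ↦ ?_) (hg.trans ENNReal.one_lt_top)
    rw [ENNReal.toReal_ofReal hs'.le, ← ofReal_norm, norm_real,
      Real.norm_of_nonneg (by positivity), ENNReal.ofReal_rpow_of_nonneg (by positivity) hs'.le,
      ← Real.rpow_mul (by positivity), mul_inv_cancel₀ hs.ne', Real.rpow_one, ENNReal.ofReal_coe_nnreal]
  · intro c hc
    refine lt_of_le_of_lt (measure_mono (t := {x | ENNReal.ofReal (c ^ s⁻¹) ≤ g x}) fun x hx ↦ ?_)
      (lt_of_le_of_lt (meas_ge_le_lintegral_div (by fun_prop) ?_ ENNReal.ofReal_ne_top)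
        (ENNReal.div_lt_top (hg.trans ENNReal.one_lt_top).ne ?_))
    · have h1 : c ^ s⁻¹ ≤ g x := by
        have := Real.rpow_le_rpow hc.le hx hs'.le
        rwa [← Real.rpow_mul (by positivity), mul_inv_cancel₀ hs.ne', Real.rpow_one] at this
      rw [mem_ofPred_eq, ← ENNReal.ofReal_coe_nnreal]
      exact ENNReal.ofReal_le_ofReal h1
    all_goals simpa using Real.rpow_pos_of_pos hc _

/-- On functions which are square integrable against a suitable weight, a functional on `Lᵖ` is
given by integration against a measurable function. -/
theorem exists_repr_of_div_mem_L2 [SigmaFinite μ] {p : ℝ} (hp1 : 1 < p) (hp2 : p < 2)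
    [Fact (1 ≤ ENNReal.ofReal p)] (L : Lp ℂ (ENNReal.ofReal p) μ →L[ℂ] ℂ)
    {W : X → ℝ} (hW0 : ∀ x, 0 < W x)
    (hWp : MemLp (fun x ↦ (W x : ℂ)) (ENNReal.ofReal (1 / p - 1 / 2)⁻¹) μ) (hWm : Measurable W) :
    ∃ U : X → ℂ, Measurable U ∧ ∀ (G : X → ℂ) (hG : MemLp G (ENNReal.ofReal p) μ),
      MemLp (fun x ↦ G x / W x) 2 μ → L (hG.toLp G) = ∫ x, U x * G x ∂μ := by
  have hs : 0 < 1 / p - 1 / 2 := sub_pos.2 (one_div_lt_one_div_of_lt (by linarith) hp2)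
  have hs2 : 1 / p - 1 / 2 < 1 := by
    have : 1 / p < 1 := by rw [div_lt_one (by linarith)]; exact hp1
    linarith
  -- The weight exponent is chosen so that `(1/p - 1/2) + 1/2 = 1/p`: multiplication by `W` then
  -- maps `L²` to `L^p`.
  have htriple : ENNReal.HolderTriple (ENNReal.ofReal (1 / p - 1 / 2)⁻¹) 2 (ENNReal.ofReal p) := by
    have : Real.HolderTriple (1 / p - 1 / 2)⁻¹ 2 p :=
      ⟨by rw [inv_inv]; ring, by positivity, by positivity⟩
    simpa using this.ennrealOfReal
  have : Fact (1 ≤ ENNReal.ofReal (1 / p - 1 / 2)⁻¹) :=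
    ⟨by rw [ENNReal.one_le_ofReal]; exact (one_le_inv₀ hs).2 hs2.le⟩
  set J : Lp ℂ 2 μ →L[ℂ] Lp ℂ (ENNReal.ofReal p) μ :=
    (ContinuousLinearMap.mul ℂ ℂ).holderL μ (ENNReal.ofReal (1 / p - 1 / 2)⁻¹) 2
      (ENNReal.ofReal p) (hWp.toLp _) with hJ
  -- Pulled back along multiplication by `W`, the functional lives on the Hilbert space `L²` and is
  -- an inner product with some `V`. Undoing the weight gives the density `conj V / W`.
  set V : Lp ℂ 2 μ := (InnerProductSpace.toDual ℂ (Lp ℂ 2 μ)).symm (L ∘L J) with hV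
  have hVm : Measurable V := (Lp.stronglyMeasurable V).measurable
  refine ⟨fun x ↦ (starRingEnd ℂ) (V x) / W x, ?_, ?_⟩
  · exact (continuous_conj.measurable.comp hVm).div (by fun_prop)
  intro G hG hG2
  have h1 : J (hG2.toLp _) = hG.toLp G := by
    rw [hJ, ContinuousLinearMap.holderL_apply_apply, ContinuousLinearMap.holder]
    apply MemLp.toLp_congr
    filter_upwards [hWp.coeFn_toLp, hG2.coeFn_toLp] with x hx hx'
    have : (W x : ℂ) ≠ 0 := by exact_mod_cast (hW0 x).ne'
    simp only [ContinuousLinearMap.mul_apply', hx, hx']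
    field_simp
  have h2 : L (J (hG2.toLp _)) = inner ℂ V (hG2.toLp _) := by
    rw [hV, ← InnerProductSpace.toDual_apply_apply, LinearIsometryEquiv.apply_symm_apply]
    rfl
  rw [← h1, h2, L2.inner_def]
  refine integral_congr_ae ?_
  filter_upwards [hG2.coeFn_toLp] with x hx
  rw [hx, RCLike.inner_apply]
  ring

theorem memLp_of_bounded_of_finite_support {P : ℝ≥0∞} {G : X → ℂ} {S : Set X}
    (hS : MeasurableSet S) (hSμ : μ S < ⊤) (hG : AEStronglyMeasurable G μ) {C : ℝ}
    (h0 : ∀ x ∉ S, G x = 0) (hC : ∀ x ∈ S, ‖G x‖ ≤ C) : MemLp G P μ := by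
  refine (memLp_indicator_const (μ := μ) P hS C (Or.inr hSμ.ne)).mono hG
    (Eventually.of_forall fun x ↦ ?_)
  by_cases hx : x ∈ S
  · rw [indicator_of_mem hx]
    exact (hC x hx).trans (le_abs_self C)
  · simp [h0 x hx]

/-- Riesz representation of functionals on `Lᵖ` for `1 < p < 2`. -/
theorem exists_memLp_repr [SigmaFinite μ] {p q : ℝ} (hp1 : 1 < p) (hp2 : p < 2)
    (hpq : p.HolderConjugate q) [Fact (1 ≤ ENNReal.ofReal p)]
    (L : Lp ℂ (ENNReal.ofReal p) μ →L[ℂ] ℂ) :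
    ∃ U : X → ℂ, MemLp U (ENNReal.ofReal q) μ ∧
      eLpNorm U (ENNReal.ofReal q) μ ≤ ENNReal.ofReal ‖L‖ ∧
      ∀ (G : X → ℂ) (hG : MemLp G (ENNReal.ofReal p) μ), L (hG.toLp G) = ∫ x, U x * G x ∂μ := by
  have hp0 : 0 < p := by linarith
  have hq0 : 0 < q := hpq.symm.pos
  have hq1 : 1 < q := hpq.symm.lt
  have hs : 0 < 1 / p - 1 / 2 := sub_pos.2 (one_div_lt_one_div_of_lt (by linarith) hp2)
  have hpE0 : ENNReal.ofReal p ≠ 0 := by simpa using hp0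
  have hqE0 : ENNReal.ofReal q ≠ 0 := by simpa using hq0
  obtain ⟨W, hW0, hWm, hWp, hWfin⟩ := exists_weight μ hs
  obtain ⟨U, hUm, hU⟩ := exists_repr_of_div_mem_L2 hp1 hp2 L hW0 hWp hWm
  have trunc : ∀ {H : X → ℂ}, Measurable H → ∀ N : ℕ,
      MeasurableSet {x | ‖H x‖ ≤ N ∧ (1 : ℝ) / (N + 1) ≤ W x} := fun {H} hH N ↦
    (measurableSet_le hH.norm measurable_const).inter (measurableSet_le measurable_const hWm)
  have truncfin : ∀ (H : X → ℂ) (N : ℕ), μ {x | ‖H x‖ ≤ N ∧ (1 : ℝ) / (N + 1) ≤ W x} < ⊤ :=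
    fun H N ↦ (measure_mono fun x hx ↦ hx.2).trans_lt (hWfin (1 / (N + 1)) (by positivity))
  have truncev : ∀ (H : X → ℂ) (x : X),
      ∀ᶠ N : ℕ in atTop, x ∈ {x | ‖H x‖ ≤ N ∧ (1 : ℝ) / (N + 1) ≤ W x} := by
    intro H x
    filter_upwards [eventually_ge_atTop ⌈‖H x‖⌉₊,
      tendsto_one_div_add_atTop_nhds_zero_nat.eventually_le_const (hW0 x)] with N h1 h2
    exact ⟨Nat.ceil_le.1 h1, h2⟩
  have hdiv : ∀ (N : ℕ) (z : ℂ) (c : ℝ) (x : X), ‖z‖ ≤ c → (1 : ℝ) / (N + 1) ≤ W x →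
      ‖z / W x‖ ≤ c * (N + 1) := by
    intro N z c x hz hx
    have hN : (0 : ℝ) < N + 1 := by positivity
    rw [norm_div, norm_real, Real.norm_of_nonneg (hW0 x).le, div_eq_mul_inv]
    refine mul_le_mul hz ?_ (inv_nonneg.2 (hW0 x).le) ((norm_nonneg z).trans hz)
    rw [one_div] at hx
    exact inv_le_of_inv_le₀ hN hx
  -- the norm of `U`
  have hnormU : ∀ N : ℕ, ∫⁻ x in {x | ‖U x‖ ≤ N ∧ (1 : ℝ) / (N + 1) ≤ W x}, ‖U x‖ₑ ^ q ∂μ ≤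
      ENNReal.ofReal ‖L‖ ^ q := by
    intro N
    set S := {x | ‖U x‖ ≤ N ∧ (1 : ℝ) / (N + 1) ≤ W x} with hSdef
    have hS : MeasurableSet S := trunc hUm N
    have hSf : μ S < ⊤ := truncfin U N
    -- The extremal test function: `U G = |U| ^ q` and `|G| ^ p = |U| ^ q` on `S`. Truncation to `S`
    -- makes `I = ∫_S |U| ^ q` finite beforehand, so that `I ≤ ‖L‖ I ^ (1/p)` may be divided by `I ^
    -- (1/p)`.
    set G : X → ℂ := S.indicator fun x ↦ (starRingEnd ℂ) (U x) * ((‖U x‖ ^ (q - 2) : ℝ) : ℂ) with hGdef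
    have hq2 : 0 < q - 2 := by
      have := hpq.inv_add_inv_eq_one
      have h2 : 2⁻¹ < p⁻¹ := inv_strictAnti₀ hp0 hp2
      have h3 : q⁻¹ < 2⁻¹ := by linarith
      have := (inv_lt_inv₀ hq0 two_pos).1 h3
      linarith
    have hGm : AEStronglyMeasurable G μ := by
      refine Measurable.aestronglyMeasurable (Measurable.indicator ?_ hS)
      exact (continuous_conj.measurable.comp hUm).mul
        (measurable_ofReal.comp (hUm.norm.pow_const _))
    have hGn : ∀ x ∈ S, ‖G x‖ = ‖U x‖ ^ (q - 1) := by
      intro x hx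
      simp only [hGdef, indicator_of_mem hx, norm_mul, RCLike.norm_conj, norm_real]
      rw [Real.norm_of_nonneg (by positivity)]
      have : ‖U x‖ ^ (q - 1) = ‖U x‖ ^ ((1 : ℝ) + (q - 2)) := by ring_nf
      rw [this, Real.rpow_add_of_nonneg (norm_nonneg _) zero_le_one hq2.le, Real.rpow_one]
    have hGb : ∀ x ∈ S, ‖G x‖ ≤ (N : ℝ) ^ (q - 1) := by
      intro x hx
      rw [hGn x hx]
      exact Real.rpow_le_rpow (norm_nonneg _) hx.1 (by linarith)
    have hGp : MemLp G (ENNReal.ofReal p) μ := memLp_of_bounded_of_finite_support hS hSf hGm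
      (fun x hx ↦ indicator_of_notMem hx _) hGb
    have hG2 : MemLp (fun x ↦ G x / W x) 2 μ := by
      refine memLp_of_bounded_of_finite_support (C := (N : ℝ) ^ (q - 1) * (N + 1)) hS hSf
        (hGm.div₀ (by fun_prop)) (fun x hx ↦ by simp [hGdef, hx]) fun x hx ↦ ?_
      exact hdiv N _ _ x (hGb x hx) hx.2
    have hint : Integrable (fun x ↦ S.indicator (fun x ↦ ‖U x‖ ^ q) x) μ := by
      rw [integrable_indicator_iff hS]
      refine Measure.integrableOn_of_bounded (M := (N : ℝ) ^ q) hSf.ne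
        (hUm.norm.pow_const _).aestronglyMeasurable ?_
      filter_upwards [ae_restrict_mem hS] with x hx
      rw [Real.norm_of_nonneg (by positivity)]
      exact Real.rpow_le_rpow (norm_nonneg _) hx.1 hq0.le
    set I := ∫ x, S.indicator (fun x ↦ ‖U x‖ ^ q) x ∂μ with hI
    have hI0 : 0 ≤ I := integral_nonneg fun x ↦ indicator_nonneg (fun x _ ↦ by positivity) x
    have hIe : ∫⁻ x in S, ‖U x‖ₑ ^ q ∂μ = ENNReal.ofReal I := by
      rw [hI, ofReal_integral_eq_lintegral_ofReal hint
        (Eventually.of_forall fun x ↦ indicator_nonneg (fun x _ ↦ by positivity) x),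
        ← lintegral_indicator hS]
      refine lintegral_congr fun x ↦ ?_
      by_cases hx : x ∈ S
      · simp only [indicator_of_mem hx]
        rw [← ofReal_norm, ENNReal.ofReal_rpow_of_nonneg (norm_nonneg _) hq0.le]
      · simp [hx]
    have hLG : L (hGp.toLp G) = (I : ℂ) := by
      rw [hU G hGp hG2, hI, ← integral_complex_ofReal]
      refine integral_congr_ae (Eventually.of_forall fun x ↦ ?_)
      by_cases hx : x ∈ S
      · simp only [hGdef, indicator_of_mem hx]
        rw [← mul_assoc, mul_conj, normSq_eq_norm_sq, ← ofReal_mul, ← Real.rpow_natCast,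
          ← Real.rpow_add_of_nonneg (norm_nonneg _) (by norm_num) hq2.le]
        norm_num
      · simp [hGdef, hx]
    have hGnorm : ‖hGp.toLp G‖ = I ^ (1 / p) := by
      have hconj : (q - 1) * p = q := by
        have := hpq.symm.sub_one_mul_conj
        linarith
      rw [Lp.norm_toLp, eLpNorm_eq_lintegral_rpow_enorm_toReal hpE0 ENNReal.ofReal_ne_top,
        ENNReal.toReal_ofReal hp0.le]
      have : ∫⁻ x, ‖G x‖ₑ ^ p ∂μ = ENNReal.ofReal I := by
        rw [← hIe, ← lintegral_indicator hS]
        refine lintegral_congr fun x ↦ ?_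
        by_cases hx : x ∈ S
        · rw [indicator_of_mem hx, ← ofReal_norm, ← ofReal_norm, hGn x hx,
            ENNReal.ofReal_rpow_of_nonneg (by positivity) hp0.le,
            ENNReal.ofReal_rpow_of_nonneg (by positivity) hq0.le, ← Real.rpow_mul (by positivity),
            hconj]
        · simp [hGdef, hx, hp0]
      rw [this, ENNReal.ofReal_rpow_of_nonneg hI0 (by positivity),
        ENNReal.toReal_ofReal (by positivity)]
    have hle : I ≤ ‖L‖ * I ^ (1 / p) := by
      have := L.le_opNorm (hGp.toLp G)
      rw [hLG, hGnorm, norm_real, Real.norm_of_nonneg hI0] at this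
      exact this
    rw [hIe, ENNReal.ofReal_rpow_of_nonneg (norm_nonneg _) hq0.le]
    apply ENNReal.ofReal_le_ofReal
    rcases hI0.eq_or_lt with h | h
    · rw [← h]; positivity
    · have hdec : I = I ^ (1 / q) * I ^ (1 / p) := by
        rw [← Real.rpow_add h, one_div, one_div, add_comm, hpq.inv_add_inv_eq_one, Real.rpow_one]
      have h1 : I ^ (1 / q) ≤ ‖L‖ := by
        have hpos := Real.rpow_pos_of_pos h (1 / p)
        conv_lhs at hle => rw [hdec]
        exact le_of_mul_le_mul_right hle hpos
      have := Real.rpow_le_rpow (by positivity) h1 hq0.le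
      rwa [← Real.rpow_mul h.le, one_div_mul_cancel hq0.ne', Real.rpow_one] at this
  have hUlint : ∫⁻ x, ‖U x‖ₑ ^ q ∂μ ≤ ENNReal.ofReal ‖L‖ ^ q := by
    have hmono : Monotone fun N : ℕ ↦ {x | ‖U x‖ ≤ N ∧ (1 : ℝ) / (N + 1) ≤ W x} := by
      intro M N hMN x hx
      have hMN' : (M : ℝ) ≤ N := by exact_mod_cast hMN
      refine ⟨hx.1.trans hMN', le_trans ?_ hx.2⟩
      exact one_div_le_one_div_of_le (by positivity) (by linarith)
    have hunion : ⋃ N : ℕ, {x | ‖U x‖ ≤ N ∧ (1 : ℝ) / (N + 1) ≤ W x} = univ :=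
      eq_univ_of_forall fun x ↦ mem_iUnion.2 (truncev U x).exists
    rw [← setLIntegral_univ, ← hunion, setLIntegral_iUnion_of_directed _ hmono.directed_le]
    exact iSup_le hnormU
  have hUnorm : eLpNorm U (ENNReal.ofReal q) μ ≤ ENNReal.ofReal ‖L‖ := by
    rw [eLpNorm_eq_lintegral_rpow_enorm_toReal hqE0 ENNReal.ofReal_ne_top,
      ENNReal.toReal_ofReal hq0.le, one_div, ENNReal.rpow_inv_le_iff hq0]
    exact hUlint
  have hUq : MemLp U (ENNReal.ofReal q) μ :=
    ⟨hUm.aestronglyMeasurable, hUnorm.trans_lt ENNReal.ofReal_lt_top⟩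
  refine ⟨U, hUq, hUnorm, fun G hG ↦ ?_⟩
  -- extension to all of `Lᵖ` by density
  have : Fact (1 ≤ ENNReal.ofReal q) := ⟨by rw [ENNReal.one_le_ofReal]; exact hq1.le⟩
  have : ENNReal.HolderConjugate (ENNReal.ofReal q) (ENNReal.ofReal p) := by
    simpa using hpq.symm.ennrealOfReal
  set K := (ContinuousLinearMap.mul ℂ ℂ).lpPairing μ (ENNReal.ofReal q) (ENNReal.ofReal p)
    (hUq.toLp U)
  have hK : ∀ (G : X → ℂ) (hG : MemLp G (ENNReal.ofReal p) μ),
      K (hG.toLp G) = ∫ x, U x * G x ∂μ := by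
    intro G hG
    simp only [K]
    rw [ContinuousLinearMap.lpPairing_eq_integral]
    refine integral_congr_ae ?_
    filter_upwards [hUq.coeFn_toLp, hG.coeFn_toLp] with x h1 h2
    rw [h1, h2]; rfl
  rw [← hK G hG]
  obtain ⟨G', hG'm, hGG'⟩ := hG.1
  have hG' : MemLp G' (ENNReal.ofReal p) μ := hG.ae_eq hGG'
  have hG'M : Measurable G' := hG'm.measurable
  have htoLp : hG.toLp G = hG'.toLp G' := MemLp.toLp_congr _ _ hGG'
  rw [htoLp]
  -- On the truncations `G' / W` is square integrable, so both functionals are given there by the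
  -- same integral; both are continuous on `L^p`.
  have hlim := tendsto_toLp_indicator hpE0 ENNReal.ofReal_ne_top hG' (trunc hG'M) (truncev G')
  refine tendsto_nhds_unique ((L.continuous.tendsto _).comp hlim)
    (((K.continuous.tendsto _).comp hlim).congr fun N ↦ ?_)
  simp only [Function.comp_apply]
  rw [hK, hU]
  refine memLp_of_bounded_of_finite_support (C := (N : ℝ) * (N + 1)) (trunc hG'M N) (truncfin G' N)
    ?_ (fun x hx ↦ by simp only [indicator_of_notMem hx, zero_div]) fun x hx ↦ ?_
  · exact ((hG'M.indicator (trunc hG'M N)).aestronglyMeasurable).div₀ (by fun_prop)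
  · rw [indicator_of_mem hx]
    exact hdiv N _ _ x hx.1 hx.2

end Dispersive

end

/-! ### Completeness of the Schwartz space and equicontinuity -/

noncomputable section

namespace Dispersive

open Set Filter Topology

section complete

variable {E F : Type*} [NormedAddCommGroup E] [NormedSpace ℝ E] [NormedAddCommGroup F]
  [NormedSpace ℝ F]

/-- Absolute convergence in all seminorms permits termwise differentiation. The seminorm bound for
the sum is kept because, applied to tails, it gives convergence in the Schwartz topology. -/
theorem exists_schwartzMap_tsum [CompleteSpace F] (d : ℕ → 𝓢(E, F))
    (hd : ∀ k m, Summable fun n ↦ SchwartzMap.seminorm ℝ k m (d n)) :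
    ∃ S : 𝓢(E, F), (∀ x, HasSum (fun n ↦ d n x) (S x)) ∧
      ∀ k m, SchwartzMap.seminorm ℝ k m S ≤ ∑' n, SchwartzMap.seminorm ℝ k m (d n) := by
  have hbound : ∀ (m n : ℕ) (x : E), ‖iteratedFDeriv ℝ m (d n) x‖ ≤
      SchwartzMap.seminorm ℝ 0 m (d n) := fun m n x ↦
    SchwartzMap.norm_iteratedFDeriv_le_seminorm ℝ (d n) m x
  have hsmooth : ContDiff ℝ ∞ fun x ↦ ∑' n, d n x :=
    contDiff_tsum (fun n ↦ (d n).smooth _) (fun m _ ↦ hd 0 m) fun m n x _ ↦ hbound m n x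
  have hderiv : ∀ (m : ℕ) (x : E), iteratedFDeriv ℝ m (fun x ↦ ∑' n, d n x) x =
      ∑' n, iteratedFDeriv ℝ m (d n) x := by
    intro m x
    exact iteratedFDeriv_tsum_apply (N := (⊤ : ℕ∞)) (fun n ↦ (d n).smooth _) (fun m _ ↦ hd 0 m)
      (fun m n x _ ↦ hbound m n x) (by exact_mod_cast le_top) x
  have hdecay : ∀ (k m : ℕ) (x : E), ‖x‖ ^ k * ‖iteratedFDeriv ℝ m (fun x ↦ ∑' n, d n x) x‖ ≤
      ∑' n, SchwartzMap.seminorm ℝ k m (d n) := by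
    intro k m x
    have hs : Summable fun n ↦ ‖iteratedFDeriv ℝ m (d n) x‖ :=
      (hd 0 m).of_nonneg_of_le (fun n ↦ norm_nonneg _) fun n ↦ hbound m n x
    rw [hderiv]
    calc _ ≤ ‖x‖ ^ k * ∑' n, ‖iteratedFDeriv ℝ m (d n) x‖ := by
          gcongr; exact norm_tsum_le_tsum_norm hs
      _ = ∑' n, ‖x‖ ^ k * ‖iteratedFDeriv ℝ m (d n) x‖ := tsum_mul_left.symm
      _ ≤ _ := (hs.mul_left _).tsum_le_tsum
          (fun n ↦ SchwartzMap.le_seminorm ℝ k m (d n) x) (hd k m)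
  refine ⟨⟨fun x ↦ ∑' n, d n x, hsmooth, fun k m ↦ ⟨_, hdecay k m⟩⟩, fun x ↦ ?_, fun k m ↦ ?_⟩
  · refine Summable.hasSum (Summable.of_norm_bounded (hd 0 0) fun n ↦ ?_)
    exact SchwartzMap.norm_le_seminorm ℝ (d n) x
  · exact SchwartzMap.seminorm_le_bound ℝ k m _
      (tsum_nonneg fun n ↦ apply_nonneg _ _) (hdecay k m)

theorem schwartz_isCountablyGenerated_uniformity : (uniformity 𝓢(E, F)).IsCountablyGenerated :=
  IsUniformAddGroup.uniformity_countably_generated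

/-- The topology is countably generated, so it suffices to sum rapidly convergent telescoping
series. Completeness then provides the Baire property used in the uniform boundedness principle. -/
instance schwartzMap_completeSpace [CompleteSpace F] : CompleteSpace 𝓢(E, F) := by
  have := schwartz_isCountablyGenerated_uniformity (E := E) (F := F)
  have hW := schwartz_withSeminorms ℝ E F
  set P : ℕ → Seminorm ℝ 𝓢(E, F) := fun N ↦
    (Finset.Iic (N, N)).sup (schwartzSeminormFamily ℝ E F) with hP
  have hle : ∀ {k m N : ℕ}, k ≤ N → m ≤ N → ∀ f, SchwartzMap.seminorm ℝ k m f ≤ P N f := by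
    intro k m N hk hm f
    exact Seminorm.le_def.1 (Finset.le_sup (f := schwartzSeminormFamily ℝ E F)
      (Finset.mem_Iic.2 (⟨hk, hm⟩ : (k, m) ≤ (N, N)))) f
  have hcont : ∀ N, Continuous (P N) := fun N ↦
    hW.finset_sups.continuous_seminorm (Finset.Iic (N, N))
  -- The `N`-th entourage controls all seminorms of index at most `(N, N)` by `2 ^ (-N)`. Every
  -- fixed seminorm is thus eventually summed by a geometric series.
  refine UniformSpace.complete_of_convergent_controlled_sequences
    (fun N ↦ {z | P N (z.2 - z.1) < (1 / 2) ^ N}) (fun N ↦ ?_) fun u hu ↦ ?_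
  · rw [uniformity_eq_comap_nhds_zero]
    refine ⟨{f | P N f < (1 / 2) ^ N}, ?_, fun z hz ↦ hz⟩
    refine (isOpen_lt (hcont N) continuous_const).mem_nhds ?_
    simp
  · set d : ℕ → 𝓢(E, F) := fun n ↦ u (n + 1) - u n with hdef
    have hd : ∀ k m, Summable fun n ↦ SchwartzMap.seminorm ℝ k m (d n) := by
      intro k m
      rw [← summable_nat_add_iff (max k m)]
      refine Summable.of_nonneg_of_le (fun n ↦ apply_nonneg _ _) (fun n ↦ ?_)
        ((summable_nat_add_iff (max k m)).2 summable_geometric_two)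
      exact (hle (by omega) (by omega) _).trans
        (hu (n + max k m) _ _ le_rfl (Nat.le_succ _)).le
    obtain ⟨S, hS, -⟩ := exists_schwartzMap_tsum d hd
    have hsum : ∀ n, ∑ j ∈ Finset.range n, d j = u n - u 0 := fun n ↦ Finset.sum_range_sub u n
    refine ⟨S + u 0, ?_⟩
    rw [hW.tendsto_nhds]
    rintro ⟨k, m⟩ ε hε
    have htail := tendsto_sum_nat_add fun n ↦ SchwartzMap.seminorm ℝ k m (d n)
    filter_upwards [htail.eventually_lt_const hε] with n hn
    refine lt_of_le_of_lt ?_ hn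
    -- The tail of the series is itself a Schwartz function and equals the error up to sign; its
    -- seminorms are bounded by tails of convergent series.
    obtain ⟨S', hS', hS'le⟩ := exists_schwartzMap_tsum (fun j ↦ d (j + n))
      fun k m ↦ (summable_nat_add_iff n).2 (hd k m)
    have : u n - (S + u 0) = -S' := by
      ext x
      have h0 : HasSum (fun j ↦ d (j + n) x) (S x - ∑ j ∈ Finset.range n, d j x) :=
        (hasSum_nat_add_iff' (f := fun j ↦ d j x) n).2 (hS x)
      have h1 : S' x = S x - ∑ j ∈ Finset.range n, d j x := (hS' x).unique h0
      have h2 : ∑ j ∈ Finset.range n, d j x = u n x - u 0 x := by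
        rw [← sub_apply, ← hsum, sum_apply]
      simp only [sub_apply, add_apply, neg_apply]
      rw [h1, h2]
      abel
    rw [this, map_neg_eq_map]
    exact hS'le k m

theorem schwartzMap_baireSpace [CompleteSpace F] : BaireSpace 𝓢(E, F) := by
  have := schwartz_isCountablyGenerated_uniformity (E := E) (F := F)
  have := UniformSpace.pseudoMetrizableSpace (X := 𝓢(E, F))
  infer_instance

end complete

section equicontinuous

variable {E : Type*} [NormedAddCommGroup E] [NormedSpace ℝ E]

/-- The uniform boundedness principle for tempered distributions. -/
theorem exists_seminorm_bound_of_pointwise_bounded {ι : Type*} (u : ι → 𝓢(E, ℂ) →L[ℂ] ℂ)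
    (hu : ∀ ψ, ∃ C, ∀ i, ‖u i ψ‖ ≤ C) :
    ∃ (s : Finset (ℕ × ℕ)) (C : ℝ≥0), ∀ i ψ,
      ‖u i ψ‖ ≤ C * s.sup (schwartzSeminormFamily ℂ E ℂ) ψ := by
  have := schwartzMap_baireSpace (E := E) (F := ℂ)
  rcases isEmpty_or_nonempty ι with h | h
  · exact ⟨∅, 0, fun i ↦ h.elim i⟩
  set q : ι → Seminorm ℂ 𝓢(E, ℂ) := fun i ↦ (normSeminorm ℂ ℂ).comp (u i).toLinearMap
  have hbdd : BddAbove (range q) := by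
    rw [Seminorm.bddAbove_range_iff]
    intro ψ
    obtain ⟨C, hC⟩ := hu ψ
    exact ⟨C, by rintro _ ⟨i, rfl⟩; exact hC i⟩
  -- This is where the Baire property enters: a pointwise finite supremum of continuous seminorms is
  -- continuous.
  have hcont : Continuous (⨆ i, q i) := Seminorm.continuous_iSup q
    (fun i ↦ continuous_norm.comp (u i).continuous) hbdd
  rw [← Seminorm.coe_iSup_eq hbdd] at hcont
  obtain ⟨s, C, -, hC⟩ := Seminorm.bound_of_continuous (schwartz_withSeminorms ℂ E ℂ) _ hcont
  refine ⟨s, C, fun i ψ ↦ ?_⟩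
  have h1 : q i ψ ≤ (⨆ i, q i) ψ := by
    rw [Seminorm.iSup_apply hbdd]
    obtain ⟨C, hC⟩ := hu ψ
    exact le_ciSup (f := fun i ↦ q i ψ) ⟨C, by rintro _ ⟨j, rfl⟩; exact hC j⟩ i
  exact h1.trans (Seminorm.le_def.1 hC ψ)

/-- Weakly continuous families of tempered distributions are locally equicontinuous. -/
theorem exists_seminorm_bound_of_continuous {u : ℝ → 𝓢'(E, ℂ)} (hu : Continuous u) (R : ℝ) :
    ∃ (s : Finset (ℕ × ℕ)) (C : ℝ≥0), ∀ t ∈ Icc (-R) R, ∀ ψ,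
      ‖u t ψ‖ ≤ C * s.sup (schwartzSeminormFamily ℂ E ℂ) ψ := by
  have hcont : ∀ ψ : 𝓢(E, ℂ), Continuous fun t ↦ u t ψ := fun ψ ↦
    (PointwiseConvergenceCLM.evalCLM (RingHom.id ℂ) ℂ ψ).continuous.comp hu
  obtain ⟨s, C, h⟩ := exists_seminorm_bound_of_pointwise_bounded
    (fun t : Icc (-R) R ↦ (u t : 𝓢(E, ℂ) →L[ℂ] ℂ)) fun ψ ↦ by
      obtain ⟨C, hC⟩ := isCompact_Icc.exists_bound_of_continuousOn (s := Icc (-R) R)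
        (hcont ψ).continuousOn
      exact ⟨C, fun t ↦ hC t t.2⟩
  exact ⟨s, C, fun t ht ψ ↦ h ⟨t, ht⟩ ψ⟩

end equicontinuous

end Dispersive

end

/-! ### Temperate multipliers depending on a parameter -/
noncomputable section
namespace Dispersive
open Set Filter Topology FourierTransform

/-! ### The exponential and its second order Taylor remainder. -/

section exponential

/-- The integral remainder in `exp (i z) = 1 + i z + z² R(z)`. -/
def expRemainder (z : ℝ) : ℂ := -∫ s in (0 : ℝ)..1, (1 - s : ℂ) * cexp (I * (s * z : ℝ))

theorem exp_eq_expRemainder (z : ℝ) :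
    cexp (I * z) = 1 + I * z + (z : ℂ) ^ 2 * expRemainder z := by
  -- An explicit primitive in `s` of the integrand, so that the identity is the fundamental theorem
  -- of calculus on `[0, 1]`.
  have hd : ∀ s : ℝ, HasDerivAt
      (fun s : ℝ ↦ cexp (I * (s * z : ℝ)) * (-I * z * (1 - s) - 1))
      ((z : ℂ) ^ 2 * ((1 - s : ℂ) * cexp (I * (s * z : ℝ)))) s := by
    intro s
    have h1 : HasDerivAt (fun s : ℝ ↦ (s : ℂ)) 1 s := ofRealCLM.hasDerivAt (x := s)
    have h2 : HasDerivAt (fun s : ℝ ↦ cexp (I * (s * z : ℝ)))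
        (cexp (I * (s * z : ℝ)) * (I * (1 * z))) s := by
      have := ((h1.mul_const (z : ℂ)).const_mul I).cexp
      simpa using this
    have h3 : HasDerivAt (fun s : ℝ ↦ (-I * z * (1 - s) - 1 : ℂ)) (-I * z * (-1)) s := by
      simpa using ((h1.const_sub 1).const_mul (-I * z)).sub_const 1
    refine (h2.fun_mul h3).congr_deriv ?_
    linear_combination (-(z : ℂ) ^ 2 * (1 - s) * cexp (I * (s * z : ℝ))) * I_sq
  have hi := intervalIntegral.integral_eq_sub_of_hasDerivAt (a := 0) (b := 1)
    (fun s _ ↦ hd s) (Continuous.intervalIntegrable (by fun_prop) _ _)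
  rw [intervalIntegral.integral_const_mul] at hi
  rw [expRemainder, mul_neg, hi]
  simp only [one_mul, zero_mul, ofReal_zero, ofReal_one, mul_zero, Complex.exp_zero]
  ring

/-- Up to scaling, the remainder is the Fourier transform of a bounded function supported in `(0,
1]`; its derivatives are Fourier transforms of moments, hence bounded. A direct formula would divide
by `z ^ 2`. -/
theorem hasTemperateGrowth_expRemainder : expRemainder.HasTemperateGrowth := by
  set f : ℝ → ℂ := (Ioc (0 : ℝ) 1).indicator fun s ↦ -(1 - s : ℂ) with hf
  have hfi : ∀ g : ℝ → ℂ, Continuous g → Integrable fun x ↦ g x * f x := by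
    intro g hg
    have : (fun x ↦ g x * f x) = (Ioc (0 : ℝ) 1).indicator fun s ↦ g s * -(1 - s : ℂ) := by
      ext x; by_cases hx : x ∈ Ioc (0 : ℝ) 1 <;> simp [hf, hx]
    rw [this, integrable_indicator_iff measurableSet_Ioc]
    exact ((by fun_prop : Continuous fun s : ℝ ↦ g s * -(1 - s : ℂ)).integrableOn_Icc
      (a := 0) (b := 1)).mono_set Ioc_subset_Icc_self
  have hint : ∀ n : ℕ, Integrable fun x : ℝ ↦ x ^ n • f x := by
    intro n
    simpa using hfi (fun x ↦ (x : ℂ) ^ n) (by fun_prop)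
  have hF : (𝓕 f : ℝ → ℂ).HasTemperateGrowth := by
    refine ⟨Real.contDiff_fourier (N := ⊤) fun n _ ↦ ?_, fun n ↦
      ⟨0, ∫ x : ℝ, ‖(-2 * Real.pi * I * x : ℂ) ^ n • f x‖, fun x ↦ ?_⟩⟩
    · convert! (hint n).norm with x
      simp
    · rw [norm_iteratedFDeriv_eq_norm_iteratedDeriv,
        Real.iteratedDeriv_fourier (N := ⊤) (fun n _ ↦ hint n) le_top, pow_zero, mul_one]
      exact VectorFourier.norm_fourierIntegral_le_integral_norm _ _ _ _ _
  have heq : expRemainder = fun z ↦ 𝓕 f (-(2 * Real.pi)⁻¹ * z) := by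
    ext z
    rw [Real.fourier_real_eq_integral_exp_smul, expRemainder, ← intervalIntegral.integral_neg,
      intervalIntegral.integral_of_le zero_le_one, ← integral_indicator measurableSet_Ioc]
    congr with s
    by_cases hs : s ∈ Ioc (0 : ℝ) 1
    · have : (-2 * Real.pi * s * (-(2 * Real.pi)⁻¹ * z) : ℝ) = s * z := by
        field_simp
      simp only [hf, indicator_of_mem hs, smul_eq_mul, this]
      rw [mul_comm I]
      ring
    · simp [hf, hs]
  rw [heq]
  exact hF.comp (by fun_prop)

theorem hasTemperateGrowth_exp_I_mul : (fun z : ℝ ↦ cexp (I * z)).HasTemperateGrowth := by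
  have := hasTemperateGrowth_expRemainder
  simp_rw [exp_eq_expRemainder]
  have h : (fun z : ℝ ↦ (z : ℂ)).HasTemperateGrowth := Function.Complex.hasTemperateGrowth_ofReal
  fun_prop

end exponential

/-! ### Uniform bounds for multiplication by a parameter-dependent symbol. -/

section uniform

variable {E : Type*} [NormedAddCommGroup E] [NormedSpace ℝ E]

theorem hasTemperateGrowth_slice {Θ : ℝ × E → ℂ} (hΘ : Θ.HasTemperateGrowth) (h : ℝ) :
    (fun ξ ↦ Θ (h, ξ)).HasTemperateGrowth := by
  have h1 : (fun ξ : E ↦ ((h, 0) : ℝ × E) + ContinuousLinearMap.inr ℝ ℝ E ξ).HasTemperateGrowth :=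
    .add (.const _) (ContinuousLinearMap.hasTemperateGrowth _)
  have := hΘ.comp h1
  simpa [Function.comp_def] using this

/-- The slice is the composition with an affine embedding whose linear part has norm at most 1, and
`1 + ‖(h, ξ)‖ ≤ (1 + R)(1 + ‖ξ‖)` for bounded `h`. -/
theorem norm_iteratedFDeriv_slice_le {Θ : ℝ × E → ℂ} (hΘ : Θ.HasTemperateGrowth) (n : ℕ) (R : ℝ) :
    ∃ (l : ℕ) (C : ℝ), 0 ≤ C ∧ ∀ N ≤ n, ∀ h : ℝ, |h| ≤ R → ∀ ξ : E,
      ‖iteratedFDeriv ℝ N (fun ξ ↦ Θ (h, ξ)) ξ‖ ≤ C * (1 + ‖ξ‖) ^ l := by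
  obtain ⟨l, C, hC, hb⟩ := hΘ.norm_iteratedFDeriv_le_uniform n
  rcases lt_or_ge R 0 with hR | hR
  · exact ⟨0, 0, le_rfl, fun N _ h hh ↦ absurd (hh.trans_lt hR) (not_lt.2 (abs_nonneg h))⟩
  refine ⟨l, C * (1 + R) ^ l, by positivity, fun N hN h hh ξ ↦ ?_⟩
  have h1 : (fun ξ : E ↦ Θ (h, ξ))
      = (fun z ↦ Θ ((h, 0) + z)) ∘ ContinuousLinearMap.inr ℝ ℝ E := by
    ext ξ; simp
  have hs : ContDiff ℝ ∞ fun z : ℝ × E ↦ Θ ((h, 0) + z) := hΘ.1.comp (by fun_prop)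
  rw [h1, ContinuousLinearMap.iteratedFDeriv_comp_right _ hs _ (by exact_mod_cast le_top),
    iteratedFDeriv_comp_add_left]
  refine (ContinuousMultilinearMap.norm_compContinuousLinearMap_le _ _).trans ?_
  have h2 : ∏ _i : Fin N, ‖ContinuousLinearMap.inr ℝ ℝ E‖ ≤ 1 :=
    Finset.prod_le_one (fun _ _ ↦ norm_nonneg _)
      fun _ _ ↦ ContinuousLinearMap.opNorm_le_bound _ zero_le_one fun x ↦ by simp
  have h3 : ‖((h, 0) : ℝ × E) + ContinuousLinearMap.inr ℝ ℝ E ξ‖ ≤ R + ‖ξ‖ := by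
    simp only [ContinuousLinearMap.inr_apply, Prod.mk_add_mk, add_zero, zero_add, Prod.norm_mk,
      Real.norm_eq_abs]
    exact max_le (hh.trans (by linarith [norm_nonneg ξ])) (by linarith)
  calc _ ≤ (C * (1 + ‖((h, 0) : ℝ × E) + ContinuousLinearMap.inr ℝ ℝ E ξ‖) ^ l) * 1 := by
        exact mul_le_mul (hb N hN _) h2 (by positivity) (by positivity)
    _ ≤ C * ((1 + R) * (1 + ‖ξ‖)) ^ l := by
        rw [mul_one]
        gcongr
        nlinarith [norm_nonneg ξ, mul_nonneg hR (norm_nonneg ξ)]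
    _ = _ := by rw [mul_pow]; ring

/-- Multiplication by a temperate function depending on a parameter is bounded, uniformly for
parameters in a bounded set. -/
theorem exists_seminorm_smulLeftCLM_le {Θ : ℝ × E → ℂ} (hΘ : Θ.HasTemperateGrowth) (k m : ℕ)
    (R : ℝ) (χ : 𝓢(E, ℂ)) : ∃ C, ∀ h : ℝ, |h| ≤ R →
      SchwartzMap.seminorm ℂ k m (SchwartzMap.smulLeftCLM ℂ (fun ξ ↦ Θ (h, ξ)) χ) ≤ C := by
  obtain ⟨l, C, hC, hb⟩ := norm_iteratedFDeriv_slice_le hΘ m R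
  set M := 2 ^ (l + k) *
    (Finset.Iic (l + k, m)).sup (fun m => SchwartzMap.seminorm ℂ m.1 m.2) χ with hM
  have hM0 : 0 ≤ M := by positivity
  refine ⟨∑ i ∈ Finset.range (m + 1), (m.choose i : ℝ) * C * M, fun h hh ↦ ?_⟩
  have ht := hasTemperateGrowth_slice hΘ h
  refine SchwartzMap.seminorm_le_bound ℂ _ _ _ (by positivity) fun ξ ↦ ?_
  rw [SchwartzMap.smulLeftCLM_apply ht]
  have h1 := norm_iteratedFDeriv_mul_le ht.1 (χ.smooth ⊤) ξ (n := m) (by exact_mod_cast le_top)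
  simp only [smul_eq_mul]
  refine (mul_le_mul_of_nonneg_left h1 (by positivity)).trans ?_
  rw [Finset.mul_sum]
  refine Finset.sum_le_sum fun i hi ↦ ?_
  have h2 := hb i (by simpa [Nat.lt_succ_iff] using hi) h hh ξ
  have h3 := SchwartzMap.one_add_le_sup_seminorm_apply (𝕜 := ℂ) (m := (l + k, m)) (k := l + k)
    (n := m - i) le_rfl (by simp) χ ξ
  have h4 : ‖ξ‖ ^ k ≤ (1 + ‖ξ‖) ^ k := by gcongr; linarith
  calc _ ≤ (1 + ‖ξ‖) ^ k * ((m.choose i : ℝ) * (C * (1 + ‖ξ‖) ^ l)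
          * ‖iteratedFDeriv ℝ (m - i) χ ξ‖) := by gcongr
    _ = (m.choose i : ℝ) * C * ((1 + ‖ξ‖) ^ (l + k) * ‖iteratedFDeriv ℝ (m - i) χ ξ‖) := by
        rw [pow_add]; ring
    _ ≤ _ := by gcongr

end uniform

section symbolGrowth

variable {E : Type*} [NormedAddCommGroup E] [NormedSpace ℝ E] {b : E → ℝ}

theorem hasTemperateGrowth_propagator_symbol (hb : b.HasTemperateGrowth) (r : ℝ) :
    (fun ξ ↦ cexp (I * (r * b ξ : ℝ))).HasTemperateGrowth :=
  hasTemperateGrowth_exp_I_mul.comp (f := fun ξ ↦ r * b ξ) (by fun_prop)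

theorem hasTemperateGrowth_ofReal_symbol (hb : b.HasTemperateGrowth) :
    (fun ξ ↦ (b ξ : ℂ)).HasTemperateGrowth :=
  Function.Complex.hasTemperateGrowth_ofReal.comp hb

end symbolGrowth

/-! ### The propagator on Schwartz functions and its Taylor expansion in time. -/

section multiplier

variable {E : Type*} [NormedAddCommGroup E] [InnerProductSpace ℝ E] [FiniteDimensional ℝ E]
  [MeasurableSpace E] [BorelSpace E]

/-- A continuous seminorm, pulled back by the inverse Fourier transform, is dominated by finitely
many Schwartz seminorms, each of which is uniformly bounded on the multiplied functions. -/
theorem exists_seminorm_fourierMultiplier_le {Θ : ℝ × E → ℂ} (hΘ : Θ.HasTemperateGrowth)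
    {q : Seminorm ℂ 𝓢(E, ℂ)} (hq : Continuous q) (R : ℝ) (ψ : 𝓢(E, ℂ)) :
    ∃ C, ∀ h : ℝ, |h| ≤ R →
      q (SchwartzMap.fourierMultiplierCLM ℂ (fun ξ ↦ Θ (h, ξ)) ψ) ≤ C := by
  have hq' : Continuous (q.comp (fourierInvCLM ℂ 𝓢(E, ℂ)).toLinearMap) :=
    hq.comp (fourierInvCLM ℂ 𝓢(E, ℂ)).continuous
  obtain ⟨s, c, -, hc⟩ := Seminorm.bound_of_continuous (schwartz_withSeminorms ℂ E ℂ) _ hq'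
  choose C hC using fun i : ℕ × ℕ ↦ exists_seminorm_smulLeftCLM_le hΘ i.1 i.2 R (𝓕 ψ)
  refine ⟨c * ∑ i ∈ s, C i, fun h hh ↦ ?_⟩
  refine (Seminorm.le_def.1 hc (SchwartzMap.smulLeftCLM ℂ (fun ξ ↦ Θ (h, ξ)) (𝓕 ψ))).trans ?_
  have h1 := Seminorm.le_def.1 (Seminorm.finset_sup_le_sum (schwartzSeminormFamily ℂ E ℂ) s)
    (SchwartzMap.smulLeftCLM ℂ (fun ξ ↦ Θ (h, ξ)) (𝓕 ψ))
  rw [sum_apply] at h1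
  exact mul_le_mul_of_nonneg_left
    (h1.trans (Finset.sum_le_sum fun i _ ↦ hC i h hh)) c.coe_nonneg

/-- The unitary group with symbol `exp (i r b)`. -/
def propagator (b : E → ℝ) (r : ℝ) : 𝓢(E, ℂ) →L[ℂ] 𝓢(E, ℂ) :=
  SchwartzMap.fourierMultiplierCLM ℂ fun ξ ↦ cexp (I * (r * b ξ : ℝ))

/-- The multiplier with real symbol `b`. -/
def realMultiplier (b : E → ℝ) : 𝓢(E, ℂ) →L[ℂ] 𝓢(E, ℂ) :=
  SchwartzMap.fourierMultiplierCLM ℂ fun ξ ↦ (b ξ : ℂ)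

variable {b : E → ℝ}

@[simp]
theorem propagator_zero (b : E → ℝ) (ψ : 𝓢(E, ℂ)) : propagator b 0 ψ = ψ := by
  simp [propagator]

theorem propagator_propagator (hb : b.HasTemperateGrowth) (r s : ℝ) (ψ : 𝓢(E, ℂ)) :
    propagator b r (propagator b s ψ) = propagator b (r + s) ψ := by
  rw [propagator, propagator, SchwartzMap.fourierMultiplierCLM_fourierMultiplierCLM_apply
    (hasTemperateGrowth_propagator_symbol hb r) (hasTemperateGrowth_propagator_symbol hb s),
    propagator]
  congr 2
  ext ξ
  rw [Pi.mul_apply, ← Complex.exp_add]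
  push_cast
  ring_nf

/-- On the Fourier side this is `exp (i z) = 1 + i z + z² R(z)` at `z = h b(ξ)`. Keeping the
remainder as a multiplier gives an error quadratic in `h` in every continuous seminorm. -/
theorem propagator_expansion (hb : b.HasTemperateGrowth) (h : ℝ) (ψ : 𝓢(E, ℂ)) :
    propagator b h ψ - ψ - (I * h) • realMultiplier b ψ = ((h : ℂ) ^ 2) •
      SchwartzMap.fourierMultiplierCLM ℂ
        (fun ξ ↦ (b ξ : ℂ) ^ 2 * expRemainder (h * b ξ)) ψ := by
  have h0 := hasTemperateGrowth_propagator_symbol hb h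
  have h1 := hasTemperateGrowth_ofReal_symbol hb
  have h2 : (fun ξ ↦ expRemainder (h * b ξ)).HasTemperateGrowth :=
    hasTemperateGrowth_expRemainder.comp (f := fun ξ ↦ h * b ξ) (by fun_prop)
  have h3 : (fun ξ ↦ (b ξ : ℂ) ^ 2 * expRemainder (h * b ξ)).HasTemperateGrowth := by fun_prop
  have key : SchwartzMap.smulLeftCLM ℂ (fun ξ ↦ cexp (I * (h * b ξ : ℝ))) (𝓕 ψ) - 𝓕 ψ
      - (I * h) • SchwartzMap.smulLeftCLM ℂ (fun ξ ↦ (b ξ : ℂ)) (𝓕 ψ) = ((h : ℂ) ^ 2) •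
        SchwartzMap.smulLeftCLM ℂ (fun ξ ↦ (b ξ : ℂ) ^ 2 * expRemainder (h * b ξ)) (𝓕 ψ) := by
    ext ξ
    simp only [sub_apply, smul_apply, SchwartzMap.smulLeftCLM_apply_apply h0,
      SchwartzMap.smulLeftCLM_apply_apply h1, SchwartzMap.smulLeftCLM_apply_apply h3, smul_eq_mul,
      exp_eq_expRemainder (h * b ξ)]
    push_cast
    ring
  have := congrArg (fourierInvCLM ℂ 𝓢(E, ℂ)) key
  simp only [map_sub, map_smul, fourierInvCLM_apply] at this
  simpa only [propagator, realMultiplier, SchwartzMap.fourierMultiplierCLM_apply,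
    FourierTransform.fourierInv_fourier_eq] using this

/-- The second order Taylor expansion of the propagator, in every continuous seminorm. -/
theorem exists_seminorm_propagator_expansion_le (hb : b.HasTemperateGrowth)
    {q : Seminorm ℂ 𝓢(E, ℂ)} (hq : Continuous q) (r : ℝ) (ψ : 𝓢(E, ℂ)) :
    ∃ C, 0 ≤ C ∧ ∀ h : ℝ, |h| ≤ 1 →
      q (propagator b (r + h) ψ - propagator b r ψ -
        (I * h) • realMultiplier b (propagator b r ψ)) ≤ C * h ^ 2 := by
  -- Temperate growth in `h` and `ξ` jointly is what makes the remainder bound uniform for `|h| ≤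
  -- 1`.
  have hΘ : (fun z : ℝ × E ↦ (b z.2 : ℂ) ^ 2 * expRemainder (z.1 * b z.2)).HasTemperateGrowth := by
    have hs : (fun z : ℝ × E ↦ z.2).HasTemperateGrowth :=
      (ContinuousLinearMap.snd ℝ ℝ E).hasTemperateGrowth
    have hf : (fun z : ℝ × E ↦ z.1).HasTemperateGrowth :=
      (ContinuousLinearMap.fst ℝ ℝ E).hasTemperateGrowth
    have h1 : (fun z : ℝ × E ↦ b z.2).HasTemperateGrowth := hb.comp hs
    have h2 : (fun z : ℝ × E ↦ expRemainder (z.1 * b z.2)).HasTemperateGrowth :=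
      hasTemperateGrowth_expRemainder.comp (f := fun z : ℝ × E ↦ z.1 * b z.2) (hf.mul h1)
    have h3 := hasTemperateGrowth_ofReal_symbol h1
    fun_prop
  obtain ⟨C, hC⟩ := exists_seminorm_fourierMultiplier_le hΘ hq 1 (propagator b r ψ)
  refine ⟨C, (apply_nonneg q _).trans (hC 0 (by simp)), fun h hh ↦ ?_⟩
  rw [add_comm r h, ← propagator_propagator hb, propagator_expansion hb, map_smul_eq_mul]
  have := hC h hh
  simp only [norm_pow, norm_real, Real.norm_eq_abs, sq_abs]
  nlinarith [sq_nonneg h]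

theorem exists_seminorm_propagator_sub_le (hb : b.HasTemperateGrowth)
    {q : Seminorm ℂ 𝓢(E, ℂ)} (hq : Continuous q) (r : ℝ) (ψ : 𝓢(E, ℂ)) :
    ∃ C, 0 ≤ C ∧ ∀ h : ℝ, |h| ≤ 1 →
      q (propagator b (r + h) ψ - propagator b r ψ) ≤ C * |h| := by
  obtain ⟨C, hC0, hC⟩ := exists_seminorm_propagator_expansion_le hb hq r ψ
  refine ⟨C + q (realMultiplier b (propagator b r ψ)),
    add_nonneg hC0 (apply_nonneg q _), fun h hh ↦ ?_⟩
  have h1 := map_add_le_add q (propagator b (r + h) ψ - propagator b r ψ -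
        (I * h) • realMultiplier b (propagator b r ψ))
        ((I * h) • realMultiplier b (propagator b r ψ))
  rw [sub_add_cancel, map_smul_eq_mul] at h1
  have h2 := hC h hh
  have h3 : h ^ 2 ≤ |h| := by rw [← sq_abs]; nlinarith [abs_nonneg h]
  simp only [norm_mul, norm_I, one_mul, norm_real, Real.norm_eq_abs] at h1
  nlinarith

theorem continuous_propagator (hb : b.HasTemperateGrowth) (ψ : 𝓢(E, ℂ)) :
    Continuous fun r ↦ propagator b r ψ := by
  rw [continuous_iff_continuousAt]
  intro r
  rw [ContinuousAt, (schwartz_withSeminorms ℂ E ℂ).tendsto_nhds]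
  intro i ε hε
  obtain ⟨C, hC0, hC⟩ := exists_seminorm_propagator_sub_le hb
    ((schwartz_withSeminorms ℂ E ℂ).continuous_seminorm i) r ψ
  have h1 : ∀ᶠ s in 𝓝 r, |s - r| < min 1 (ε / (C + 1)) :=
    Metric.ball_mem_nhds r (by positivity)
  filter_upwards [h1] with s hs
  have h2 := hC (s - r) (hs.le.trans (min_le_left _ _))
  rw [add_sub_cancel] at h2
  refine h2.trans_lt ?_
  have h3 : |s - r| * (C + 1) < ε := (lt_div_iff₀ (by positivity)).1 (hs.trans_le (min_le_right _ _))
  nlinarith [abs_nonneg (s - r)]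

theorem continuous_propagator_uncurry (hb : b.HasTemperateGrowth) (ψ : 𝓢(E, ℂ)) :
    Continuous fun z : ℝ × E ↦ propagator b z.1 ψ z.2 := by
  have h1 : Continuous fun r ↦ SchwartzMap.toBoundedContinuousFunctionCLM ℂ E ℂ
      (propagator b r ψ) :=
    (SchwartzMap.toBoundedContinuousFunctionCLM ℂ E ℂ).continuous.comp (continuous_propagator hb ψ)
  have h2 : Continuous fun z : ℝ × E ↦ (SchwartzMap.toBoundedContinuousFunctionCLM ℂ E ℂ
      (propagator b z.1 ψ)) z.2 :=
    continuous_eval.comp ((h1.comp continuous_fst).prodMk continuous_snd)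
  exact h2

/-- The `L^p` norm, as a seminorm on Schwartz functions. -/
def lpSeminorm (p : ℝ≥0∞) [Fact (1 ≤ p)] : Seminorm ℂ 𝓢(E, ℂ) :=
  (normSeminorm ℂ (Lp ℂ p (volume : Measure E))).comp
    (SchwartzMap.toLpCLM ℂ ℂ p (volume : Measure E)).toLinearMap

theorem continuous_lpSeminorm (p : ℝ≥0∞) [Fact (1 ≤ p)] :
    Continuous (lpSeminorm (E := E) p) :=
  continuous_norm.comp (SchwartzMap.toLpCLM ℂ ℂ p (volume : Measure E)).continuous

theorem lpSeminorm_apply (p : ℝ≥0∞) [Fact (1 ≤ p)] (ψ : 𝓢(E, ℂ)) :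
    lpSeminorm p ψ = ‖ψ.toLp p (volume : Measure E)‖ := rfl

theorem lpSeminorm_eq_toReal (p : ℝ≥0∞) [Fact (1 ≤ p)] (ψ : 𝓢(E, ℂ)) :
    lpSeminorm p ψ = (eLpNorm ψ p (volume : Measure E)).toReal := by
  rw [lpSeminorm_apply, SchwartzMap.norm_toLp]

end multiplier

/-! ### The operator `a(D)` as a real Fourier multiplier acting on test functions. -/

section symbol

variable {n : ℕ}

/-- The symbol of `a(D)` in the normalisation of the Fourier transform with `2π`, reflected. -/
def dispersionSymbol (a : Fin n → ℝ) (k : Fin n → ℕ) (ξ : Space n) : ℝ :=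
  ∑ j, a j * (-(2 * Real.pi * ξ j)) ^ k j

theorem hasTemperateGrowth_coord (j : Fin n) :
    (fun ξ : Space n ↦ ξ j).HasTemperateGrowth :=
  (EuclideanSpace.proj (𝕜 := ℝ) j : Space n →L[ℝ] ℝ).hasTemperateGrowth

theorem hasTemperateGrowth_dispersionSymbol (a : Fin n → ℝ) (k : Fin n → ℕ) :
    (dispersionSymbol a k).HasTemperateGrowth := by
  unfold dispersionSymbol
  refine Function.HasTemperateGrowth.sum fun j _ ↦ ?_
  have := hasTemperateGrowth_coord j
  fun_prop

/-- Transposition to the test function replaces `-i ∂_j` by `i ∂_j`, whose symbol is `-2π ξ_j`; this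
is the origin of the minus sign in `dispersionSymbol`. -/
theorem partialD_apply (j : Fin n) (T : 𝓢'(Space n, ℂ)) (ψ : 𝓢(Space n, ℂ)) :
    partialD j T ψ =
      T (SchwartzMap.fourierMultiplierCLM ℂ (fun ξ ↦ ((-(2 * Real.pi * ξ j) : ℝ) : ℂ)) ψ) := by
  have hj := hasTemperateGrowth_coord j
  have h1 : SchwartzMap.fourierMultiplierCLM ℂ
      (fun ξ : Space n ↦ ((-(2 * Real.pi * ξ j) : ℝ) : ℂ)) ψ
      = I • ∂_{(EuclideanSpace.single j (1 : ℝ) : Space n)} ψ := by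
    have h2 : (fun ξ : Space n ↦ ((-(2 * Real.pi * ξ j) : ℝ) : ℂ))
        = (-(2 * Real.pi) : ℂ) • fun ξ : Space n ↦ ((ξ j : ℝ) : ℂ) := by
      ext ξ; simp
    rw [h2, SchwartzMap.fourierMultiplierCLM_smul (hasTemperateGrowth_ofReal_symbol hj),
      SchwartzMap.lineDeriv_eq_fourierMultiplierCLM, smul_smul]
    have h3 : (fun ξ : Space n ↦ inner ℝ ξ (EuclideanSpace.single j (1 : ℝ))) = fun ξ ↦ ξ j := by
      ext ξ; simp [EuclideanSpace.inner_single_right]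
    rw [h3, ← SchwartzMap.fourierMultiplierCLM_ofReal ℂ hj, smul_apply]
    congr 1
    linear_combination (-(2 * Real.pi) : ℂ) * I_sq
  rw [h1, partialD, map_smul]
  change (-I) • (∂_{(EuclideanSpace.single j (1 : ℝ) : Space n)} T) ψ = _
  rw [TemperedDistribution.lineDerivOp_apply_apply, map_neg, smul_neg, neg_smul, neg_neg]

theorem iterate_partialD_apply (j : Fin n) (m : ℕ) (T : 𝓢'(Space n, ℂ)) (ψ : 𝓢(Space n, ℂ)) :
    (partialD j)^[m] T ψ = T (SchwartzMap.fourierMultiplierCLM ℂ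
      (fun ξ ↦ (((-(2 * Real.pi * ξ j)) ^ m : ℝ) : ℂ)) ψ) := by
  have hj := hasTemperateGrowth_coord j
  induction m generalizing T with
  | zero => simp
  | succ m ih =>
    rw [Function.iterate_succ_apply, ih, partialD_apply,
      SchwartzMap.fourierMultiplierCLM_fourierMultiplierCLM_apply
        (hasTemperateGrowth_ofReal_symbol (by fun_prop))
        (hasTemperateGrowth_ofReal_symbol (by fun_prop))]
    congr 3
    ext ξ
    simp [pow_succ']

/-- The equation tested against a fixed `ψ` becomes a scalar weak equation in time in which `a(D)`
acts on `ψ`. -/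
theorem symbolD_apply (a : Fin n → ℝ) (k : Fin n → ℕ) (T : 𝓢'(Space n, ℂ)) (ψ : 𝓢(Space n, ℂ)) :
    symbolD a k T ψ = T (realMultiplier (dispersionSymbol a k) ψ) := by
  have h1 : (fun ξ : Space n ↦ (dispersionSymbol a k ξ : ℂ)) = fun ξ ↦ ∑ j,
      ((a j : ℂ) • fun ξ : Space n ↦ (((-(2 * Real.pi * ξ j)) ^ k j : ℝ) : ℂ)) ξ := by
    ext ξ
    simp [dispersionSymbol]
  have h2 : ∀ j, (fun ξ : Space n ↦ (((-(2 * Real.pi * ξ j)) ^ k j : ℝ) : ℂ)).HasTemperateGrowth :=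
    fun j ↦ by
      have := hasTemperateGrowth_coord j
      exact hasTemperateGrowth_ofReal_symbol (by fun_prop)
  have h3 : ∀ j, ((a j : ℂ) • fun ξ : Space n ↦
      (((-(2 * Real.pi * ξ j)) ^ k j : ℝ) : ℂ)).HasTemperateGrowth := fun j ↦ by
    have := h2 j
    exact (Function.HasTemperateGrowth.const (a j : ℂ)).mul this
  rw [realMultiplier, h1, SchwartzMap.fourierMultiplierCLM_sum _ fun j _ ↦ h3 j, sum_apply, map_sum,
    symbolD]
  change (∑ j, (a j : ℂ) • (partialD j)^[k j] T : 𝓢(Space n, ℂ) →Lₚₜ[ℂ] ℂ) ψ = _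
  rw [sum_apply]
  refine Finset.sum_congr rfl fun j _ ↦ ?_
  rw [SchwartzMap.fourierMultiplierCLM_smul (h2 j), smul_apply, smul_apply, map_smul,
    iterate_partialD_apply]

end symbol

end Dispersive
end

/-! ### The dispersive estimate -/
noncomputable section
namespace Dispersive
open Set Filter Topology FourierTransform

/-! ### Plancherel for the integral Fourier transform on `L¹ ∩ L²`. -/

section plancherel

variable {E : Type*} [NormedAddCommGroup E] [InnerProductSpace ℝ E] [FiniteDimensional ℝ E]
  [MeasurableSpace E] [BorelSpace E]

theorem continuous_fourier_of_integrable {f : E → ℂ} (hf : Integrable f) : Continuous (𝓕 f) :=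
  VectorFourier.fourierIntegral_continuous Real.continuous_fourierChar
    (by simpa using continuous_inner) hf

theorem norm_fourier_le_integral_norm (f : E → ℂ) (ξ : E) : ‖𝓕 f ξ‖ ≤ ∫ x, ‖f x‖ :=
  VectorFourier.norm_fourierIntegral_le_integral_norm _ _ _ _ _

theorem integral_fourier_mul {f g : E → ℂ} (hf : Integrable f) (hg : Integrable g) :
    ∫ x, 𝓕 f x * g x = ∫ x, f x * 𝓕 g x := by
  simpa using! VectorFourier.integral_bilin_fourierIntegral_eq_flip (ContinuousLinearMap.mul ℂ ℂ)
    (L := innerₗ E) Real.continuous_fourierChar (by simpa using continuous_inner) hf hg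

theorem integral_fourierInv_mul {f g : E → ℂ} (hf : Integrable f) (hg : Integrable g) :
    ∫ x, 𝓕⁻ f x * g x = ∫ x, f x * 𝓕⁻ g x := by
  rw [Real.fourierInv_eq_fourier_comp_neg f, integral_fourier_mul hf.comp_neg hg,
    ← integral_neg_eq_self]
  simp [Real.fourierInv_eq_fourier_neg]

/-- The Fourier integral and the `L²` extension obey the same exchange formula `∫ 𝓕 f g = ∫ f 𝓕 g`
against test functions, and therefore agree almost everywhere. -/
theorem fourier_ae_eq_toLp {f : E → ℂ} (h1 : Integrable f) (h2 : MemLp f 2) :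
    𝓕 f =ᵐ[volume] (𝓕 (h2.toLp f) : Lp ℂ 2 (volume : Measure E)) := by
  refine ae_eq_of_integral_contDiff_smul_eq
    (continuous_fourier_of_integrable h1).locallyIntegrable
    ((Lp.memLp _).locallyIntegrable (by norm_num)) fun g hg hgc ↦ ?_
  have hc : HasCompactSupport fun x ↦ (g x : ℂ) := hgc.comp_left (g := ofReal) rfl
  set ψ : 𝓢(E, ℂ) := hc.toSchwartzMap (ofRealCLM.contDiff.comp hg) with hψ
  have hψ' : ∀ x, ψ x = g x := fun x ↦ rfl
  have key := congrArg (fun T : 𝓢'(E, ℂ) ↦ T ψ)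
    (Lp.fourier_toTemperedDistribution_eq (h2.toLp f))
  simp only [TemperedDistribution.fourier_apply, Lp.toTemperedDistribution_apply,
    smul_eq_mul] at key
  simp only [real_smul, ← hψ']
  rw [← key]
  have h3 : ∫ x, 𝓕 ψ x * (h2.toLp f : E → ℂ) x = ∫ x, 𝓕 (ψ : E → ℂ) x * f x := by
    refine integral_congr_ae ?_
    filter_upwards [h2.coeFn_toLp] with x hx
    rw [hx, SchwartzMap.fourier_coe]
  rw [h3, integral_fourier_mul ψ.integrable h1]

theorem memLp_fourier {f : E → ℂ} (h1 : Integrable f) (h2 : MemLp f 2) : MemLp (𝓕 f) 2 :=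
  (memLp_congr_ae (fourier_ae_eq_toLp h1 h2)).2 (Lp.memLp _)

theorem eLpNorm_fourier {f : E → ℂ} (h1 : Integrable f) (h2 : MemLp f 2) :
    eLpNorm (𝓕 f) 2 = eLpNorm f 2 := by
  rw [eLpNorm_congr_ae (fourier_ae_eq_toLp h1 h2), ← Lp.enorm_def, ← eLpNorm_congr_ae h2.coeFn_toLp,
    ← Lp.enorm_def, ← ofReal_norm, Lp.norm_fourier_eq, ofReal_norm]

theorem integral_norm_sq_eq_of_eLpNorm {X Y : Type*} {_ : MeasurableSpace X} {_ : MeasurableSpace Y}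
    {μ : Measure X} {ν : Measure Y} {f : X → ℂ} {g : Y → ℂ} (hf : MemLp f 2 μ) (hg : MemLp g 2 ν)
    (h : eLpNorm f 2 μ = eLpNorm g 2 ν) : ∫ x, ‖f x‖ ^ 2 ∂μ = ∫ x, ‖g x‖ ^ 2 ∂ν := by
  have h1 := hf.eLpNorm_eq_integral_rpow_norm two_ne_zero (by simp)
  have h2 := hg.eLpNorm_eq_integral_rpow_norm two_ne_zero (by simp)
  rw [h1, h2, ENNReal.ofReal_eq_ofReal_iff (by positivity) (by positivity)] at h
  simp only [ENNReal.toReal_ofNat, Real.rpow_ofNat] at h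
  exact (Real.rpow_left_inj (by positivity) (by positivity) (by norm_num)).1 h

theorem integral_norm_sq_fourier {f : E → ℂ} (h1 : Integrable f) (h2 : MemLp f 2) :
    ∫ ξ, ‖𝓕 f ξ‖ ^ 2 = ∫ x, ‖f x‖ ^ 2 :=
  integral_norm_sq_eq_of_eLpNorm (memLp_fourier h1 h2) h2 (eLpNorm_fourier h1 h2)

theorem memLp_fourierInv {f : E → ℂ} (h1 : Integrable f) (h2 : MemLp f 2) : MemLp (𝓕⁻ f) 2 := by
  have : 𝓕⁻ f = 𝓕 f ∘ Neg.neg := by ext; simp [Real.fourierInv_eq_fourier_neg]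
  rw [this]
  exact (memLp_fourier h1 h2).comp_measurePreserving (Measure.measurePreserving_neg _)

theorem integral_norm_sq_fourierInv {f : E → ℂ} (h1 : Integrable f) (h2 : MemLp f 2) :
    ∫ ξ, ‖𝓕⁻ f ξ‖ ^ 2 = ∫ x, ‖f x‖ ^ 2 := by
  rw [← integral_norm_sq_fourier h1 h2, ← integral_neg_eq_self]
  simp [Real.fourierInv_eq_fourier_neg]

end plancherel

/-! ### The uniform bound for the truncated kernel. -/

section kernel

variable {n : ℕ}

/-- The cube of side `2R`. -/
def frequencyBox (n : ℕ) (R : ℝ) : Set (Space n) := {ξ | ∀ j, ξ j ∈ Ioc (-R) R}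

theorem measurableSet_frequencyBox (R : ℝ) : MeasurableSet (frequencyBox n R) := by
  have : frequencyBox n R = ⋂ j, (fun ξ : Space n ↦ ξ j) ⁻¹' Ioc (-R) R := by
    ext ξ; simp [frequencyBox]
  rw [this]
  exact MeasurableSet.iInter fun j ↦ measurableSet_Ioc.preimage (by fun_prop)

theorem volume_frequencyBox_lt_top (R : ℝ) : volume (frequencyBox n R) < ⊤ := by
  have h : frequencyBox n R ⊆ WithLp.ofLp ⁻¹' (Set.pi univ fun _ ↦ Icc (-R) R) := by
    intro ξ hξ j _
    exact Ioc_subset_Icc_self (hξ j)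
  refine (measure_mono h).trans_lt ?_
  rw [(PiLp.volume_preserving_ofLp (Fin n)).measure_preimage
    (MeasurableSet.univ_pi fun _ ↦ measurableSet_Icc).nullMeasurableSet]
  exact (isCompact_univ_pi fun _ ↦ isCompact_Icc).measure_lt_top

/-- The decay constant for the propagator with symbol `∑ a_j ξ_j ^ k_j`. -/
def kernelConst (a : Fin n → ℝ) (k : Fin n → ℕ) : ℝ :=
  ∏ j, (18 * (|a j| * (2 * Real.pi) ^ k j) ^ (-(1 / k j : ℝ)))

theorem kernelConst_pos {a : Fin n → ℝ} (ha : ∀ j, a j ≠ 0) (k : Fin n → ℕ) :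
    0 < kernelConst a k :=
  Finset.prod_pos fun j _ ↦ by
    have := abs_pos.2 (ha j)
    positivity

/-- A sum of one-variable phases on a cube gives a product of one-dimensional integrals. Van der
Corput bounds the factors by `18 |c_j| ^ (-1/k_j)`, and the powers of `|r|` multiply to `|r| ^
(-σ)`. The cube replaces an integral which need not converge absolutely. -/
theorem norm_integral_frequencyBox_le {a : Fin n → ℝ} {k : Fin n → ℕ} (ha : ∀ j, a j ≠ 0)
    (hk : ∀ j, 2 ≤ k j) {r : ℝ} (hr : r ≠ 0) {R : ℝ} (hR : 0 ≤ R) (z : Space n) :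
    ‖∫ ξ in frequencyBox n R, cexp (I * (r * dispersionSymbol a k ξ : ℝ)) *
      cexp (I * (2 * Real.pi * inner ℝ ξ z : ℝ))‖
      ≤ kernelConst a k * |r| ^ (-∑ j, 1 / (k j : ℝ)) := by
  set c : Fin n → ℝ := fun j ↦ r * a j * (-(2 * Real.pi)) ^ k j with hc
  set φ : Fin n → ℝ → ℂ := fun j ↦ (Ioc (-R) R).indicator fun s ↦
    cexp (I * ((c j * s ^ k j + 2 * Real.pi * z j * s : ℝ) : ℂ)) with hφ
  have h1 : ∀ ξ : Space n, (frequencyBox n R).indicator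
      (fun ξ ↦ cexp (I * (r * dispersionSymbol a k ξ : ℝ)) *
        cexp (I * (2 * Real.pi * inner ℝ ξ z : ℝ))) ξ = ∏ j, φ j (ξ.ofLp j) := by
    intro ξ
    by_cases hξ : ξ ∈ frequencyBox n R
    · have : ∀ j, φ j (ξ.ofLp j) =
          cexp (I * ((c j * ξ j ^ k j + 2 * Real.pi * z j * ξ j : ℝ) : ℂ)) :=
        fun j ↦ indicator_of_mem (hξ j) _
      simp only [this, indicator_of_mem hξ]
      have hs : r * dispersionSymbol a k ξ + 2 * Real.pi * inner ℝ ξ z =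
          ∑ j, (c j * ξ j ^ k j + 2 * Real.pi * z j * ξ j) := by
        rw [dispersionSymbol, PiLp.inner_apply, Finset.mul_sum, Finset.mul_sum,
          ← Finset.sum_add_distrib]
        refine Finset.sum_congr rfl fun j _ ↦ ?_
        simp only [hc, ← neg_mul, mul_pow, RCLike.inner_apply, conj_trivial]
        ring
      rw [← Complex.exp_sum, ← Complex.exp_add, ← Finset.mul_sum, ← mul_add, ← ofReal_add,
        ← ofReal_sum, hs]
    · rw [indicator_of_notMem hξ]
      simp only [frequencyBox, mem_ofPred_eq, not_forall] at hξ
      obtain ⟨j, hj⟩ := hξ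
      exact (Finset.prod_eq_zero (Finset.mem_univ j) (indicator_of_notMem hj _)).symm
  rw [← integral_indicator (measurableSet_frequencyBox R)]
  simp_rw [h1]
  rw [(PiLp.volume_preserving_ofLp (Fin n)).integral_comp
    (MeasurableEquiv.toLp 2 (Fin n → ℝ)).symm.measurableEmbedding (fun x ↦ ∏ j, φ j (x j)),
    integral_fintype_prod_volume_eq_prod, norm_prod]
  have h2 : ∀ j, c j ≠ 0 := fun j ↦ by
    have h2 : (2 * Real.pi) ≠ 0 := by positivity
    exact mul_ne_zero (mul_ne_zero hr (ha j)) (pow_ne_zero _ (neg_ne_zero.2 h2))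
  have h3 : kernelConst a k * |r| ^ (-∑ j, 1 / (k j : ℝ))
      = ∏ j, 18 * |c j| ^ (-(1 / k j : ℝ)) := by
    rw [← Finset.sum_neg_distrib, Real.rpow_sum_of_pos (abs_pos.2 hr), kernelConst,
      ← Finset.prod_mul_distrib]
    refine Finset.prod_congr rfl fun j _ ↦ ?_
    have : |c j| = |a j| * (2 * Real.pi) ^ k j * |r| := by
      simp only [hc]
      rw [abs_mul, abs_mul, abs_pow, abs_neg, abs_of_pos (by positivity : 0 < 2 * Real.pi)]
      ring
    rw [this, Real.mul_rpow (by positivity) (abs_nonneg _)]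
    ring
  rw [h3]
  refine Finset.prod_le_prod (fun _ _ ↦ norm_nonneg _) fun j _ ↦ ?_
  rw [hφ, integral_indicator measurableSet_Ioc, ← intervalIntegral.integral_of_le (by linarith)]
  exact norm_integral_exp_mul_pow_add_le (hk j) (h2 j) _ R hR

end kernel

/-! ### The propagator as a bilinear form, and its two endpoint bounds. -/

section form

theorem norm_cexp_I_mul (x : ℝ) : ‖cexp (I * x)‖ = 1 := by
  rw [mul_comm, norm_exp_ofReal_mul_I]

theorem continuous_propagator_symbol {X : Type*} [TopologicalSpace X] {b : X → ℝ} (hb : Continuous b) (r : ℝ) :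
    Continuous fun ξ ↦ cexp (I * (r * b ξ : ℝ)) := by fun_prop

variable {E : Type*} [NormedAddCommGroup E] [InnerProductSpace ℝ E] [FiniteDimensional ℝ E]
  [MeasurableSpace E] [BorelSpace E] {b : E → ℝ}

theorem fourier_fun_add {f g : E → ℂ} (hf : Integrable f) (hg : Integrable g) (ξ : E) :
    𝓕 (f + g) ξ = 𝓕 f ξ + 𝓕 g ξ := by
  simp only [Real.fourier_eq', smul_eq_mul, Pi.add_apply, mul_add]
  refine integral_add ?_ ?_
  · simpa [Real.fourier_eq', Circle.smul_def, Real.fourierChar_apply] using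
      (Real.fourierIntegral_convergent_iff (f := f) ξ).2 hf
  · simpa [Real.fourier_eq', Circle.smul_def, Real.fourierChar_apply] using
      (Real.fourierIntegral_convergent_iff (f := g) ξ).2 hg

theorem fourier_fun_smul (c : ℂ) (f : E → ℂ) (ξ : E) : 𝓕 (c • f) ξ = c * 𝓕 f ξ := by
  simp only [Real.fourier_eq', smul_eq_mul, Pi.smul_apply, mul_left_comm, integral_const_mul]

theorem fourierInv_fun_add {f g : E → ℂ} (hf : Integrable f) (hg : Integrable g) (ξ : E) :
    𝓕⁻ (f + g) ξ = 𝓕⁻ f ξ + 𝓕⁻ g ξ := by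
  simp only [Real.fourierInv_eq_fourier_neg, fourier_fun_add hf hg]

theorem fourierInv_fun_smul (c : ℂ) (f : E → ℂ) (ξ : E) : 𝓕⁻ (c • f) ξ = c * 𝓕⁻ f ξ := by
  simp only [Real.fourierInv_eq_fourier_neg, fourier_fun_smul]

theorem integrable_propagatorForm (hb : Continuous b) (r : ℝ) {f g : E → ℂ}
    (hf : f ∈ intersectionL1L2 (volume : Measure E))
    (hg : g ∈ intersectionL1L2 (volume : Measure E)) :
    Integrable fun ξ ↦ cexp (I * (r * b ξ : ℝ)) * (𝓕 f ξ * 𝓕⁻ g ξ) := by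
  have h1 := memLp_fourier (memLp_one_iff_integrable.1 hf.1) hf.2
  have h2 := memLp_fourierInv (memLp_one_iff_integrable.1 hg.1) hg.2
  refine (h1.integrable_mul h2).bdd_mul
    (continuous_propagator_symbol hb r).aestronglyMeasurable (c := 1)
    (Eventually.of_forall fun ξ ↦ (norm_cexp_I_mul _).le)

/-- The bilinear form `∫ g (S_r f)`. -/
def propagatorForm (hb : Continuous b) (r : ℝ) :
    intersectionL1L2 (volume : Measure E) →ₗ[ℂ] intersectionL1L2 (volume : Measure E) →ₗ[ℂ] ℂ :=
  LinearMap.mk₂ ℂ (fun f g ↦ ∫ ξ, cexp (I * (r * b ξ : ℝ)) * (𝓕 f.1 ξ * 𝓕⁻ g.1 ξ))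
    (fun f f' g ↦ by
      rw [← integral_add (integrable_propagatorForm hb r f.2 g.2)
        (integrable_propagatorForm hb r f'.2 g.2)]
      congr with ξ
      rw [Submodule.coe_add, fourier_fun_add (memLp_one_iff_integrable.1 f.2.1)
        (memLp_one_iff_integrable.1 f'.2.1)]
      ring)
    (fun c f g ↦ by
      rw [smul_eq_mul, ← integral_const_mul]
      congr with ξ
      rw [Submodule.coe_smul, fourier_fun_smul]
      ring)
    (fun f g g' ↦ by
      rw [← integral_add (integrable_propagatorForm hb r f.2 g.2)
        (integrable_propagatorForm hb r f.2 g'.2)]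
      congr with ξ
      rw [Submodule.coe_add, fourierInv_fun_add (memLp_one_iff_integrable.1 g.2.1)
        (memLp_one_iff_integrable.1 g'.2.1)]
      ring)
    (fun c f g ↦ by
      rw [smul_eq_mul, ← integral_const_mul]
      congr with ξ
      rw [Submodule.coe_smul, fourierInv_fun_smul]
      ring)

theorem propagatorForm_apply (hb : Continuous b) (r : ℝ)
    (f g : intersectionL1L2 (volume : Measure E)) :
    propagatorForm hb r f g = ∫ ξ, cexp (I * (r * b ξ : ℝ)) * (𝓕 f.1 ξ * 𝓕⁻ g.1 ξ) := rfl

theorem norm_propagatorForm_le_L2 (hb : Continuous b) (r : ℝ)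
    (f g : intersectionL1L2 (volume : Measure E)) :
    ‖propagatorForm hb r f g‖ ≤ √(∫ x, ‖f.1 x‖ ^ 2) * √(∫ x, ‖g.1 x‖ ^ 2) := by
  have hf := memLp_one_iff_integrable.1 f.2.1
  have hg := memLp_one_iff_integrable.1 g.2.1
  have h1 := memLp_fourier hf f.2.2
  have h2 := memLp_fourierInv hg g.2.2
  rw [propagatorForm_apply, ← integral_norm_sq_fourier hf f.2.2,
    ← integral_norm_sq_fourierInv hg g.2.2]
  refine (norm_integral_le_integral_norm _).trans ?_
  simp only [norm_mul, norm_cexp_I_mul, one_mul]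
  have := integral_mul_le_Lp_mul_Lq_of_nonneg (μ := (volume : Measure E)) Real.HolderConjugate.two_two
    (f := fun ξ ↦ ‖𝓕 f.1 ξ‖) (g := fun ξ ↦ ‖𝓕⁻ g.1 ξ‖)
    (Eventually.of_forall fun _ ↦ norm_nonneg _) (Eventually.of_forall fun _ ↦ norm_nonneg _)
    (by simpa using h1.norm) (by simpa using h2.norm)
  simpa [Real.sqrt_eq_rpow] using this

/-- A uniform bound for truncated kernels bounds the form on `L¹`. -/
theorem norm_propagatorForm_le_L1 (hb : Continuous b) (r : ℝ) {Q : ℕ → Set E}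
    (hQ : ∀ N, MeasurableSet (Q N)) (hQf : ∀ N, volume (Q N) < ⊤) (hmono : Monotone Q)
    (hcover : ⋃ N, Q N = univ) {A : ℝ}
    (hA : ∀ N z, ‖∫ ξ in Q N, cexp (I * (r * b ξ : ℝ)) *
      cexp (I * (2 * Real.pi * inner ℝ ξ z : ℝ))‖ ≤ A)
    (f g : intersectionL1L2 (volume : Measure E)) :
    ‖propagatorForm hb r f g‖ ≤ A * ((∫ x, ‖f.1 x‖) * ∫ x, ‖g.1 x‖) := by
  have hf := memLp_one_iff_integrable.1 f.2.1
  have hg := memLp_one_iff_integrable.1 g.2.1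
  -- For fixed `f` and `g` the product of Fourier transforms is integrable, so the frequency cutoff
  -- may be introduced at once and removed by a limit.
  have hlim := tendsto_setIntegral_of_monotone (f := fun ξ ↦ cexp (I * (r * b ξ : ℝ)) *
    (𝓕 f.1 ξ * 𝓕⁻ g.1 ξ)) hQ hmono (integrable_propagatorForm hb r f.2 g.2).integrableOn
  rw [hcover, Measure.restrict_univ, ← propagatorForm_apply hb] at hlim
  refine le_of_tendsto hlim.norm (Eventually.of_forall fun N ↦ ?_)
  set w : E → ℂ := (Q N).indicator fun ξ ↦ cexp (I * (r * b ξ : ℝ)) with hw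
  have hwi : ∀ y, Integrable fun ξ ↦ cexp (I * (2 * Real.pi * inner ℝ ξ y : ℝ)) * w ξ := by
    intro y
    have : Integrable w := by
      rw [hw, integrable_indicator_iff (hQ N)]
      exact Measure.integrableOn_of_bounded (hQf N).ne
        (continuous_propagator_symbol hb r).aestronglyMeasurable (M := 1)
        (Eventually.of_forall fun ξ ↦ (norm_cexp_I_mul _).le)
    exact this.bdd_mul (Continuous.aestronglyMeasurable (by fun_prop)) (c := 1)
      (Eventually.of_forall fun ξ ↦ (norm_cexp_I_mul _).le)
  have hwi0 : Integrable w := by simpa using hwi 0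
  have hwf : Integrable fun ξ ↦ w ξ * 𝓕 f.1 ξ :=
    hwi0.mul_bdd (continuous_fourier_of_integrable hf).aestronglyMeasurable
      (Eventually.of_forall fun ξ ↦ norm_fourier_le_integral_norm f.1 ξ)
  -- The truncated operator has a convolution kernel: this Fourier integral is the truncated kernel
  -- at `y - x`.
  have hker : ∀ y x, ‖𝓕 (fun ξ ↦ cexp (I * (2 * Real.pi * inner ℝ ξ y : ℝ)) * w ξ) x‖ ≤ A := by
    intro y x
    refine le_of_eq_of_le ?_ (hA N (y - x))
    rw [Real.fourier_eq', ← integral_indicator (hQ N)]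
    congr 1
    congr with ξ
    by_cases hξ : ξ ∈ Q N
    · simp only [hw, indicator_of_mem hξ, smul_eq_mul, ← Complex.exp_add, inner_sub_right]
      congr 1
      push_cast
      ring
    · simp [hw, hξ]
  have hinner : ∀ y, ‖𝓕⁻ (fun ξ ↦ w ξ * 𝓕 f.1 ξ) y‖ ≤ A * ∫ x, ‖f.1 x‖ := by
    intro y
    have h1 : 𝓕⁻ (fun ξ ↦ w ξ * 𝓕 f.1 ξ) y
        = ∫ x, 𝓕 (fun ξ ↦ cexp (I * (2 * Real.pi * inner ℝ ξ y : ℝ)) * w ξ) x * f.1 x := by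
      rw [integral_fourier_mul (hwi y) hf, Real.fourierInv_eq']
      congr with ξ
      rw [smul_eq_mul, mul_comm I]
      ring
    rw [h1, ← integral_const_mul]
    refine norm_integral_le_of_norm_le (hf.norm.const_mul A) (Eventually.of_forall fun x ↦ ?_)
    rw [norm_mul]
    exact mul_le_mul_of_nonneg_right (hker y x) (norm_nonneg _)
  have h2 : ∫ ξ in Q N, cexp (I * (r * b ξ : ℝ)) * (𝓕 f.1 ξ * 𝓕⁻ g.1 ξ)
      = ∫ y, 𝓕⁻ (fun ξ ↦ w ξ * 𝓕 f.1 ξ) y * g.1 y := by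
    rw [integral_fourierInv_mul hwf hg, ← integral_indicator (hQ N)]
    congr with ξ
    by_cases hξ : ξ ∈ Q N
    · simp [hw, hξ, mul_assoc]
    · simp [hw, hξ]
  rw [h2, ← mul_assoc, ← integral_const_mul]
  refine norm_integral_le_of_norm_le (hg.norm.const_mul _) (Eventually.of_forall fun x ↦ ?_)
  rw [norm_mul]
  exact mul_le_mul_of_nonneg_right (hinner x) (norm_nonneg _)

theorem schwartz_mem_intersectionL1L2 (ψ : 𝓢(E, ℂ)) :
    (ψ : E → ℂ) ∈ intersectionL1L2 (volume : Measure E) := ⟨ψ.memLp 1, ψ.memLp 2⟩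

/-- The form is defined on the Fourier side, where it makes sense on all of `L¹ ∩ L²`; on Schwartz
functions it recovers the propagator by exchanging the inverse Fourier transform. -/
theorem propagatorForm_schwartz (hb : b.HasTemperateGrowth) (r : ℝ) (ψ : 𝓢(E, ℂ))
    (g : intersectionL1L2 (volume : Measure E)) :
    propagatorForm hb.1.continuous r ⟨ψ, schwartz_mem_intersectionL1L2 ψ⟩ g
      = ∫ x, propagator b r ψ x * g.1 x := by
  have hs := hasTemperateGrowth_propagator_symbol hb r
  rw [propagatorForm_apply, propagator, SchwartzMap.fourierMultiplierCLM_apply,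
    SchwartzMap.fourierInv_coe, integral_fourierInv_mul (SchwartzMap.integrable _)
    (memLp_one_iff_integrable.1 g.2.1)]
  congr with ξ
  rw [SchwartzMap.smulLeftCLM_apply_apply hs, SchwartzMap.fourier_coe, smul_eq_mul, mul_assoc]

end form

section decay

variable {n : ℕ}

theorem norm_propagatorForm_dispersion_le {a : Fin n → ℝ} {k : Fin n → ℕ} (ha : ∀ j, a j ≠ 0)
    (hk : ∀ j, 2 ≤ k j) {r : ℝ} (hr : r ≠ 0)
    (f g : intersectionL1L2 (volume : Measure (Space n))) :
    ‖propagatorForm (hasTemperateGrowth_dispersionSymbol a k).1.continuous r f g‖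
      ≤ kernelConst a k * |r| ^ (-∑ j, 1 / (k j : ℝ)) * ((∫ x, ‖f.1 x‖) * ∫ x, ‖g.1 x‖) := by
  refine norm_propagatorForm_le_L1 _ r (Q := fun N : ℕ ↦ frequencyBox n N)
    (fun N ↦ measurableSet_frequencyBox _) (fun N ↦ volume_frequencyBox_lt_top _)
    (fun M N h ξ hξ j ↦ ?_) ?_
    (fun N z ↦ norm_integral_frequencyBox_le ha hk hr N.cast_nonneg z) f g
  · have h' : (M : ℝ) ≤ N := by exact_mod_cast h
    exact ⟨by linarith [(hξ j).1], (hξ j).2.trans h'⟩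
  · refine eq_univ_of_forall fun ξ ↦ mem_iUnion.2 ?_
    obtain ⟨N, hN⟩ := exists_nat_gt ‖ξ‖
    refine ⟨N, fun j ↦ ?_⟩
    have := (PiLp.norm_apply_le ξ j).trans_lt hN
    rw [Real.norm_eq_abs, abs_lt] at this
    exact ⟨this.1, this.2.le⟩

end decay
end Dispersive
end

/-! ### Unitarity and decay of the propagator -/
noncomputable section
namespace Dispersive
open Set Filter Topology FourierTransform

section unitary

variable {E : Type*} [NormedAddCommGroup E] [InnerProductSpace ℝ E] [FiniteDimensional ℝ E]
  [MeasurableSpace E] [BorelSpace E] {b : E → ℝ}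

theorem inner_toLp_eq_integral (ψ χ : 𝓢(E, ℂ)) :
    inner ℂ (ψ.toLp 2 (volume : Measure E)) (χ.toLp 2 (volume : Measure E))
      = ∫ x, (starRingEnd ℂ) (ψ x) * χ x := by
  rw [L2.inner_def]
  refine integral_congr_ae ?_
  filter_upwards [ψ.coeFn_toLp 2 (volume : Measure E), χ.coeFn_toLp 2 (volume : Measure E)]
    with x h1 h2
  rw [h1, h2, RCLike.inner_apply, mul_comm]

/-- By Plancherel, and because `b` is real, the conjugate of `exp (i s b)` cancels part of `exp (i t
b)`. This identity turns the `TT*` square into an integral of the propagator at time differences. -/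
theorem inner_toLp_propagator (hb : b.HasTemperateGrowth) (s t : ℝ) (ψ χ : 𝓢(E, ℂ)) :
    inner ℂ ((propagator b s ψ).toLp 2 (volume : Measure E))
        ((propagator b t χ).toLp 2 (volume : Measure E))
      = ∫ x, (starRingEnd ℂ) (ψ x) * propagator b (t - s) χ x := by
  have hF : ∀ r (ψ : 𝓢(E, ℂ)) ξ, 𝓕 (propagator b r ψ) ξ = cexp (I * (r * b ξ : ℝ)) * 𝓕 ψ ξ := by
    intro r ψ ξ
    rw [propagator, SchwartzMap.fourierMultiplierCLM_apply,
      FourierTransform.fourier_fourierInv_eq,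
      SchwartzMap.smulLeftCLM_apply_apply (hasTemperateGrowth_propagator_symbol hb r), smul_eq_mul]
  rw [← inner_toLp_eq_integral, ← SchwartzMap.inner_fourier_toL2_eq (propagator b s ψ),
    ← SchwartzMap.inner_fourier_toL2_eq ψ, inner_toLp_eq_integral, inner_toLp_eq_integral]
  congr with ξ
  rw [hF, hF, hF, map_mul, ← Complex.exp_conj, map_mul, conj_I, conj_ofReal]
  rw [show cexp (I * ((t - s) * b ξ : ℝ)) = cexp (-I * (s * b ξ : ℝ)) * cexp (I * (t * b ξ : ℝ)) by
    rw [← Complex.exp_add]; congr 1; push_cast; ring]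
  ring

theorem norm_toLp_propagator (hb : b.HasTemperateGrowth) (t : ℝ) (ψ : 𝓢(E, ℂ)) :
    ‖(propagator b t ψ).toLp 2 (volume : Measure E)‖ = ‖ψ.toLp 2 (volume : Measure E)‖ := by
  have h := inner_toLp_propagator hb t t ψ ψ
  rw [sub_self, propagator_zero, ← inner_toLp_eq_integral, inner_self_eq_norm_sq_to_K,
    inner_self_eq_norm_sq_to_K] at h
  have h' : ‖(propagator b t ψ).toLp 2 (volume : Measure E)‖ ^ 2
      = ‖ψ.toLp 2 (volume : Measure E)‖ ^ 2 := by exact_mod_cast h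
  exact (sq_eq_sq₀ (norm_nonneg _) (norm_nonneg _)).1 h'

end unitary

/-! ### Estimating `L^q` norms of Schwartz functions by duality. -/

section duality

variable {E : Type*} [NormedAddCommGroup E] [InnerProductSpace ℝ E] [FiniteDimensional ℝ E]
  [MeasurableSpace E] [BorelSpace E]

theorem integrable_norm_rpow_schwartz (h : 𝓢(E, ℂ)) {s : ℝ} (hs : 0 < s) :
    Integrable fun x ↦ ‖h x‖ ^ s := by
  have := (h.memLp (ENNReal.ofReal s) (volume : Measure E)).integrable_norm_rpow
    (by simpa using hs) (by simp)
  rwa [ENNReal.toReal_ofReal hs.le] at this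

theorem eLpNorm_schwartz (h : 𝓢(E, ℂ)) {q : ℝ} (hq : 0 < q) :
    eLpNorm h (ENNReal.ofReal q) volume = ENNReal.ofReal ((∫ x, ‖h x‖ ^ q) ^ (1 / q)) := by
  rw [(h.memLp (ENNReal.ofReal q) (volume : Measure E)).eLpNorm_eq_integral_rpow_norm
    (by simpa using hq) (by simp), ENNReal.toReal_ofReal hq.le, one_div]

/-- A bound on the `L^q` norm of a Schwartz function by testing against `L¹ ∩ L²`. -/
theorem eLpNorm_le_of_forall_intersectionL1L2 {p q : ℝ} (hp1 : 1 < p) (hp2 : p < 2)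
    (hpq : p.HolderConjugate q) (h : 𝓢(E, ℂ)) {K : ℝ} (hK : 0 ≤ K)
    (hh : ∀ g ∈ intersectionL1L2 (volume : Measure E),
      ‖∫ x, h x * g x‖ ≤ K * (∫ x, ‖g x‖ ^ p) ^ (1 / p)) :
    eLpNorm h (ENNReal.ofReal q) volume ≤ ENNReal.ofReal K := by
  have hq2 : 2 < q := by
    have h1 := hpq.symm.sub_one_pos
    have h2 := hpq.mul_eq_add
    nlinarith
  -- The extremal test function: `h g = |h| ^ q = |g| ^ p`. It lies in `L¹ ∩ L²` because positive
  -- powers of a Schwartz function are integrable.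
  set g : E → ℂ := fun x ↦ ((‖h x‖ ^ (q - 2) : ℝ) : ℂ) * (starRingEnd ℂ) (h x) with hg
  have hgn : ∀ x, ‖g x‖ = ‖h x‖ ^ (q - 1) := fun x ↦ by
    rw [hg, norm_mul, RCLike.norm_conj, norm_real, Real.norm_of_nonneg (by positivity)]
    rcases eq_or_ne ‖h x‖ 0 with h0 | h0
    · rw [h0, mul_zero, Real.zero_rpow (by linarith)]
    · rw [← Real.rpow_add_one h0]; congr 1; ring
  have hgc : Continuous g := by
    have : Continuous fun x ↦ ‖h x‖ ^ (q - 2) :=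
      h.continuous.norm.rpow_const fun x ↦ Or.inr (by linarith)
    have h2 : Continuous fun x ↦ h x := h.continuous
    fun_prop
  have hgm : g ∈ intersectionL1L2 (volume : Measure E) := by
    refine ⟨memLp_one_iff_integrable.2 ((integrable_norm_iff hgc.aestronglyMeasurable).1 ?_),
      (memLp_two_iff_integrable_sq_norm hgc.aestronglyMeasurable).2 ?_⟩
    · simp only [hgn]
      exact integrable_norm_rpow_schwartz h (by linarith)
    · simp only [hgn, ← Real.rpow_mul_natCast (norm_nonneg _)]
      exact integrable_norm_rpow_schwartz h (by push_cast; linarith)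
  set X := ∫ x, ‖h x‖ ^ q with hX
  have hX0 : 0 ≤ X := by positivity
  have h1 : ∫ x, h x * g x = (X : ℂ) := by
    rw [hX, ← integral_complex_ofReal]
    congr with x
    rw [hg, mul_left_comm, mul_conj, normSq_eq_norm_sq, ← ofReal_mul]
    congr 1
    rcases eq_or_ne ‖h x‖ 0 with h0 | h0
    · rw [h0, Real.zero_rpow (by linarith : q ≠ 0)]; simp
    · rw [← Real.rpow_natCast, ← Real.rpow_add (by positivity)]
      congr 1; push_cast; ring
  have h2 : ∫ x, ‖g x‖ ^ p = X := by
    congr with x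
    rw [hgn, ← Real.rpow_mul (norm_nonneg _)]
    congr 1
    rw [mul_comm]
    linarith [hpq.mul_eq_add]
  have key := hh g hgm
  rw [h1, h2, norm_real, Real.norm_of_nonneg hX0] at key
  rw [eLpNorm_schwartz h (by linarith)]
  refine ENNReal.ofReal_le_ofReal ?_
  rcases hX0.eq_or_lt with h0 | h0
  · rw [← hX, ← h0, Real.zero_rpow (by positivity)]
    exact hK
  · have h3 : 1 / q = 1 - 1 / p := by
      have := hpq.inv_add_inv_eq_one
      simp only [one_div]; linarith
    rw [← hX, h3, Real.rpow_sub h0, Real.rpow_one, div_le_iff₀ (by positivity)]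
    exact key

end duality

section decay

variable {n : ℕ}

/-- Interpolation raises the endpoint constant `D |r| ^ (-σ)` to the power `2/p - 1 = 1 / (1 + σ)`,
which produces `|r| ^ (-α)`. Testing against `L¹ ∩ L²` converts the bilinear bound into an operator
bound. -/
theorem exists_eLpNorm_propagator_le {a : Fin n → ℝ} {k : Fin n → ℕ} (ha : ∀ j, a j ≠ 0)
    (hk : ∀ j, 2 ≤ k j) {p q α : ℝ} (hσ : 0 < ∑ j, 1 / (k j : ℝ))
    (hα : α = (∑ j, 1 / (k j : ℝ)) / (1 + ∑ j, 1 / (k j : ℝ)))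
    (hp : p = 2 / (2 - α)) (hpq : p.HolderConjugate q) :
    ∃ C : ℝ≥0, ∀ r ≠ 0, ∀ ψ : 𝓢(Space n, ℂ),
      eLpNorm (propagator (dispersionSymbol a k) r ψ) (ENNReal.ofReal q) volume
        ≤ C * rieszKernel α r * eLpNorm ψ (ENNReal.ofReal p) volume := by
  set σ := ∑ j, 1 / (k j : ℝ) with hσd
  have hα1 : α < 1 := by rw [hα, div_lt_one (by linarith)]; linarith
  have hα0 : 0 < α := by rw [hα]; positivity
  have hp1 : 1 < p := hpq.lt
  have hp2 : p < 2 := by rw [hp, div_lt_iff₀ (by linarith)]; linarith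
  have hexp : 2 / p - 1 = 1 / (1 + σ) := by
    rw [hp, hα]; field_simp; ring
  have hb := hasTemperateGrowth_dispersionSymbol a k
  set D := kernelConst a k with hD
  have hD0 : 0 < D := kernelConst_pos ha k
  have hI := interpolationConst_nonneg p
  refine ⟨(interpolationConst p * D ^ (1 / (1 + σ))).toNNReal, fun r hr ψ ↦ ?_⟩
  have hr' : 0 < |r| := abs_pos.2 hr
  have hA : 0 < D * |r| ^ (-σ) := by positivity
  have h1 := eLpNorm_le_of_forall_intersectionL1L2 hp1 hp2 hpq
    (propagator (dispersionSymbol a k) r ψ)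
    (K := interpolationConst p * D ^ (1 / (1 + σ)) * |r| ^ (-α) * (∫ x, ‖ψ x‖ ^ p) ^ (1 / p))
    (by positivity) fun g hg ↦ by
      have := norm_bilin_le_interpolation (propagatorForm hb.1.continuous r) hp1 hp2 hA
        (norm_propagatorForm_dispersion_le ha hk hr) (norm_propagatorForm_le_L2 _ r)
        ⟨ψ, schwartz_mem_intersectionL1L2 ψ⟩ ⟨g, hg⟩
      rw [propagatorForm_schwartz hb] at this
      refine this.trans_eq ?_
      rw [hexp, Real.mul_rpow hD0.le (by positivity), ← Real.rpow_mul hr'.le,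
        show -σ * (1 / (1 + σ)) = -α by rw [hα]; ring]
      ring
  refine h1.trans_eq ?_
  rw [eLpNorm_schwartz ψ (by linarith), rieszKernel, ENNReal.ofReal_mul (by positivity),
    ENNReal.ofReal_mul (by positivity)]
  rfl

end decay
end Dispersive
end

/-! ### Duhamel's formula -/
noncomputable section
namespace Dispersive
open Set Filter Topology FourierTransform

/-! ### Weak derivatives of continuous functions of time. -/

section duBoisReymond

/-- The primitive of a normalised bump function. -/
def bumpStep (ρ : ContDiffBump (0 : ℝ)) (r : ℝ) : ℝ := ∫ x in (-1)..r, ρ.normed volume x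

variable {ρ : ContDiffBump (0 : ℝ)}

theorem hasDerivAt_bumpStep (r : ℝ) : HasDerivAt (bumpStep ρ) (ρ.normed volume r) r :=
  intervalIntegral.integral_hasDerivAt_right (ρ.continuous_normed.intervalIntegrable _ _)
    ρ.continuous_normed.aestronglyMeasurable.stronglyMeasurableAtFilter
    ρ.continuous_normed.continuousAt

theorem contDiff_bumpStep : ContDiff ℝ ∞ (bumpStep ρ) := by
  refine contDiff_infty_iff_deriv.2 ⟨fun r ↦ (hasDerivAt_bumpStep r).differentiableAt, ?_⟩
  have : deriv (bumpStep ρ) = ρ.normed volume := funext fun r ↦ (hasDerivAt_bumpStep r).deriv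
  rw [this]
  exact ρ.contDiff_normed

theorem bumpStep_of_le (hρ : ρ.rOut ≤ 1) {r : ℝ} (hr : r ≤ -ρ.rOut) : bumpStep ρ r = 0 := by
  refine intervalIntegral.integral_zero_ae (Eventually.of_forall fun x hx ↦ ?_)
  have hx' : x ≤ -ρ.rOut := by
    rcases mem_uIoc.1 hx with h | h
    · exact h.2.trans hr
    · exact h.2.trans (by linarith)
  have : x ∉ Function.support (ρ.normed volume) := by
    rw [ρ.support_normed_eq, Metric.mem_ball, dist_zero_right, Real.norm_eq_abs, not_lt]
    exact (by linarith : ρ.rOut ≤ -x).trans (neg_le_abs x)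
  simpa using this

theorem bumpStep_of_ge (hρ : ρ.rOut ≤ 1) {r : ℝ} (hr : ρ.rOut ≤ r) : bumpStep ρ r = 1 := by
  have hpos := ρ.rOut_pos
  rw [bumpStep, intervalIntegral.integral_of_le (by linarith)]
  refine (setIntegral_eq_integral_of_forall_compl_eq_zero fun x hx ↦ ?_).trans ρ.integral_normed
  by_contra hne
  have : x ∈ Function.support (ρ.normed volume) := hne
  rw [ρ.support_normed_eq, Metric.mem_ball, dist_zero_right, Real.norm_eq_abs, abs_lt] at this
  exact hx ⟨by linarith, by linarith⟩

theorem monotone_bumpStep : Monotone (bumpStep ρ) :=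
  monotone_of_hasDerivAt_nonneg hasDerivAt_bumpStep fun r ↦ ρ.nonneg_normed r

theorem bumpStep_mem (hρ : ρ.rOut ≤ 1) (r : ℝ) : bumpStep ρ r ∈ Icc (0 : ℝ) 1 := by
  constructor
  · rw [← bumpStep_of_le hρ (min_le_left (-ρ.rOut) r)]
    exact monotone_bumpStep (min_le_right _ _)
  · rw [← bumpStep_of_ge hρ (le_max_left ρ.rOut r)]
    exact monotone_bumpStep (le_max_right _ _)

/-- A continuous function with a locally integrable weak derivative is its primitive. -/
theorem sub_eq_integral_of_weak_deriv {w G : ℝ → ℂ} (hw : Continuous w) (hG : LocallyIntegrable G)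
    (h : ∀ η : ℝ → ℂ, ContDiff ℝ ∞ η → HasCompactSupport η →
      ∫ t, w t * deriv η t = -∫ t, G t * η t) {s t : ℝ} (hst : s ≤ t) :
    w t - w s = ∫ r in s..t, G r := by
  set ρ : ℕ → ContDiffBump (0 : ℝ) := fun i ↦
    ⟨1 / (2 * (i + 1)), 1 / (i + 1), by positivity, by
      apply one_div_lt_one_div_of_lt <;> linarith [(i.cast_nonneg : (0 : ℝ) ≤ i)]⟩ with hρ
  have hr1 : ∀ i, (ρ i).rOut ≤ 1 := fun i ↦ by
    simp only [hρ]
    rw [div_le_one (by positivity)]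
    linarith [(i.cast_nonneg : (0 : ℝ) ≤ i)]
  have hr0 : Tendsto (fun i ↦ (ρ i).rOut) atTop (𝓝 0) := tendsto_one_div_add_atTop_nhds_zero_nat
  -- A difference of smoothed steps approximates the indicator of `(s, t)`, while its derivative is
  -- a difference of approximate Dirac masses at `s` and `t`.
  set η : ℕ → ℝ → ℂ := fun i r ↦ ((bumpStep (ρ i) (r - s) - bumpStep (ρ i) (r - t) : ℝ) : ℂ) with hη
  have hηd : ∀ i r, HasDerivAt (η i)
      (((ρ i).normed volume (r - s) - (ρ i).normed volume (r - t) : ℝ) : ℂ) r := fun i r ↦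
    (((hasDerivAt_bumpStep (r - s)).comp_sub_const r s).fun_sub
      ((hasDerivAt_bumpStep (r - t)).comp_sub_const r t)).ofReal_comp
  have hηs : ∀ i, ContDiff ℝ ∞ (η i) := fun i ↦ ofRealCLM.contDiff.comp
    ((contDiff_bumpStep.comp (contDiff_id.sub contDiff_const)).sub
      (contDiff_bumpStep.comp (contDiff_id.sub contDiff_const)))
  have hη0 : ∀ i, ∀ r ∉ Icc (s - 1) (t + 1), η i r = 0 := by
    intro i r hr
    rw [mem_Icc, not_and_or, not_le, not_le] at hr
    rcases hr with hr | hr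
    · simp only [hη]
      rw [bumpStep_of_le (hr1 i) (by linarith [hr1 i]), bumpStep_of_le (hr1 i) (by linarith [hr1 i])]
      simp
    · simp only [hη]
      rw [bumpStep_of_ge (hr1 i) (by linarith [hr1 i]), bumpStep_of_ge (hr1 i) (by linarith [hr1 i])]
      simp
  have hηc : ∀ i, HasCompactSupport (η i) := fun i ↦
    HasCompactSupport.intro isCompact_Icc fun r hr ↦ hη0 i r hr
  have hη1 : ∀ i r, ‖η i r‖ ≤ 1 := fun i r ↦ by
    simp only [hη]
    rw [norm_real, Real.norm_eq_abs, abs_le]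
    have h1 := bumpStep_mem (hr1 i) (r - s)
    have h2 := bumpStep_mem (hr1 i) (r - t)
    constructor <;> linarith [h1.1, h1.2, h2.1, h2.2]
  have hlim1 : Tendsto (fun i ↦ ∫ r, G r * η i r) atTop (𝓝 (∫ r in s..t, G r)) := by
    rw [intervalIntegral.integral_of_le hst, integral_Ioc_eq_integral_Ioo,
      ← integral_indicator measurableSet_Ioo]
    refine tendsto_integral_of_dominated_convergence
      ((Icc (s - 1) (t + 1)).indicator fun r ↦ ‖G r‖) (fun i ↦ ?_) ?_ (fun i ↦ ?_) ?_
    · exact hG.aestronglyMeasurable.mul (hηs i).continuous.aestronglyMeasurable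
    · exact (integrable_indicator_iff measurableSet_Icc).2
        (hG.integrableOn_isCompact isCompact_Icc).norm
    · refine Eventually.of_forall fun r ↦ ?_
      by_cases hr : r ∈ Icc (s - 1) (t + 1)
      · rw [indicator_of_mem hr, norm_mul]
        exact mul_le_of_le_one_right (norm_nonneg _) (hη1 i r)
      · rw [indicator_of_notMem hr, hη0 i r hr, mul_zero, norm_zero]
    · have hst0 : ∀ᵐ r : ℝ, r ≠ s ∧ r ≠ t := by
        refine (measure_eq_zero_iff_ae_notMem.1 (measure_singleton s)).and
          (measure_eq_zero_iff_ae_notMem.1 (measure_singleton t)) |>.mono fun r hr ↦ by simpa using hr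
      filter_upwards [hst0] with r hr
      have hs' : ∀ᶠ i in atTop, (ρ i).rOut < |r - s| :=
        hr0.eventually_lt_const (abs_pos.2 (sub_ne_zero.2 hr.1))
      have ht' : ∀ᶠ i in atTop, (ρ i).rOut < |r - t| :=
        hr0.eventually_lt_const (abs_pos.2 (sub_ne_zero.2 hr.2))
      have step : ∀ i x, (ρ i).rOut < |x| → bumpStep (ρ i) x = if 0 < x then 1 else 0 := by
        intro i x hx
        split_ifs with h0
        · exact bumpStep_of_ge (hr1 i) (by rw [abs_of_pos h0] at hx; exact hx.le)
        · exact bumpStep_of_le (hr1 i) (by rw [abs_of_nonpos (not_lt.1 h0)] at hx; linarith)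
      refine tendsto_const_nhds.congr' ?_
      filter_upwards [hs', ht'] with i h1 h2
      simp only [hη]
      rw [step i _ h1, step i _ h2]
      by_cases hm : r ∈ Ioo s t
      · rw [indicator_of_mem hm, if_pos (by linarith [hm.1]), if_neg (by linarith [hm.2])]
        simp
      · rw [indicator_of_notMem hm]
        rw [mem_Ioo, not_and_or, not_lt, not_lt] at hm
        rcases hm with hm | hm
        · rw [if_neg (by linarith), if_neg (by linarith)]; simp
        · have := lt_of_le_of_ne hm (Ne.symm hr.2)
          rw [if_pos (by linarith), if_pos (by linarith)]; simp
  have hconv : ∀ x, Tendsto (fun i ↦ ∫ r, w r * (((ρ i).normed volume (r - x) : ℝ) : ℂ)) atTop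
      (𝓝 (w x)) := by
    intro x
    have h1 := ContDiffBump.convolution_tendsto_right_of_continuous (μ := volume) hr0 hw x
    refine h1.congr fun i ↦ ?_
    rw [convolution_def, ← integral_sub_left_eq_self _ volume x]
    congr with r
    rw [← (ρ i).normed_neg (r - x)]
    simp [mul_comm]
  have hint : ∀ i x, Integrable fun r ↦ w r * (((ρ i).normed volume (r - x) : ℝ) : ℂ) := by
    intro i x
    have hc : HasCompactSupport fun r ↦ (((ρ i).normed volume (r - x) : ℝ) : ℂ) :=
      (((ρ i).hasCompactSupport_normed (μ := volume)).comp_homeomorph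
        (Homeomorph.subRight x)).comp_left (g := ofReal) rfl
    refine Continuous.integrable_of_hasCompactSupport ?_ hc.mul_left
    have := (ρ i).continuous_normed (μ := volume)
    fun_prop
  have hlim2 := (hconv s).sub (hconv t)
  have heq : ∀ i, (∫ r, w r * (((ρ i).normed volume (r - s) : ℝ) : ℂ)) -
      (∫ r, w r * (((ρ i).normed volume (r - t) : ℝ) : ℂ)) = -∫ r, G r * η i r := by
    intro i
    rw [← h _ (hηs i) (hηc i), ← integral_sub (hint i s) (hint i t)]
    congr with r
    rw [(hηd i r).deriv]
    push_cast
    ring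
  have := tendsto_nhds_unique (hlim2.congr heq) hlim1.neg
  linear_combination -this

end duBoisReymond

/-! ### Differentiating along the backward propagator. -/

section duhamel

theorem continuous_eval_distribution {E : Type*} [NormedAddCommGroup E] [NormedSpace ℝ E]
    {u : ℝ → 𝓢'(E, ℂ)} (hu : Continuous u) (ψ : 𝓢(E, ℂ)) :
    Continuous fun t ↦ u t ψ :=
  (PointwiseConvergenceCLM.evalCLM (RingHom.id ℂ) ℂ ψ).continuous.comp hu

variable {E : Type*} [NormedAddCommGroup E] [InnerProductSpace ℝ E] [FiniteDimensional ℝ E]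
  [MeasurableSpace E] [BorelSpace E] {b : E → ℝ}

/-- Duhamel's formula for a weak solution, the right-hand side being a family of functionals. -/
theorem duhamel_formula {u : ℝ → 𝓢'(E, ℂ)} (hu : Continuous u) (hb : b.HasTemperateGrowth)
    {Φ : ℝ → 𝓢(E, ℂ) → ℂ} {N : ℝ → ℝ} (hN : LocallyIntegrable N) (hN0 : ∀ r, 0 ≤ N r)
    {q : Seminorm ℂ 𝓢(E, ℂ)} (hq : Continuous q)
    (hΦ : ∀ᵐ r, ∀ χ, ‖Φ r χ‖ ≤ N r * q χ)
    (hΦs : ∀ᵐ r, ∀ χ χ', Φ r (χ - χ') = Φ r χ - Φ r χ')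
    (hΦm : ∀ χ, AEStronglyMeasurable fun r ↦ Φ r χ)
    (heq : ∀ χ s t, s ≤ t → u t χ - u s χ =
      ∫ r in s..t, (I * u r (realMultiplier b χ) + I * Φ r χ))
    (T : ℝ) (ψ : 𝓢(E, ℂ)) (hm : AEStronglyMeasurable fun r ↦ Φ r (propagator b (T - r) ψ)) :
    u T ψ = u 0 (propagator b T ψ) + I * ∫ r in (0)..T, Φ r (propagator b (T - r) ψ) := by
  have hlinN : ∀ a c, IntervalIntegrable N volume a c := fun a c ↦
    (hN.integrableOn_isCompact isCompact_uIcc).intervalIntegrable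
  set G : ℝ → ℂ := fun r ↦ Φ r (propagator b (T - r) ψ) with hG
  have hqc : Continuous fun r ↦ q (propagator b (T - r) ψ) :=
    hq.comp ((continuous_propagator hb ψ).comp (by fun_prop))
  have hGi : ∀ a c, IntervalIntegrable G volume a c := fun a c ↦ by
    refine ((hlinN a c).mul_continuousOn hqc.continuousOn).mono_fun hm.restrict
      (ae_restrict_of_ae (hΦ.mono fun r hr ↦ ?_))
    exact (hr _).trans (le_abs_self _)
  have hΦi : ∀ χ a c, IntervalIntegrable (fun r ↦ Φ r χ) volume a c := fun χ a c ↦ by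
    refine ((hlinN a c).mul_const (q χ)).mono_fun (hΦm χ).restrict
      (ae_restrict_of_ae (hΦ.mono fun r hr ↦ ?_))
    exact (hr _).trans (le_abs_self _)
  have heq' : ∀ χ s t, u t χ - u s χ =
      ∫ r in s..t, (I * u r (realMultiplier b χ) + I * Φ r χ) := by
    intro χ s t
    rcases le_total s t with h | h
    · exact heq χ s t h
    · rw [intervalIntegral.integral_symm, ← heq χ t s h]; ring
  -- The aim is that `H` be constant; comparing its values at `T` and at 0 is then the formula.
  set H : ℝ → ℂ := fun s ↦ u s (propagator b (T - s) ψ) - I * ∫ r in (0)..s, G r with hH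
  have key : ∀ t, HasDerivAt H 0 t := by
    intro t
    set χ := propagator b (T - t) ψ with hχ
    set v : ℝ → ℂ := fun r ↦ u r (realMultiplier b χ) with hv
    have hvc : Continuous v := continuous_eval_distribution hu _
    -- Both the distribution and its argument vary with `s`. One seminorm must therefore bound all
    -- `u_s` for `s` near `t`.
    obtain ⟨J, C, hC⟩ := exists_seminorm_bound_of_continuous hu (|t| + 1)
    have hJ : Continuous (J.sup (schwartzSeminormFamily ℂ E ℂ) : Seminorm ℂ 𝓢(E, ℂ)) := by
      refine Seminorm.continuous_of_le (q := ∑ i ∈ J, schwartzSeminormFamily ℂ E ℂ i) ?_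
        (Seminorm.finset_sup_le_sum _ J)
      have : ⇑(∑ i ∈ J, schwartzSeminormFamily ℂ E ℂ i) =
          fun ψ ↦ ∑ i ∈ J, schwartzSeminormFamily ℂ E ℂ i ψ := by
        ext ψ; rw [sum_apply]
      rw [this]
      exact continuous_finsetSum _ fun i _ ↦
        (schwartz_withSeminorms ℂ E ℂ).continuous_seminorm i
    obtain ⟨C₂, hC₂0, hC₂⟩ := exists_seminorm_propagator_expansion_le hb hJ (T - t) ψ
    obtain ⟨C₃, hC₃0, hC₃⟩ := exists_seminorm_propagator_sub_le hb hq (T - t) ψ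
    -- The increment is split using the integrated equation for the frozen function `χ`. The first
    -- term is a second order Taylor remainder, of size `|s - t|²`. The second is small relative to
    -- `|s - t|` by continuity of `v`. The third is at most `C₃ |s - t|` times `|∫ N|` between `t`
    -- and `s`, which tends to zero. Only local integrability of `N` is needed.
    have hdecomp : ∀ s, H s - H t =
        u s (propagator b (T - s) ψ - χ - (I * ((t - s : ℝ) : ℂ)) • realMultiplier b χ)
        + I * (∫ r in t..s, (v r - v s)) + I * ∫ r in t..s, (Φ r χ - G r) := by
      intro s
      have h1 := heq' χ t s
      rw [intervalIntegral.integral_add ((hvc.intervalIntegrable _ _).const_mul I)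
        ((hΦi χ t s).const_mul I), intervalIntegral.integral_const_mul,
        intervalIntegral.integral_const_mul] at h1
      rw [intervalIntegral.integral_sub (hvc.intervalIntegrable _ _)
        intervalIntegrable_const, intervalIntegral.integral_sub (hΦi χ t s) (hGi t s),
        intervalIntegral.integral_const]
      have h2 := intervalIntegral.integral_add_adjacent_intervals (hGi 0 t) (hGi t s)
      simp only [hH, ← h2, map_sub, map_smul, smul_eq_mul, real_smul]
      have h3 : v s = u s (realMultiplier b χ) := rfl
      rw [← h3, ← hχ]
      push_cast
      linear_combination h1
    rw [hasDerivAt_iff_isLittleO]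
    refine Asymptotics.isLittleO_iff.2 fun ε hε ↦ ?_
    have e1 : ∀ᶠ s in 𝓝 t, |s - t| < min 1 (ε / 3 / (C * C₂ + 1)) :=
      Metric.ball_mem_nhds t (by positivity)
    obtain ⟨δ, hδ, hvδ⟩ := Metric.continuousAt_iff.1 (hvc.continuousAt (x := t)) (ε / 6) (by positivity)
    have e2 : ∀ᶠ s in 𝓝 t, |s - t| < δ := Metric.ball_mem_nhds t hδ
    have e3 : ∀ᶠ s in 𝓝 t, |∫ r in t..s, N r| < ε / 3 / (C₃ + 1) := by
      have h1 : Continuous fun s ↦ |∫ r in t..s, N r| :=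
        (intervalIntegral.continuous_primitive hlinN t).abs
      have h2 := h1.tendsto t
      simp only [intervalIntegral.integral_same, abs_zero] at h2
      exact h2.eventually_lt_const (by positivity)
    filter_upwards [e1, e2, e3] with s h1 h2 h3
    have h11 : |s - t| ≤ 1 := h1.le.trans (min_le_left _ _)
    have hst : ∀ r ∈ uIoc t s, |r - t| ≤ |s - t| := fun r hr ↦
      abs_sub_left_of_mem_uIcc (uIoc_subset_uIcc hr)
    have b1 : ‖u s (propagator b (T - s) ψ - χ - (I * ((t - s : ℝ) : ℂ)) • realMultiplier b χ)‖
        ≤ ε / 3 * |s - t| := by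
      have hs : s ∈ Icc (-(|t| + 1)) (|t| + 1) := by
        refine abs_le.1 ?_
        calc |s| = |t + (s - t)| := by ring_nf
          _ ≤ |t| + |s - t| := abs_add_le _ _
          _ ≤ _ := by linarith
      refine (hC s hs _).trans ?_
      have h4 := hC₂ (t - s) (by rwa [abs_sub_comm])
      rw [show T - t + (t - s) = T - s by ring] at h4
      have h5 : |s - t| * (C * C₂ + 1) < ε / 3 :=
        (lt_div_iff₀ (by positivity)).1 (h1.trans_le (min_le_right _ _))
      have h6 : (t - s) ^ 2 = |s - t| * |s - t| := by rw [abs_mul_abs_self]; ring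
      calc _ ≤ (C : ℝ) * (C₂ * (t - s) ^ 2) := by gcongr
        _ = (|s - t| * (C * C₂)) * |s - t| := by rw [h6]; ring
        _ ≤ _ := by
          gcongr
          nlinarith [abs_nonneg (s - t)]
    have b2 : ‖∫ r in t..s, (v r - v s)‖ ≤ ε / 3 * |s - t| := by
      refine intervalIntegral.norm_integral_le_of_norm_le_const fun r hr ↦ ?_
      have h4 := hvδ (x := r) ((hst r hr).trans_lt h2)
      have h5 := hvδ (x := s) h2
      rw [← dist_eq_norm]
      linarith [dist_triangle_right (v r) (v s) (v t)]
    have b3 : ‖∫ r in t..s, (Φ r χ - G r)‖ ≤ ε / 3 * |s - t| := by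
      have h4 : ‖∫ r in t..s, (Φ r χ - G r)‖ ≤ |∫ r in t..s, C₃ * |s - t| * N r| := by
        refine intervalIntegral.norm_integral_le_abs_of_norm_le ?_ ((hlinN _ _).const_mul _)
        filter_upwards [ae_restrict_of_ae hΦ, ae_restrict_of_ae hΦs,
          ae_restrict_mem measurableSet_uIoc] with r hr hr' hr3
        rw [← norm_neg, neg_sub, hG, ← hr']
        refine (hr _).trans ?_
        have h5 := hC₃ (t - r) (by rw [abs_sub_comm]; exact (hst r hr3).trans h11)
        rw [show T - t + (t - r) = T - r by ring, abs_sub_comm] at h5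
        calc _ ≤ N r * (C₃ * |r - t|) := by gcongr; exact hN0 r
          _ ≤ N r * (C₃ * |s - t|) := mul_le_mul_of_nonneg_left
            (mul_le_mul_of_nonneg_left (hst r hr3) hC₃0) (hN0 r)
          _ = _ := by ring
      rw [intervalIntegral.integral_const_mul, abs_mul, abs_of_nonneg (by positivity)] at h4
      have h5 : |∫ r in t..s, N r| * (C₃ + 1) < ε / 3 := (lt_div_iff₀ (by positivity)).1 h3
      refine h4.trans ?_
      calc _ = (|∫ r in t..s, N r| * C₃) * |s - t| := by ring
        _ ≤ _ := by
          gcongr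
          nlinarith [abs_nonneg (∫ r in t..s, N r)]
    rw [smul_zero, sub_zero, hdecomp, Real.norm_eq_abs]
    refine (norm_add₃_le).trans ?_
    rw [norm_mul, norm_mul, norm_I, one_mul, one_mul]
    linarith
  have hconst := is_const_of_deriv_eq_zero (fun t ↦ (key t).differentiableAt)
    (fun t ↦ (key t).deriv) T 0
  simp only [hH, sub_self, propagator_zero, sub_zero, intervalIntegral.integral_same,
    mul_zero] at hconst
  linear_combination hconst

end duhamel
end Dispersive
end

/-! ### Slices of space-time functions and the solution formula -/
noncomputable section
namespace Dispersive
open Set Filter Topology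

/-! ### Hölder's inequality in extended norms. -/

section holder

variable {X : Type*} [MeasurableSpace X] {μ : Measure X} {p q : ℝ}

theorem eLpNorm_ofReal_eq (hp : 0 < p) (f : X → ℂ) :
    eLpNorm f (ENNReal.ofReal p) μ = (∫⁻ x, ‖f x‖ₑ ^ p ∂μ) ^ (1 / p) := by
  rw [eLpNorm_eq_lintegral_rpow_enorm_toReal (by simpa using hp) (by simp),
    ENNReal.toReal_ofReal hp.le]

theorem lintegral_enorm_mul_le (hpq : p.HolderConjugate q) {f g : X → ℂ}
    (hf : AEStronglyMeasurable f μ) (hg : AEStronglyMeasurable g μ) :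
    ∫⁻ x, ‖f x * g x‖ₑ ∂μ
      ≤ eLpNorm f (ENNReal.ofReal p) μ * eLpNorm g (ENNReal.ofReal q) μ := by
  rw [eLpNorm_ofReal_eq hpq.pos, eLpNorm_ofReal_eq hpq.symm.pos]
  simp only [enorm_mul]
  exact ENNReal.lintegral_mul_le_Lp_mul_Lq μ hpq hf.enorm hg.enorm

theorem enorm_integral_mul_le (hpq : p.HolderConjugate q) {f g : X → ℂ}
    (hf : AEStronglyMeasurable f μ) (hg : AEStronglyMeasurable g μ) :
    ‖∫ x, f x * g x ∂μ‖ₑ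
      ≤ eLpNorm f (ENNReal.ofReal p) μ * eLpNorm g (ENNReal.ofReal q) μ :=
  (enorm_integral_le_lintegral_enorm _).trans (lintegral_enorm_mul_le hpq hf hg)

theorem integrable_mul_of_memLp (hpq : p.HolderConjugate q) {f g : X → ℂ}
    (hf : MemLp f (ENNReal.ofReal p) μ) (hg : MemLp g (ENNReal.ofReal q) μ) :
    Integrable (fun x ↦ f x * g x) μ :=
  ⟨hf.1.mul hg.1, (lintegral_enorm_mul_le hpq hf.1 hg.1).trans_lt (ENNReal.mul_lt_top hf.2 hg.2)⟩

end holder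

/-! ### Norms of time slices. -/

section slice

variable {X : Type*} [MeasureSpace X] [SFinite (volume : Measure X)] {p q : ℝ}

/-- The norm of a space-time function at a fixed time. -/
def sliceNorm (p : ℝ) (f : ℝ × X → ℂ) (t : ℝ) : ℝ≥0∞ :=
  eLpNorm (fun x ↦ f (t, x)) (ENNReal.ofReal p)

theorem aemeasurable_sliceNorm (hp : 0 < p) {f : ℝ × X → ℂ} (hf : AEStronglyMeasurable f) :
    AEMeasurable (sliceNorm p f) := by
  have h1 : sliceNorm p f = fun t ↦ (∫⁻ x, ‖f (t, x)‖ₑ ^ p) ^ (1 / p) :=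
    funext fun t ↦ eLpNorm_ofReal_eq hp _
  rw [h1]
  have h2 : AEMeasurable (fun z ↦ ‖f z‖ₑ ^ p) ((volume : Measure ℝ).prod (volume : Measure X)) :=
    hf.enorm.pow_const p
  exact h2.lintegral_prod_right'.pow_const _

theorem lintegral_sliceNorm_rpow (hp : 0 < p) {f : ℝ × X → ℂ} (hf : AEStronglyMeasurable f) :
    (∫⁻ t, sliceNorm p f t ^ p) ^ (1 / p) = eLpNorm f (ENNReal.ofReal p) := by
  rw [eLpNorm_ofReal_eq hp, Measure.volume_eq_prod, lintegral_prod _ (hf.enorm.pow_const p)]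
  congr 2
  ext t
  rw [sliceNorm, eLpNorm_ofReal_eq hp, ← ENNReal.rpow_mul, one_div_mul_cancel hp.ne',
    ENNReal.rpow_one]

theorem lintegral_sliceNorm_rpow_lt_top (hp : 0 < p) {f : ℝ × X → ℂ}
    (hf : MemLp f (ENNReal.ofReal p)) : ∫⁻ t, sliceNorm p f t ^ p < ⊤ := by
  have h := hf.2
  rw [← lintegral_sliceNorm_rpow hp hf.1] at h
  by_contra hc
  rw [not_lt, top_le_iff] at hc
  rw [hc, ENNReal.top_rpow_of_pos (by positivity)] at h
  exact lt_irrefl _ h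

theorem ae_memLp_slice (hp : 0 < p) {f : ℝ × X → ℂ} (hf : MemLp f (ENNReal.ofReal p)) :
    ∀ᵐ t, MemLp (fun x ↦ f (t, x)) (ENNReal.ofReal p) := by
  have hf1 : AEStronglyMeasurable f ((volume : Measure ℝ).prod (volume : Measure X)) := hf.1
  have h1 := ae_lt_top' ((aemeasurable_sliceNorm hp hf.1).pow_const p)
    (lintegral_sliceNorm_rpow_lt_top hp hf).ne
  filter_upwards [hf1.prodMk_left, h1] with t ht1 ht2
  exact ⟨ht1, (ENNReal.rpow_lt_top_iff_of_pos hp).1 ht2⟩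

theorem locallyIntegrable_sliceNorm (hp : 1 ≤ p) {f : ℝ × X → ℂ}
    (hf : MemLp f (ENNReal.ofReal p)) :
    LocallyIntegrable fun t ↦ (sliceNorm p f t).toReal := by
  have hp0 : 0 < p := by linarith
  have h1 : MemLp (fun t ↦ (sliceNorm p f t).toReal) (ENNReal.ofReal p) := by
    refine ⟨(aemeasurable_sliceNorm hp0 hf.1).ennreal_toReal.aestronglyMeasurable, ?_⟩
    rw [eLpNorm_eq_lintegral_rpow_enorm_toReal (by simpa using hp0) (by simp),
      ENNReal.toReal_ofReal hp0.le]
    refine ENNReal.rpow_lt_top_of_nonneg (by positivity) (ne_of_lt ?_)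
    refine (lintegral_mono fun t ↦ ?_).trans_lt (lintegral_sliceNorm_rpow_lt_top hp0 hf)
    gcongr
    rw [Real.enorm_of_nonneg ENNReal.toReal_nonneg]
    exact ENNReal.ofReal_toReal_le
  exact h1.locallyIntegrable (by simpa using hp)

end slice

/-! ### Pairing time slices with Schwartz functions. -/

section formula

variable {E : Type*} [NormedAddCommGroup E] [InnerProductSpace ℝ E] [FiniteDimensional ℝ E]
  [MeasurableSpace E] [BorelSpace E] {p q : ℝ}

/-- The pairing of a space-time function at time `t` with a Schwartz function. -/
def slicePairing (f : ℝ × E → ℂ) (t : ℝ) (ψ : 𝓢(E, ℂ)) : ℂ := ∫ x, f (t, x) * ψ x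

theorem aestronglyMeasurable_integral_slice {f : ℝ × E → ℂ} (hf : AEStronglyMeasurable f)
    {θ : ℝ × E → ℂ} (hθ : Continuous θ) :
    AEStronglyMeasurable fun t ↦ ∫ x, f (t, x) * θ (t, x) := by
  have : AEStronglyMeasurable (fun z ↦ f z * θ z)
      ((volume : Measure ℝ).prod (volume : Measure E)) := hf.mul hθ.aestronglyMeasurable
  exact this.integral_prod_right'

theorem aestronglyMeasurable_slicePairing {f : ℝ × E → ℂ} (hf : AEStronglyMeasurable f)
    (χ : 𝓢(E, ℂ)) : AEStronglyMeasurable fun r ↦ slicePairing f r χ :=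
  aestronglyMeasurable_integral_slice hf (χ.continuous.comp continuous_snd)

theorem aestronglyMeasurable_slicePairing_propagator {f : ℝ × E → ℂ}
    (hf : AEStronglyMeasurable f) {b : E → ℝ} (hb : b.HasTemperateGrowth) (T : ℝ) (ψ : 𝓢(E, ℂ)) :
    AEStronglyMeasurable fun r ↦ slicePairing f r (propagator b (T - r) ψ) := by
  have hc : Continuous fun z : ℝ × E ↦ propagator b (T - z.1) ψ z.2 :=
    Continuous.comp (g := fun z : ℝ × E ↦ propagator b z.1 ψ z.2)
      (continuous_propagator_uncurry hb ψ)
      (f := fun z : ℝ × E ↦ (T - z.1, z.2)) (by fun_prop)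
  exact aestronglyMeasurable_integral_slice hf hc

/-- The exceptional set of times depends only on whether the slice of `f` lies in `L^p`, so it
serves all `ψ` simultaneously. The argument of Duhamel's formula varies with time, which makes this
order of quantifiers essential. -/
theorem enorm_slicePairing_le (hpq : p.HolderConjugate q) {f : ℝ × E → ℂ}
    (hf : MemLp f (ENNReal.ofReal p)) : ∀ᵐ t, ∀ ψ : 𝓢(E, ℂ),
      ‖slicePairing f t ψ‖ₑ ≤ sliceNorm p f t * eLpNorm ψ (ENNReal.ofReal q) volume := by
  filter_upwards [ae_memLp_slice hpq.pos hf] with t ht ψ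
  exact enorm_integral_mul_le hpq ht.1 ψ.continuous.aestronglyMeasurable

theorem norm_slicePairing_le_toReal (hpq : p.HolderConjugate q) {f : ℝ × E → ℂ}
    (hf : MemLp f (ENNReal.ofReal p)) : ∀ᵐ t, ∀ ψ : 𝓢(E, ℂ),
      ‖slicePairing f t ψ‖ ≤
        (sliceNorm p f t).toReal * (eLpNorm ψ (ENNReal.ofReal q) volume).toReal := by
  filter_upwards [enorm_slicePairing_le hpq hf, ae_memLp_slice hpq.pos hf] with t ht ht2 ψ
  have h3 : eLpNorm ψ (ENNReal.ofReal q) volume < ⊤ := ψ.eLpNorm_lt_top (μ := volume) _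
  rw [← ENNReal.toReal_mul, ← toReal_enorm]
  exact ENNReal.toReal_mono (ENNReal.mul_lt_top ht2.2 h3).ne (ht ψ)

theorem norm_slicePairing_le (hpq : p.HolderConjugate q) [Fact (1 ≤ ENNReal.ofReal q)]
    {f : ℝ × E → ℂ} (hf : MemLp f (ENNReal.ofReal p)) : ∀ᵐ t, ∀ ψ : 𝓢(E, ℂ),
      ‖slicePairing f t ψ‖ ≤ (sliceNorm p f t).toReal * lpSeminorm (ENNReal.ofReal q) ψ := by
  simp only [lpSeminorm_eq_toReal]
  exact norm_slicePairing_le_toReal hpq hf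

theorem locallyIntegrable_slicePairing (hpq : p.HolderConjugate q) {f : ℝ × E → ℂ}
    (hf : MemLp f (ENNReal.ofReal p)) (χ : 𝓢(E, ℂ)) :
    LocallyIntegrable fun r ↦ slicePairing f r χ := by
  refine ((locallyIntegrable_sliceNorm hpq.lt.le hf).smul
    (eLpNorm χ (ENNReal.ofReal q) volume).toReal).mono
    (aestronglyMeasurable_slicePairing hf.1 χ) ?_
  filter_upwards [norm_slicePairing_le_toReal hpq hf] with r hr
  refine (hr χ).trans (le_of_eq_of_le (mul_comm _ _) (le_abs_self _))

theorem slicePairing_sub (hpq : p.HolderConjugate q) {f : ℝ × E → ℂ}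
    (hf : MemLp f (ENNReal.ofReal p)) : ∀ᵐ t, ∀ ψ χ : 𝓢(E, ℂ),
      slicePairing f t (ψ - χ) = slicePairing f t ψ - slicePairing f t χ := by
  filter_upwards [ae_memLp_slice hpq.pos hf] with t ht ψ χ
  rw [slicePairing, slicePairing, slicePairing, ← integral_sub
    (integrable_mul_of_memLp hpq ht (ψ.memLp _)) (integrable_mul_of_memLp hpq ht (χ.memLp _))]
  simp only [sub_apply, mul_sub]

theorem memLp_tensor {r : ℝ} (hr : 0 < r) {η : ℝ → ℂ} (hη : Continuous η)
    (hηc : HasCompactSupport η) (ψ : 𝓢(E, ℂ)) :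
    MemLp (fun z : ℝ × E ↦ η z.1 * ψ z.2) (ENNReal.ofReal r) := by
  have hc : Continuous fun z : ℝ × E ↦ η z.1 * ψ z.2 := by
    have := ψ.continuous
    fun_prop
  rw [← integrable_norm_rpow_iff hc.aestronglyMeasurable (by simpa using hr) (by simp),
    ENNReal.toReal_ofReal hr.le]
  have h1 : Integrable fun t ↦ ‖η t‖ ^ r := by
    refine Continuous.integrable_of_hasCompactSupport
      (hη.norm.rpow_const fun _ ↦ Or.inr hr.le) ?_
    exact hηc.comp_left (g := fun z ↦ ‖z‖ ^ r) (by simp [hr.ne'])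
  have := h1.mul_prod (integrable_norm_rpow_schwartz ψ hr)
  refine this.congr (Eventually.of_forall fun z ↦ ?_)
  simp only [norm_mul]
  rw [Real.mul_rpow (norm_nonneg _) (norm_nonneg _)]

theorem integral_mul_tensor (hpq : p.HolderConjugate q) {f : ℝ × E → ℂ}
    (hf : MemLp f (ENNReal.ofReal p)) {η : ℝ → ℂ} (hη : Continuous η)
    (hηc : HasCompactSupport η) (ψ : 𝓢(E, ℂ)) :
    ∫ z : ℝ × E, f z * (η z.1 * ψ z.2) = ∫ t, slicePairing f t ψ * η t := by
  have h1 := integrable_mul_of_memLp hpq hf (memLp_tensor hpq.symm.pos hη hηc ψ)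
  rw [Measure.volume_eq_prod] at h1 ⊢
  rw [integral_prod _ h1]
  congr with t
  rw [slicePairing, ← integral_mul_const]
  congr with x
  ring

end formula

/-! ### Weak solutions satisfy the integrated equation and Duhamel's formula. -/

section solution

variable {n : ℕ} {a : Fin n → ℝ} {k : Fin n → ℕ} {φ : Space n → ℂ} {f : ℝ × Space n → ℂ}
  {u : ℝ → 𝓢'(Space n, ℂ)} {p q : ℝ}

/-- Tested against a fixed `χ`, the equation says that `t ↦ u_t(χ)` has weak derivative `i u_t(b(D)
χ) + i ⟨f_t, χ⟩`, where `b` is the transposed symbol; this is locally integrable. -/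
theorem IsSolution.sub_eq_integral (hu : IsSolution a k φ f u) (hpq : p.HolderConjugate q)
    (hf : MemLp f (ENNReal.ofReal p)) (χ : 𝓢(Space n, ℂ)) (s t : ℝ) (hst : s ≤ t) :
    u t χ - u s χ = ∫ r in s..t, (I * u r (realMultiplier (dispersionSymbol a k) χ) +
      I * slicePairing f r χ) := by
  have hv := continuous_eval_distribution hu.continuous (realMultiplier (dispersionSymbol a k) χ)
  have hw := continuous_eval_distribution hu.continuous χ
  have hF := locallyIntegrable_slicePairing hpq hf χ
  refine sub_eq_integral_of_weak_deriv hw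
    ((hv.locallyIntegrable.smul I).add (hF.smul I)) (fun η hη hηc ↦ ?_) hst
  have key := hu.equation η χ hη hηc
  rw [integral_mul_tensor hpq hf hη.continuous hηc] at key
  simp only [symbolD_apply] at key
  have i1 : Integrable fun r ↦ u r (realMultiplier (dispersionSymbol a k) χ) * η r :=
    (hv.mul hη.continuous).integrable_of_hasCompactSupport hηc.mul_left
  have i2 : Integrable fun r ↦ slicePairing f r χ * η r :=
    hF.integrable_smul_right_of_hasCompactSupport hη.continuous hηc
  have e1 : ∫ r, (I * u r (realMultiplier (dispersionSymbol a k) χ) +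
      I * slicePairing f r χ) * η r = I * (∫ r, u r (realMultiplier (dispersionSymbol a k) χ) * η r)
      + I * ∫ r, slicePairing f r χ * η r := by
    rw [← integral_const_mul, ← integral_const_mul, ← integral_add (i1.const_mul I)
      (i2.const_mul I)]
    congr with r
    ring
  have e2 : ∫ r, u r χ * (-I * deriv η r) = -I * ∫ r, u r χ * deriv η r := by
    rw [← integral_const_mul]
    congr with r
    ring
  rw [e2] at key
  change _ = -∫ r, (I * u r (realMultiplier (dispersionSymbol a k) χ) +
      I * slicePairing f r χ) * η r
  rw [e1]
  linear_combination (-I) * key + (∫ r, u r χ * deriv η r) * I_sq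

/-- Duhamel's formula for weak solutions. -/
theorem IsSolution.duhamel (hu : IsSolution a k φ f u) (hpq : p.HolderConjugate q)
    (hf : MemLp f (ENNReal.ofReal p)) (T : ℝ) (ψ : 𝓢(Space n, ℂ)) :
    u T ψ = (∫ x, φ x * propagator (dispersionSymbol a k) T ψ x) +
      I * ∫ r in (0)..T, slicePairing f r (propagator (dispersionSymbol a k) (T - r) ψ) := by
  have : Fact (1 ≤ ENNReal.ofReal q) := ⟨by simpa using hpq.symm.lt.le⟩
  have hb := hasTemperateGrowth_dispersionSymbol a k
  have h0 := (hu.initial (propagator (dispersionSymbol a k) T ψ)).2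
  rw [← h0]
  exact duhamel_formula hu.continuous hb (Φ := slicePairing f)
    (locallyIntegrable_sliceNorm hpq.lt.le hf)
    (fun _ ↦ ENNReal.toReal_nonneg) (continuous_lpSeminorm (ENNReal.ofReal q))
    (norm_slicePairing_le hpq hf) (slicePairing_sub hpq hf)
    (aestronglyMeasurable_slicePairing hf.1) (hu.sub_eq_integral hpq hf) T ψ
    (aestronglyMeasurable_slicePairing_propagator hf.1 hb T ψ)

end solution
end Dispersive
end

/-! ### Space-time estimates by duality -/
noncomputable section
namespace Dispersive
open Set Filter Topology

section tensorSum

variable {E : Type*} [NormedAddCommGroup E] [NormedSpace ℝ E] {ι : Type*} {s : Finset ι}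
  {η : ι → ℝ → ℂ} {ψ : ι → 𝓢(E, ℂ)}

/-- The space-time function `∑ i, η_i(t) ψ_i(x)` at a fixed time. -/
def tensorSum (s : Finset ι) (η : ι → ℝ → ℂ) (ψ : ι → 𝓢(E, ℂ)) (t : ℝ) : 𝓢(E, ℂ) :=
  ∑ i ∈ s, η i t • ψ i

theorem tensorSum_apply (t : ℝ) (x : E) : tensorSum s η ψ t x = ∑ i ∈ s, η i t * ψ i x := by
  simp [tensorSum, sum_apply, smul_apply]

theorem map_tensorSum {F : Type*} [AddCommGroup F] [Module ℂ F] [TopologicalSpace F]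
    (L : 𝓢(E, ℂ) →L[ℂ] F) (t : ℝ) : L (tensorSum s η ψ t) = ∑ i ∈ s, η i t • L (ψ i) := by
  simp only [tensorSum, map_sum, map_smul]

theorem continuous_tensorSum (hη : ∀ i ∈ s, Continuous (η i)) :
    Continuous fun z : ℝ × E ↦ tensorSum s η ψ z.1 z.2 := by
  simp only [tensorSum_apply]
  refine continuous_finsetSum _ fun i hi ↦ ?_
  have h1 := hη i hi
  have h2 := (ψ i).continuous
  fun_prop

end tensorSum

section bounds

variable {E : Type*} [NormedAddCommGroup E] [InnerProductSpace ℝ E] [FiniteDimensional ℝ E]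
  [MeasurableSpace E] [BorelSpace E] {b : E → ℝ} {p q α : ℝ} {C : ℝ≥0}

/-- The propagator with symbol `b` maps `L^p` to `L^q` with decay `|r| ^ (-α)`. -/
def HasDecay (b : E → ℝ) (p q α : ℝ) (C : ℝ≥0) : Prop :=
  ∀ r ≠ 0, ∀ ψ : 𝓢(E, ℂ), eLpNorm (propagator b r ψ) (ENNReal.ofReal q) volume
    ≤ C * rieszKernel α r * eLpNorm ψ (ENNReal.ofReal p) volume

/-- Hölder in space followed by the decay estimate; the single time `r = T`, where no decay is
available, is a null set. -/
theorem lintegral_slicePairing_propagator_le (hd : HasDecay b p q α C) (hpq : p.HolderConjugate q)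
    {f : ℝ × E → ℂ} (hf : MemLp f (ENNReal.ofReal p)) (T : ℝ) (ψ : 𝓢(E, ℂ)) :
    ∫⁻ r, ‖slicePairing f r (propagator b (T - r) ψ)‖ₑ
      ≤ C * ∫⁻ r, rieszKernel α (T - r) * sliceNorm p f r *
          eLpNorm ψ (ENNReal.ofReal p) volume := by
  rw [← lintegral_const_mul' _ _ ENNReal.coe_ne_top]
  refine lintegral_mono_ae ?_
  have hT : ∀ᵐ r : ℝ, r ≠ T := by
    simpa using measure_eq_zero_iff_ae_notMem.1 (measure_singleton (μ := volume) T)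
  filter_upwards [enorm_slicePairing_le hpq hf, hT] with r hr hrT
  calc _ ≤ sliceNorm p f r * (C * rieszKernel α (T - r) * eLpNorm ψ (ENNReal.ofReal p) volume) :=
        (hr _).trans (mul_le_mul_right (hd _ (sub_ne_zero.2 hrT.symm) ψ) _)
    _ = _ := by ring

variable {ι : Type*} {s : Finset ι} {η : ι → ℝ → ℂ} {ψ : ι → 𝓢(E, ℂ)}

theorem integrable_toLp_propagator_tensorSum (hb : b.HasTemperateGrowth)
    (hη : ∀ i ∈ s, Continuous (η i)) (hηc : ∀ i ∈ s, HasCompactSupport (η i)) :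
    Integrable fun t ↦ (propagator b t (tensorSum s η ψ t)).toLp 2 (volume : Measure E) := by
  have h1 : ∀ t, (propagator b t (tensorSum s η ψ t)).toLp 2 (volume : Measure E) =
      ∑ i ∈ s, η i t • (propagator b t (ψ i)).toLp 2 (volume : Measure E) := by
    intro t
    exact map_tensorSum ((SchwartzMap.toLpCLM ℂ ℂ 2 (volume : Measure E)).comp (propagator b t)) t
  simp only [h1]
  refine integrable_finsetSum _ fun i hi ↦ ?_
  have hc : Continuous fun t ↦ (propagator b t (ψ i)).toLp 2 (volume : Measure E) :=
    (SchwartzMap.toLpCLM ℂ ℂ 2 (volume : Measure E)).continuous.comp (continuous_propagator hb _)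
  exact ((hη i hi).smul hc).integrable_of_hasCompactSupport (hηc i hi).smul_right

/-- The `TT*` argument: the dual homogeneous estimate. -/
theorem enorm_integral_toLp_propagator_le (hd : HasDecay b p q α C) (hb : b.HasTemperateGrowth)
    (hpq : p.HolderConjugate q) (hα0 : 0 < α) (hα1 : α < 1) (hp : p = 2 / (2 - α))
    (hη : ∀ i ∈ s, Continuous (η i)) (hηc : ∀ i ∈ s, HasCompactSupport (η i)) :
    ‖∫ t, (propagator b t (tensorSum s η ψ t)).toLp 2 (volume : Measure E)‖ₑ
      ≤ (C * hlsConst α + 1) *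
        eLpNorm (fun z : ℝ × E ↦ tensorSum s η ψ z.1 z.2) (ENNReal.ofReal p) := by
  have hint := integrable_toLp_propagator_tensorSum (ψ := ψ) hb hη hηc
  set g := tensorSum s η ψ with hg
  set Φ := fun t ↦ (propagator b t (g t)).toLp 2 (volume : Measure E) with hΦ
  set V := ∫ t, Φ t with hV
  have hG := continuous_tensorSum (ψ := ψ) hη
  set N := sliceNorm p (fun z : ℝ × E ↦ g z.1 z.2) with hN
  have hNm : AEMeasurable N := aemeasurable_sliceNorm hpq.pos hG.aestronglyMeasurable
  set M := eLpNorm (fun z : ℝ × E ↦ g z.1 z.2) (ENNReal.ofReal p) with hM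
  have hNM : (∫⁻ t, N t ^ p) ^ (1 / p) = M :=
    lintegral_sliceNorm_rpow hpq.pos hG.aestronglyMeasurable
  -- Unitarity moves both propagators onto `g_r` as `S_{r-t}`; Hölder and decay then produce the
  -- Riesz kernel.
  have hpair : ∀ t r, r ≠ t → ‖inner ℂ (Φ t) (Φ r)‖ₑ ≤ C * (rieszKernel α (t - r) * N r * N t) := by
    intro t r hrt
    rw [hΦ, inner_toLp_propagator hb]
    refine (enorm_integral_mul_le hpq
      (f := fun x ↦ (starRingEnd ℂ) (g t x)) (g := fun x ↦ propagator b (r - t) (g r) x)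
      (continuous_conj.comp (g t).continuous).aestronglyMeasurable
      (SchwartzMap.continuous _).aestronglyMeasurable).trans ?_
    have h1 : eLpNorm (fun x ↦ (starRingEnd ℂ) (g t x)) (ENNReal.ofReal p) volume = N t :=
      eLpNorm_congr_norm_ae (Eventually.of_forall fun x ↦ RCLike.norm_conj _)
    have h2 := hd _ (sub_ne_zero.2 hrt) (g r)
    rw [rieszKernel_sub_comm] at h2
    rw [h1]
    calc _ ≤ N t * (C * rieszKernel α (t - r) * N r) := mul_le_mul_right h2 _
      _ = _ := by ring
  have hVV : ‖V‖ₑ ^ 2 ≤ C * rieszForm α N N := by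
    have h1 : ‖V‖ₑ ^ 2 = ‖inner ℂ V V‖ₑ := by
      rw [inner_self_eq_norm_sq_to_K, enorm_pow]
      congr 1
      rw [← ofReal_norm, ← ofReal_norm]
      simp
    rw [h1]
    nth_rewrite 2 [hV]
    rw [← integral_inner hint]
    refine (enorm_integral_le_lintegral_enorm _).trans ?_
    rw [rieszForm, ← lintegral_const_mul' _ _ ENNReal.coe_ne_top]
    refine lintegral_mono fun t ↦ ?_
    rw [← lintegral_const_mul' _ _ ENNReal.coe_ne_top]
    have h2 : ‖inner ℂ V (Φ t)‖ₑ = ‖∫ r, inner ℂ (Φ t) (Φ r)‖ₑ := by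
      rw [integral_inner hint, ← inner_conj_symm, ← ofReal_norm, ← ofReal_norm, RCLike.norm_conj]
    rw [h2]
    refine (enorm_integral_le_lintegral_enorm _).trans (lintegral_mono_ae ?_)
    have hT : ∀ᵐ r : ℝ, r ≠ t := by
      simpa using measure_eq_zero_iff_ae_notMem.1 (measure_singleton (μ := volume) t)
    filter_upwards [hT] with r hr
    exact hpair t r hr
  have hHLS := rieszForm_le hα0 hα1 hp hNm hNm
  rw [hNM] at hHLS
  set D : ℝ≥0∞ := C * hlsConst α with hD
  -- The square root of the constant is avoided through `D ≤ (D + 1)²`; hence the `+ 1` in the final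
  -- bound.
  have hfin : ‖V‖ₑ ^ 2 ≤ ((D + 1) * M) ^ 2 := by
    calc ‖V‖ₑ ^ 2 ≤ C * (hlsConst α * (M * M)) := hVV.trans (mul_le_mul_right hHLS _)
      _ = D * M ^ 2 := by rw [hD]; ring
      _ ≤ (D + 1) ^ 2 * M ^ 2 := by
        refine mul_le_mul_left ?_ _
        calc D ≤ D ^ 2 + D + D + 1 := by
              rw [add_assoc, add_assoc]
              exact le_add_self.trans' le_self_add
          _ = (D + 1) ^ 2 := by ring
      _ = _ := by ring
  exact (ENNReal.pow_right_strictMono two_ne_zero).le_iff_le.1 hfin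

theorem integral_mul_eq_inner {φ : E → ℂ} (hφ : MemLp φ 2) (h : 𝓢(E, ℂ)) :
    ∫ x, φ x * h x = inner ℂ (hφ.star.toLp (star φ)) (h.toLp 2 (volume : Measure E)) := by
  rw [L2.inner_def]
  refine integral_congr_ae ?_
  filter_upwards [hφ.star.coeFn_toLp, h.coeFn_toLp 2 (volume : Measure E)] with x h1 h2
  rw [h1, h2, RCLike.inner_apply]
  simp [mul_comm]

end bounds

section solution

variable {n : ℕ} {a : Fin n → ℝ} {k : Fin n → ℕ} {φ : Space n → ℂ} {f : ℝ × Space n → ℂ}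
  {u : ℝ → 𝓢'(Space n, ℂ)} {p q α : ℝ} {C : ℝ≥0} {ι : Type*} {s : Finset ι} {η : ι → ℝ → ℂ}
  {ψ : ι → 𝓢(Space n, ℂ)}

theorem integrable_eval_tensorSum (hu : Continuous u)
    (hη : ∀ i ∈ s, Continuous (η i)) (hηc : ∀ i ∈ s, HasCompactSupport (η i)) :
    Integrable fun t ↦ u t (tensorSum s η ψ t) := by
  have h1 : ∀ t, u t (tensorSum s η ψ t) = ∑ i ∈ s, η i t * u t (ψ i) := fun t ↦ by
    simp only [tensorSum, map_sum, map_smul, smul_eq_mul]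
  simp only [h1]
  refine integrable_finsetSum _ fun i hi ↦ ?_
  exact ((hη i hi).mul (continuous_eval_distribution hu _)).integrable_of_hasCompactSupport
    (hηc i hi).mul_right

/-- By Duhamel the pairing splits. The homogeneous part is an inner product of `conj φ` with `∫ S_t
g_t dt`, to which `TT*` applies. In the Duhamel part absolute values are taken before integrating,
so the restriction to times between 0 and `t` is simply dropped and Hardy–Littlewood–Sobolev applies
on the whole line. -/
theorem IsSolution.enorm_integral_tensorSum_le (hu : IsSolution a k φ f u)
    (hd : HasDecay (dispersionSymbol a k) p q α C) (hpq : p.HolderConjugate q)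
    (hα0 : 0 < α) (hα1 : α < 1) (hp : p = 2 / (2 - α)) (hφ : MemLp φ 2)
    (hf : MemLp f (ENNReal.ofReal p))
    (hη : ∀ i ∈ s, Continuous (η i)) (hηc : ∀ i ∈ s, HasCompactSupport (η i)) :
    ‖∫ t, u t (tensorSum s η ψ t)‖ₑ ≤ (C * hlsConst α + 1) *
      (eLpNorm φ 2 + eLpNorm f (ENNReal.ofReal p)) *
        eLpNorm (fun z : ℝ × Space n ↦ tensorSum s η ψ z.1 z.2) (ENNReal.ofReal p) := by
  have hb := hasTemperateGrowth_dispersionSymbol a k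
  set b := dispersionSymbol a k with hbd
  have hint := integrable_toLp_propagator_tensorSum (ψ := ψ) hb hη hηc
  have hhom := enorm_integral_toLp_propagator_le (ψ := ψ) hd hb hpq hα0 hα1 hp hη hηc
  have hui := integrable_eval_tensorSum (ψ := ψ) hu.continuous hη hηc
  have hG := continuous_tensorSum (ψ := ψ) hη
  set g := tensorSum s η ψ with hg
  set M := eLpNorm (fun z : ℝ × Space n ↦ g z.1 z.2) (ENNReal.ofReal p) with hM
  set A : ℝ → ℂ := fun t ↦ ∫ x, φ x * propagator b t (g t) x with hA
  set B : ℝ → ℂ := fun t ↦ ∫ r in (0)..t, slicePairing f r (propagator b (t - r) (g t)) with hB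
  have hAe : A = fun t ↦ inner ℂ (hφ.star.toLp (star φ))
      ((propagator b t (g t)).toLp 2 (volume : Measure (Space n))) :=
    funext fun t ↦ integral_mul_eq_inner hφ _
  have hAi : Integrable A := by
    rw [hAe]
    exact hint.const_inner _
  have hdec : ∀ t, u t (g t) = A t + I * B t := fun t ↦ hu.duhamel hpq hf t (g t)
  -- Integrability of the Duhamel part in `t` is obtained by difference, which avoids a separate
  -- measurability argument for it.
  have hBi : Integrable fun t ↦ I * B t :=
    (hui.sub hAi).congr (Eventually.of_forall fun t ↦ by simp [hdec])
  have hA2 : ‖∫ t, A t‖ₑ ≤ eLpNorm φ 2 * ((C * hlsConst α + 1) * M) := by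
    rw [hAe, integral_inner hint]
    refine le_trans ?_ (mul_le_mul_right hhom _)
    have h1 : ‖hφ.star.toLp (star φ)‖ₑ = eLpNorm φ 2 := by
      rw [Lp.enorm_def, eLpNorm_congr_ae hφ.star.coeFn_toLp]
      exact eLpNorm_congr_norm_ae (Eventually.of_forall fun x ↦ by simp)
    rw [← h1, ← ofReal_norm, ← ofReal_norm, ← ofReal_norm, ← ENNReal.ofReal_mul (norm_nonneg _)]
    exact ENNReal.ofReal_le_ofReal (norm_inner_le_norm _ _)
  have hB2 : ‖∫ t, I * B t‖ₑ ≤ C * hlsConst α * eLpNorm f (ENNReal.ofReal p) * M := by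
    have hHLS := rieszForm_le hα0 hα1 hp (aemeasurable_sliceNorm hpq.pos hf.1)
      (aemeasurable_sliceNorm hpq.pos hG.aestronglyMeasurable)
    rw [lintegral_sliceNorm_rpow hpq.pos hf.1,
      lintegral_sliceNorm_rpow hpq.pos hG.aestronglyMeasurable] at hHLS
    refine (enorm_integral_le_lintegral_enorm _).trans ?_
    calc _ ≤ ∫⁻ t, C * ∫⁻ r, rieszKernel α (t - r) * sliceNorm p f r *
          eLpNorm (g t) (ENNReal.ofReal p) volume := by
          refine lintegral_mono fun t ↦ ?_
          refine le_trans ?_ (lintegral_slicePairing_propagator_le hd hpq hf t (g t))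
          rw [enorm_mul, ← ofReal_norm I, norm_I, ENNReal.ofReal_one, one_mul, hB,
            ← ofReal_norm, intervalIntegral.norm_intervalIntegral_eq, ofReal_norm]
          exact (enorm_integral_le_lintegral_enorm _).trans (setLIntegral_le_lintegral _ _)
      _ = C * rieszForm α (sliceNorm p f) (sliceNorm p fun z : ℝ × Space n ↦ g z.1 z.2) := by
          rw [rieszForm, lintegral_const_mul' _ _ ENNReal.coe_ne_top]
          rfl
      _ ≤ C * _ := mul_le_mul_right hHLS _
      _ = _ := by ring
  simp only [hdec]
  rw [integral_add hAi hBi]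
  refine (enorm_add_le _ _).trans ((add_le_add hA2 hB2).trans ?_)
  calc _ ≤ eLpNorm φ 2 * ((C * hlsConst α + 1) * M) +
        (C * hlsConst α + 1) * eLpNorm f (ENNReal.ofReal p) * M := by
        gcongr
        exact le_self_add
    _ = _ := by ring

end solution
end Dispersive
end

/-! ### Representation of solutions by functions -/
noncomputable section
namespace Dispersive
open Set Filter Topology

/-- A linear functional dominated by `‖V ·‖` factors through a bounded functional. -/
theorem exists_functional_of_bound {W F : Type*} [AddCommGroup W] [Module ℂ W]
    [NormedAddCommGroup F] [NormedSpace ℂ F] (V : W →ₗ[ℂ] F) (Λ : W →ₗ[ℂ] ℂ) {K : ℝ} (hK : 0 ≤ K)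
    (h : ∀ c, ‖Λ c‖ ≤ K * ‖V c‖) :
    ∃ L : F →L[ℂ] ℂ, ‖L‖ ≤ K ∧ ∀ c, L (V c) = Λ c := by
  -- A linear section of `V` onto its range carries `Λ` there; the bound implies that `Λ` vanishes
  -- on the kernel of `V`, so the choice of section does not matter. Hahn–Banach then extends the
  -- functional.
  obtain ⟨g, hg⟩ := V.rangeRestrict.exists_rightInverse_of_surjective V.range_rangeRestrict
  have hVg : ∀ y : LinearMap.range V, V (g y) = y := fun y ↦
    congrArg Subtype.val (LinearMap.congr_fun hg y)
  set L₀ : LinearMap.range V →L[ℂ] ℂ := (Λ ∘ₗ g).mkContinuous K fun y ↦ by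
    have := h (g y)
    rwa [hVg] at this with hL₀
  obtain ⟨L, hL, hLn⟩ := exists_extension_norm_eq (LinearMap.range V) L₀
  refine ⟨L, hLn.trans_le (LinearMap.mkContinuous_norm_le _ hK _), fun c ↦ ?_⟩
  have h1 := hL (V.rangeRestrict c)
  have h2 : ‖Λ (g (V.rangeRestrict c) - c)‖ ≤ 0 := by
    refine (h _).trans_eq ?_
    rw [map_sub, hVg]
    simp
  rw [norm_le_zero_iff, map_sub, sub_eq_zero] at h2
  exact h1.trans h2

section dense

variable {E : Type*} [NormedAddCommGroup E] [InnerProductSpace ℝ E] [FiniteDimensional ℝ E]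
  [MeasurableSpace E] [BorelSpace E]

/-- Schwartz functions are separable for the norm of `L^p ∩ L^r`. -/
theorem exists_countable_dense_schwartz (p r : ℝ≥0∞) [Fact (1 ≤ p)] [Fact (1 ≤ r)]
    [Fact (p ≠ ⊤)] [Fact (r ≠ ⊤)] :
    ∃ D : Set 𝓢(E, ℂ), D.Countable ∧ ∀ ψ : 𝓢(E, ℂ), ∀ ε > 0, ∃ χ ∈ D,
      eLpNorm (ψ - χ : 𝓢(E, ℂ)) p volume ≤ ENNReal.ofReal ε ∧
      eLpNorm (ψ - χ : 𝓢(E, ℂ)) r volume ≤ ENNReal.ofReal ε := by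
  set J : 𝓢(E, ℂ) → Lp ℂ p (volume : Measure E) × Lp ℂ r (volume : Measure E) :=
    fun ψ ↦ (ψ.toLp p, ψ.toLp r) with hJ
  -- Separability of `L^p × L^r` passes to the image of the Schwartz space under the diagonal map.
  obtain ⟨S, hSc, hSd⟩ := TopologicalSpace.exists_countable_dense (range J)
  choose ρ hρ using fun y : range J ↦ y.2
  refine ⟨ρ '' S, hSc.image ρ, fun ψ ε hε ↦ ?_⟩
  obtain ⟨y, hy, hyS⟩ := Metric.dense_iff.1 hSd ⟨J ψ, ψ, rfl⟩ ε hε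
  refine ⟨ρ y, mem_image_of_mem _ hyS, ?_⟩
  have h1 : dist (J (ρ y)) (J ψ) < ε := by
    rw [hρ y]
    exact hy
  rw [Prod.dist_eq, max_lt_iff, dist_comm, dist_comm (J (ρ y)).2] at h1
  have key : ∀ (P : ℝ≥0∞) [Fact (1 ≤ P)],
      dist (ψ.toLp P (volume : Measure E)) ((ρ y).toLp P (volume : Measure E)) < ε →
      eLpNorm (ψ - ρ y : 𝓢(E, ℂ)) P volume ≤ ENNReal.ofReal ε := by
    intro P _ h
    have h2 : ψ.toLp P (volume : Measure E) - (ρ y).toLp P (volume : Measure E)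
        = (ψ - ρ y).toLp P (volume : Measure E) :=
      (map_sub (SchwartzMap.toLpCLM ℂ ℂ P (volume : Measure E)) ψ (ρ y)).symm
    rw [dist_eq_norm, h2, SchwartzMap.norm_toLp] at h
    rw [← ENNReal.ofReal_toReal ((ψ - ρ y).eLpNorm_lt_top P (μ := volume)).ne]
    exact ENNReal.ofReal_le_ofReal h.le
  exact ⟨key p h1.1, key r h1.2⟩

end dense

/-- Pairing with the indicator of `[-m, m]`, which has finite `L^p` norm, gives a finite integral of
the potential over that interval by Hardy–Littlewood–Sobolev. This makes the fixed-time bound on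
`u_t` useful at almost every `t`. -/
theorem ae_lintegral_rieszKernel_lt_top {p α : ℝ} (hα0 : 0 < α) (hα1 : α < 1)
    (hp : p = 2 / (2 - α)) {F : ℝ → ℝ≥0∞} (hF : AEMeasurable F)
    (hFp : (∫⁻ s, F s ^ p) ^ (1 / p) < ⊤) :
    ∀ᵐ t, ∫⁻ s, rieszKernel α (t - s) * F s < ⊤ := by
  have hp0 : 0 < p := by rw [hp]; apply div_pos <;> linarith
  have hm : AEMeasurable fun t ↦ ∫⁻ s, rieszKernel α (t - s) * F s := by
    have : AEMeasurable (fun z : ℝ × ℝ ↦ rieszKernel α (z.1 - z.2) * F z.2)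
        ((volume : Measure ℝ).prod volume) :=
      (measurable_rieszKernel_sub α).aemeasurable.mul hF.comp_snd
    exact this.lintegral_prod_right'
  have key : ∀ m : ℕ, ∀ᵐ t : ℝ, t ∈ Icc (-(m : ℝ)) m →
      ∫⁻ s, rieszKernel α (t - s) * F s < ⊤ := by
    intro m
    set G : ℝ → ℝ≥0∞ := (Icc (-(m : ℝ)) m).indicator 1 with hG
    have hGm : Measurable G := measurable_one.indicator measurableSet_Icc
    have h1 := rieszForm_le hα0 hα1 hp hF hGm.aemeasurable
    have h2 : (∫⁻ t, G t ^ p) ^ (1 / p) < ⊤ := by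
      refine ENNReal.rpow_lt_top_of_nonneg (by positivity) (ne_of_lt ?_)
      have : ∀ t, G t ^ p = (Icc (-(m : ℝ)) m).indicator 1 t := fun t ↦ by
        by_cases ht : t ∈ Icc (-(m : ℝ)) m <;> simp [hG, ht, hp0]
      simp only [this]
      rw [lintegral_indicator_one measurableSet_Icc]
      exact isCompact_Icc.measure_lt_top
    have h3 : rieszForm α F G = ∫⁻ t in Icc (-(m : ℝ)) m, ∫⁻ s, rieszKernel α (t - s) * F s := by
      rw [rieszForm, ← lintegral_indicator measurableSet_Icc]
      refine lintegral_congr fun t ↦ ?_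
      by_cases ht : t ∈ Icc (-(m : ℝ)) m <;> simp [hG, ht]
    have h4 : rieszForm α F G < ⊤ :=
      h1.trans_lt (ENNReal.mul_lt_top ENNReal.ofReal_lt_top (ENNReal.mul_lt_top hFp h2))
    rw [h3] at h4
    exact (ae_restrict_iff' measurableSet_Icc).1 (ae_lt_top' hm.restrict h4.ne)
  filter_upwards [ae_all_iff.2 key] with t ht
  obtain ⟨m, hm⟩ := exists_nat_ge |t|
  exact ht m (abs_le.1 hm)

section solution

variable {n : ℕ} {a : Fin n → ℝ} {k : Fin n → ℕ} {φ : Space n → ℂ} {f : ℝ × Space n → ℂ}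
  {u : ℝ → 𝓢'(Space n, ℂ)} {p q α : ℝ} {C : ℝ≥0}

/-- Unitarity controls the homogeneous term by the `L²` norm of `ψ`; decay controls the Duhamel term
by its `L^p` norm. Where the potential is finite, `u_T` is therefore continuous for the norm of `L²
∩ L^p`. -/
theorem IsSolution.enorm_apply_le (hu : IsSolution a k φ f u)
    (hd : HasDecay (dispersionSymbol a k) p q α C) (hpq : p.HolderConjugate q) (hφ : MemLp φ 2)
    (hf : MemLp f (ENNReal.ofReal p)) (T : ℝ) (ψ : 𝓢(Space n, ℂ)) :
    ‖u T ψ‖ₑ ≤ eLpNorm φ 2 * eLpNorm ψ 2 volume +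
      C * (∫⁻ r, rieszKernel α (T - r) * sliceNorm p f r) *
        eLpNorm ψ (ENNReal.ofReal p) volume := by
  have hb := hasTemperateGrowth_dispersionSymbol a k
  rw [hu.duhamel hpq hf T ψ]
  refine (enorm_add_le _ _).trans (add_le_add ?_ ?_)
  · have h1 : eLpNorm ψ 2 (volume : Measure (Space n)) =
        eLpNorm (propagator (dispersionSymbol a k) T ψ) 2 volume := by
      have := norm_toLp_propagator hb T ψ
      rw [SchwartzMap.norm_toLp, SchwartzMap.norm_toLp,
        ENNReal.toReal_eq_toReal_iff' (SchwartzMap.eLpNorm_lt_top _ _ _).ne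
          (SchwartzMap.eLpNorm_lt_top _ _ _).ne] at this
      exact this.symm
    rw [h1]
    have := enorm_integral_mul_le Real.HolderConjugate.two_two (p := 2) (q := 2)
      hφ.1 (propagator (dispersionSymbol a k) T ψ).continuous.aestronglyMeasurable
    simpa using this
  · rw [enorm_mul, ← ofReal_norm I, norm_I, ENNReal.ofReal_one, one_mul, ← ofReal_norm,
      intervalIntegral.norm_intervalIntegral_eq, ofReal_norm]
    refine (enorm_integral_le_lintegral_enorm _).trans
      ((setLIntegral_le_lintegral _ _).trans ?_)
    refine (lintegral_slicePairing_propagator_le hd hpq hf T ψ).trans_eq ?_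
    rw [lintegral_mul_const' _ _ (ψ.eLpNorm_lt_top (ENNReal.ofReal p) (μ := volume)).ne, mul_assoc]

/-- A weak solution acts on space-time test functions as an `L^q` function. -/
theorem IsSolution.exists_memLp (hu : IsSolution a k φ f u)
    (hd : HasDecay (dispersionSymbol a k) p q α C) (hpq : p.HolderConjugate q)
    (hα0 : 0 < α) (hα1 : α < 1) (hp : p = 2 / (2 - α)) (hφ : MemLp φ 2)
    (hf : MemLp f (ENNReal.ofReal p)) :
    ∃ U : ℝ × Space n → ℂ, MemLp U (ENNReal.ofReal q) ∧
      eLpNorm U (ENNReal.ofReal q) ≤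
        (C * hlsConst α + 1) * (eLpNorm φ 2 + eLpNorm f (ENNReal.ofReal p)) ∧
      ∀ η : ℝ → ℂ, Continuous η → HasCompactSupport η → ∀ ψ : 𝓢(Space n, ℂ),
        ∫ t, slicePairing U t ψ * η t = ∫ t, u t ψ * η t := by
  have hp1 : 1 < p := hpq.lt
  have hp2 : p < 2 := by rw [hp, div_lt_iff₀ (by linarith)]; linarith
  have : Fact (1 ≤ ENNReal.ofReal p) := ⟨by simpa using hp1.le⟩
  set K : ℝ≥0∞ := (C * hlsConst α + 1) * (eLpNorm φ 2 + eLpNorm f (ENNReal.ofReal p)) with hK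
  have hKt : K ≠ ⊤ := by
    refine (ENNReal.mul_lt_top (ENNReal.add_lt_top.2 ⟨ENNReal.mul_lt_top ENNReal.coe_lt_top
      ENNReal.ofReal_lt_top, ENNReal.one_lt_top⟩) (ENNReal.add_lt_top.2 ⟨hφ.2, hf.2⟩)).ne
  -- The functional is defined on formal combinations of tensors. No well-definedness on functions
  -- has to be checked: the estimate implies it afterwards.
  set ι := {η : ℝ → ℂ // Continuous η ∧ HasCompactSupport η} × 𝓢(Space n, ℂ)
  have hten : ∀ i : ι, MemLp (fun z : ℝ × Space n ↦ i.1.1 z.1 * i.2 z.2) (ENNReal.ofReal p) :=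
    fun i ↦ memLp_tensor hpq.pos i.1.2.1 i.1.2.2 i.2
  set V : (ι →₀ ℂ) →ₗ[ℂ] Lp ℂ (ENNReal.ofReal p) (volume : Measure (ℝ × Space n)) :=
    Finsupp.linearCombination ℂ fun i ↦ (hten i).toLp _ with hV
  set Λ : (ι →₀ ℂ) →ₗ[ℂ] ℂ := Finsupp.linearCombination ℂ fun i ↦ ∫ t, i.1.1 t * u t i.2 with hΛ
  have hbound : ∀ c, ‖Λ c‖ ≤ K.toReal * ‖V c‖ := by
    intro c
    have h1 := hu.enorm_integral_tensorSum_le hd hpq hα0 hα1 hp hφ hf (s := c.support)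
      (η := fun i t ↦ c i * i.1.1 t) (ψ := fun i ↦ i.2)
      (fun i _ ↦ continuous_const.mul i.1.2.1) (fun i _ ↦ i.1.2.2.mul_left)
    have h2 : ∫ t, u t (tensorSum c.support (fun i t ↦ c i * i.1.1 t) (fun i ↦ i.2) t) = Λ c := by
      rw [hΛ, Finsupp.linearCombination_apply, Finsupp.sum]
      have : ∀ t, u t (tensorSum c.support (fun i t ↦ c i * i.1.1 t) (fun i ↦ i.2) t)
          = ∑ i ∈ c.support, c i * (i.1.1 t * u t i.2) := fun t ↦ by
        simp only [tensorSum, map_sum, map_smul, smul_eq_mul, mul_assoc]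
      simp only [this]
      rw [integral_finsetSum]
      · simp only [integral_const_mul, smul_eq_mul]
      · intro i _
        exact ((i.1.2.1.mul (continuous_eval_distribution hu.continuous
          _)).integrable_of_hasCompactSupport i.1.2.2.mul_right).const_mul _
    have h3 : eLpNorm (fun z : ℝ × Space n ↦ tensorSum c.support (fun i t ↦ c i * i.1.1 t)
        (fun i ↦ i.2) z.1 z.2) (ENNReal.ofReal p) = ‖V c‖ₑ := by
      rw [Lp.enorm_def]
      refine eLpNorm_congr_ae ?_
      rw [hV, Finsupp.linearCombination_apply, Finsupp.sum]
      have hae : ∀ i ∈ c.support, ∀ᵐ z, (c i • (hten i).toLp _ : Lp ℂ (ENNReal.ofReal p) _) z =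
          c i * (i.1.1 z.1 * i.2 z.2) := by
        intro i _
        filter_upwards [Lp.coeFn_smul (c i) ((hten i).toLp _), (hten i).coeFn_toLp] with z e1 e2
        rw [e1, Pi.smul_apply, e2, smul_eq_mul]
      have hsum := Lp.coeFn_finsetSum c.support fun i ↦ c i • (hten i).toLp _
      filter_upwards [hsum, (Finset.eventually_all _).2 hae] with z e1 e2
      rw [e1, Finset.sum_apply, tensorSum_apply]
      refine Finset.sum_congr rfl fun i hi ↦ ?_
      rw [e2 i hi, mul_assoc]
    rw [h2, h3] at h1
    have h4 := ENNReal.toReal_mono (ENNReal.mul_ne_top hKt enorm_ne_top) h1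
    rwa [ENNReal.toReal_mul, toReal_enorm, toReal_enorm] at h4
  obtain ⟨L, hLn, hL⟩ := exists_functional_of_bound V Λ ENNReal.toReal_nonneg hbound
  obtain ⟨U, hU, hUn, hUrep⟩ := exists_memLp_repr hp1 hp2 hpq L
  refine ⟨U, hU, hUn.trans ((ENNReal.ofReal_le_ofReal hLn).trans_eq
    (ENNReal.ofReal_toReal hKt)), fun η hη hηc ψ ↦ ?_⟩
  set i : ι := (⟨η, hη, hηc⟩, ψ) with hi
  have h1 := hL (Finsupp.single i 1)
  rw [hV, hΛ, Finsupp.linearCombination_single, Finsupp.linearCombination_single, one_smul,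
    one_smul, hUrep _ (hten i)] at h1
  rw [← integral_mul_tensor hpq.symm hU hη hηc ψ]
  refine h1.trans ?_
  congr with t
  exact mul_comm _ _

/-- For one `ψ` the two functions of time agree almost everywhere, with a null set depending on `ψ`.
Restricting to a countable dense set gives a common null set. At almost every remaining time both
functionals are continuous for the `L² ∩ L^p` norm, the one given by `U` by Hölder, so equality
extends to all `ψ`. -/
theorem IsSolution.ae_isFunction (hu : IsSolution a k φ f u)
    (hd : HasDecay (dispersionSymbol a k) p q α C) (hpq : p.HolderConjugate q)
    (hα0 : 0 < α) (hα1 : α < 1) (hp : p = 2 / (2 - α)) (hφ : MemLp φ 2)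
    (hf : MemLp f (ENNReal.ofReal p)) {U : ℝ × Space n → ℂ} (hU : MemLp U (ENNReal.ofReal q))
    (hUu : ∀ η : ℝ → ℂ, Continuous η → HasCompactSupport η → ∀ ψ : 𝓢(Space n, ℂ),
        ∫ t, slicePairing U t ψ * η t = ∫ t, u t ψ * η t) :
    ∀ᵐ t : ℝ, IsFunction (u t) (fun x ↦ U (t, x)) := by
  have : Fact (1 ≤ ENNReal.ofReal p) := ⟨by simpa using hpq.lt.le⟩
  have : Fact (ENNReal.ofReal p ≠ ⊤) := ⟨ENNReal.ofReal_ne_top⟩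
  have : Fact ((2 : ℝ≥0∞) ≠ ⊤) := ⟨by simp⟩
  obtain ⟨D, hDc, hD⟩ := exists_countable_dense_schwartz (E := Space n) 2 (ENNReal.ofReal p)
  have hone : ∀ ψ : 𝓢(Space n, ℂ), ∀ᵐ t, slicePairing U t ψ = u t ψ := by
    intro ψ
    refine ae_eq_of_integral_contDiff_smul_eq (locallyIntegrable_slicePairing hpq.symm hU ψ)
      (continuous_eval_distribution hu.continuous ψ).locallyIntegrable fun g hg hgc ↦ ?_
    have := hUu (fun t ↦ (g t : ℂ)) (by have := hg.continuous; fun_prop)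
      (hgc.comp_left (g := ofReal) rfl) ψ
    simpa only [real_smul, mul_comm] using this
  have hDae : ∀ᵐ t, ∀ ψ ∈ D, slicePairing U t ψ = u t ψ :=
    (ae_ball_iff hDc).2 fun ψ _ ↦ hone ψ
  have hpot := ae_lintegral_rieszKernel_lt_top hα0 hα1 hp (aemeasurable_sliceNorm hpq.pos hf.1)
    (by rw [lintegral_sliceNorm_rpow hpq.pos hf.1]; exact hf.2)
  filter_upwards [hDae, hpot, ae_memLp_slice hpq.symm.pos hU, slicePairing_sub hpq.symm hU,
    enorm_slicePairing_le hpq.symm hU] with t h1 h2 h3 h4 h5 ψ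
  refine ⟨integrable_mul_of_memLp hpq.symm h3 (ψ.memLp _), ?_⟩
  change u t ψ = slicePairing U t ψ
  set W : ℝ≥0∞ := eLpNorm φ 2 + C * (∫⁻ r, rieszKernel α (t - r) * sliceNorm p f r) +
    sliceNorm q U t with hW
  have hWt : W ≠ ⊤ := (ENNReal.add_lt_top.2 ⟨ENNReal.add_lt_top.2 ⟨hφ.2,
    ENNReal.mul_lt_top ENNReal.coe_lt_top h2⟩, h3.2⟩).ne
  have key : ∀ ε > 0, ‖u t ψ - slicePairing U t ψ‖ₑ ≤ W * ENNReal.ofReal ε := by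
    intro ε hε
    obtain ⟨χ, hχD, hχ2, hχp⟩ := hD ψ ε hε
    have e1 : u t ψ - slicePairing U t ψ = u t (ψ - χ) - slicePairing U t (ψ - χ) := by
      rw [map_sub, h4, h1 χ hχD]
      ring
    rw [e1]
    calc _ ≤ ‖u t (ψ - χ)‖ₑ + ‖slicePairing U t (ψ - χ)‖ₑ := enorm_sub_le
      _ ≤ (eLpNorm φ 2 * ENNReal.ofReal ε +
          C * (∫⁻ r, rieszKernel α (t - r) * sliceNorm p f r) * ENNReal.ofReal ε) +
          sliceNorm q U t * ENNReal.ofReal ε := by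
        refine add_le_add ((hu.enorm_apply_le hd hpq hφ hf t _).trans ?_) ((h5 _).trans ?_)
        · exact add_le_add (mul_le_mul_right hχ2 _) (mul_le_mul_right hχp _)
        · exact mul_le_mul_right hχp _
      _ = _ := by rw [hW]; ring
  have key2 : ‖u t ψ - slicePairing U t ψ‖ ≤ 0 := by
    refine le_of_forall_pos_le_add fun ε hε ↦ ?_
    have h6 := key (ε / (W.toReal + 1)) (by positivity)
    have h7 := ENNReal.toReal_mono (ENNReal.mul_ne_top hWt ENNReal.ofReal_ne_top) h6
    rw [toReal_enorm, ENNReal.toReal_mul, ENNReal.toReal_ofReal (by positivity)] at h7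
    refine h7.trans ?_
    rw [zero_add, mul_div_assoc', div_le_iff₀ (by positivity)]
    nlinarith [ENNReal.toReal_nonneg (a := W)]
  exact sub_eq_zero.1 (norm_le_zero_iff.1 key2)

end solution
end Dispersive
end

/-! ### The space-time estimate. -/

theorem theorem1p4 (n : ℕ) (hn : 1 ≤ n) (a : Fin n → ℝ) (k : Fin n → ℕ)
    (ha : ∀ j, a j ≠ 0) (hk : ∀ j, 2 ≤ k j)
    (p : ℝ) (hp : p = 2 - 2 / (2 + ∑ j, 1 / (k j : ℝ))) :
    ∃ C : ℝ≥0, ∀ (φ : Dispersive.Space n → ℂ) (f : ℝ × Dispersive.Space n → ℂ)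
      (u : ℝ → 𝓢'(Dispersive.Space n, ℂ)),
      MemLp φ 2 → MemLp f (ENNReal.ofReal p) → Dispersive.IsSolution a k φ f u →
      ∃ U : ℝ × Dispersive.Space n → ℂ,
        (∀ᵐ t : ℝ, Dispersive.IsFunction (u t) (fun x ↦ U (t, x))) ∧
        MemLp U (ENNReal.ofReal (p / (p - 1))) ∧
        eLpNorm U (ENNReal.ofReal (p / (p - 1))) ≤
          C * (eLpNorm φ 2 + eLpNorm f (ENNReal.ofReal p)) := by
  have hσ : 0 < ∑ j, 1 / (k j : ℝ) := by
    refine Finset.sum_pos (fun j _ ↦ ?_) ⟨⟨0, hn⟩, Finset.mem_univ _⟩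
    have := hk j
    have : (0 : ℝ) < k j := by exact_mod_cast (by omega : 0 < k j)
    positivity
  set σ := ∑ j, 1 / (k j : ℝ) with hσd
  -- The interpolated decay exponent. It satisfies `p = 2 / (2 - α)`, the Hardy–Littlewood–Sobolev
  -- relation for equal exponents.
  set α := σ / (1 + σ) with hα
  have hα0 : 0 < α := by positivity
  have hα1 : α < 1 := by rw [hα, div_lt_one (by linarith)]; linarith
  have hpα : p = 2 / (2 - α) := by
    rw [hp, hα]
    have : 2 - σ / (1 + σ) = (2 + σ) / (1 + σ) := by field_simp; ring
    rw [this]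
    field_simp
    ring
  have hp1 : 1 < p := by rw [hpα, lt_div_iff₀ (by linarith)]; linarith
  have hpq : p.HolderConjugate (p / (p - 1)) := Real.HolderConjugate.conjExponent hp1
  obtain ⟨C, hC⟩ := Dispersive.exists_eLpNorm_propagator_le ha hk hσ hα hpα hpq
  refine ⟨C * (Dispersive.hlsConst α).toNNReal + 1, fun φ f u hφ hf hu ↦ ?_⟩
  obtain ⟨U, hU, hUn, hUu⟩ := hu.exists_memLp hC hpq hα0 hα1 hpα hφ hf
  refine ⟨U, hu.ae_isFunction hC hpq hα0 hα1 hpα hφ hf hU hUu, hU, hUn.trans_eq ?_⟩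
  rw [ENNReal.coe_add, ENNReal.coe_mul, ENNReal.coe_one,
    ENNReal.coe_toNNReal (show Dispersive.hlsConst α ≠ ⊤ from ENNReal.ofReal_ne_top)]
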